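/- Let $n>1$ and let $a_1,a_2\in\mathbb{C}\setminus\mathbb{Z}$ with $a_1-a_2\notin\mathbb{Z}$. Put $a=(-1,\dots,-1,a_1,a_2,0,\dots,0)\in\mathbb{C}^{2n}$, with $n-1$ entries $-1$ and $n-1$ entries $0$. Let $N_{a_1,a_2}$ be the complex vector space with basis the symbols $x(b)$, where $b\in\mathbb{C}^{2n}$ runs over the tuples such that $b_i-a_i\in\mathbb{Z}$ for all $i$, $b_i\in\mathbb{Z}_{<0}$ if and only if $a_i\in\mathbb{Z}_{<0}$, and $\sum_i b_i=\sum_i a_i$. The Lie algebra $\mathfrak{sl}_{2n}$ of traceless complex matrices acts on it by letting the elementary matrix $E_{i,j}$ act as $q_ip_j$, where $$q_i\,x(b)=\begin{cases}(b_i+1)\,x(b+\epsilon_i)& b_i\in\mathbb{Z}_{<0}\\ x(b+\epsilon_i)&\text{otherwise,}\end{cases}\qquad p_j\,x(b)=\begin{cases}x(b-\epsilon_j)& b_j\in\mathbb{Z}_{<0}\\ b_j\,x(b-\epsilon_j)&\text{otherwise,}\end{cases}$$ and $\epsilon_i$ is the $i$-th standard basis vector. Let $\mathfrak{b}\cong\mathfrak{sl}_n$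 be the subalgebra of the block matrices $\begin{pmatrix}A&0\\0&A\end{pmatrix}$ with $A\in\mathfrak{sl}_n$, and let $\mathfrak{a}\cong\mathfrak{sl}_2$ be the subalgebra of the block matrices $\begin{pmatrix}pI_n&qI_n\\rI_n&-pI_n\end{pmatrix}$ with $p,q,r\in\mathbb{C}$, identified with $\begin{pmatrix}p&q\\r&-p\end{pmatrix}\in\mathfrak{sl}_2$. Denote by $L(\lambda_1,\dots,\lambda_{n-1})$ the simple highest weight $\mathfrak{sl}_n$-module with respect to the upper triangular Borel subalgebra whose highest weight takes the value $\lambda_i$ on $E_{i,i}-E_{i+1,i+1}$, and by $L(\mu)$ the simple highest weight $\mathfrak{sl}_2$-module of highest weight $\mu$. Then: 1. $\mathfrak{a}$ and $\mathfrak{b}$ are the commutant of each other in $\mathfrak{sl}_{2n}$. 2. As a $\mathfrak{b}\oplus\mathfrak{a}$-module, $$N_{a_1,a_2}\cong\bigoplus_{b\in\mathbb{Z}}L(-1-a_1+a_2-2b)\otimes L(a_1-a_2+2b-1)\quad\text{if } n=2,$$ $$N_{a_1,a_2}\cong\bigoplus_{b\in\mathbb{Z}}L(a_2-b,0,\dots,0,-1-a_1-b)\otimes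 L(a_1-a_2+2b-(n-1))\quad\text{if } n>2,$$ where in each tensor product the first factor is a module over $\mathfrak{b}\cong\mathfrak{sl}_n$, the second one is a module over $\mathfrak{a}\cong\mathfrak{sl}_2$, and both factors as well as their tensor product are simple. 3. This decomposition is multiplicity free: any two isomorphic simple $\mathfrak{b}\oplus\mathfrak{a}$-submodules of $N_{a_1,a_2}$ are equal. 4. The resulting correspondence $L(-1-a_1+a_2-2b)\leftrightarrow L(a_1-a_2+2b-1)$ (for $n=2$), $L(a_2-b,0,\dots,0,-1-a_1-b)\leftrightarrow L(a_1-a_2+2b-(n-1))$ (for $n>2$), $b\in\mathbb{Z}$, between simple highest weight modules of $\mathfrak{b}$ and of $\mathfrak{a}$ is one-to-one: for distinct integers $b$ the first members are pairwise non-isomorphic, and so are the second members. -/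

import Mathlib

open scoped TensorProduct DirectSum
open LieAlgebra.SpecialLinear (sl)

noncomputable section

namespace DualPairSL

/-! ### Monomials with complex exponents and the Weyl algebra operators -/

/-- The complex vector space with basis the symbols `x(b)`, for `b` a tuple of complex numbers
indexed by `ι`. -/
def Mono (ι : Type) : Type := (ι → ℂ) →₀ ℂ

instance (ι : Type) : AddCommGroup (Mono ι) := inferInstanceAs (AddCommGroup ((ι → ℂ) →₀ ℂ))
instance (ι : Type) : Module ℂ (Mono ι) := inferInstanceAs (Module ℂ ((ι → ℂ) →₀ ℂ))

/-- The basis vector `x(b)`. -/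
def mono {ι : Type} (b : ι → ℂ) : Mono ι := Finsupp.single b (1 : ℂ)

/-- `z` is a (strictly) negative integer. -/
def IsNegInt (z : ℂ) : Prop := ∃ k : ℤ, k < 0 ∧ z = k

instance : DecidablePred IsNegInt := Classical.decPred _

/-- The operator `q_i`: it sends `x(b)` to `(b_i + 1) x(b + ε_i)` if `b_i` is a negative integer,
and to `x(b + ε_i)` otherwise. -/
def qOp {ι : Type} [DecidableEq ι] (i : ι) : Module.End ℂ (Mono ι) :=
  Finsupp.linearCombination ℂ fun b : ι → ℂ =>
    if IsNegInt (b i) then (b i + 1) • mono (b + Pi.single i 1) else mono (b + Pi.single i 1)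

/-- The operator `p_j`: it sends `x(b)` to `x(b - ε_j)` if `b_j` is a negative integer,
and to `b_j x(b - ε_j)` otherwise. -/
def pOp {ι : Type} [DecidableEq ι] (j : ι) : Module.End ℂ (Mono ι) :=
  Finsupp.linearCombination ℂ fun b : ι → ℂ =>
    if IsNegInt (b j) then mono (b - Pi.single j 1) else b j • mono (b - Pi.single j 1)

section Weyl

theorem isNegInt_add_one {z : ℂ} (hz : z ≠ -1) : IsNegInt (z + 1) ↔ IsNegInt z := by
  constructor
  · rintro ⟨k, hk, h⟩
    exact ⟨k - 1, by omega, by push_cast; rw [← h]; ring⟩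
  · rintro ⟨k, hk, h⟩
    have : k ≠ -1 := by rintro rfl; apply hz; rw [h]; norm_num
    exact ⟨k + 1, by omega, by push_cast; rw [← h]⟩

theorem isNegInt_sub_one {z : ℂ} (hz : z ≠ 0) : IsNegInt (z - 1) ↔ IsNegInt z := by
  rw [← isNegInt_add_one (z := z - 1) (by intro h; apply hz; linear_combination h),
    sub_add_cancel]

theorem isNegInt_neg_one : IsNegInt (-1) := ⟨-1, by norm_num, by norm_num⟩

theorem not_isNegInt_zero : ¬ IsNegInt 0 := by
  rintro ⟨k, hk, h⟩
  have : k = 0 := by exact_mod_cast h.symm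
  omega

theorem mono_ext {ι : Type} {f g : Module.End ℂ (Mono ι)}
    (h : ∀ b, f (mono b) = g (mono b)) : f = g :=
  Finsupp.lhom_ext' fun b => LinearMap.ext_ring (h b)

variable {ι : Type} [DecidableEq ι]

theorem qOp_mono (i : ι) (b : ι → ℂ) :
    qOp i (mono b) = (if IsNegInt (b i) then b i + 1 else 1) • mono (b + Pi.single i 1) := by
  have h : qOp i (mono b) = (1 : ℂ) • (if IsNegInt (b i) then
      (b i + 1) • mono (b + Pi.single i 1) else mono (b + Pi.single i 1)) :=
    Finsupp.linearCombination_single ℂ 1 b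
  rw [h]; split_ifs <;> simp

theorem pOp_mono (j : ι) (b : ι → ℂ) :
    pOp j (mono b) = (if IsNegInt (b j) then 1 else b j) • mono (b - Pi.single j 1) := by
  have h : pOp j (mono b) = (1 : ℂ) • (if IsNegInt (b j) then
      mono (b - Pi.single j 1) else b j • mono (b - Pi.single j 1)) :=
    Finsupp.linearCombination_single ℂ 1 b
  rw [h]; split_ifs <;> simp

theorem qOp_comm (i j : ι) : qOp i * qOp j = qOp j * qOp i := by
  refine mono_ext fun b => ?_
  by_cases hij : i = j
  · rw [hij]
  · simp only [Module.End.mul_apply, qOp_mono, map_smul, smul_smul, Pi.add_apply]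
    rw [Pi.single_eq_of_ne hij, Pi.single_eq_of_ne (Ne.symm hij), add_zero, add_zero,
      add_right_comm, mul_comm]

theorem pOp_comm (i j : ι) : pOp i * pOp j = pOp j * pOp i := by
  refine mono_ext fun b => ?_
  by_cases hij : i = j
  · rw [hij]
  · simp only [Module.End.mul_apply, pOp_mono, map_smul, smul_smul, Pi.sub_apply]
    rw [Pi.single_eq_of_ne hij, Pi.single_eq_of_ne (Ne.symm hij), sub_zero, sub_zero,
      sub_right_comm, mul_comm]

theorem pOp_qOp (j i : ι) :
    pOp j * qOp i = qOp i * pOp j + (if j = i then 1 else 0) := by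
  refine mono_ext fun b => ?_
  by_cases hij : j = i
  · subst hij
    simp only [Module.End.mul_apply, LinearMap.add_apply, if_true, Module.End.one_apply,
      qOp_mono, pOp_mono, map_smul, smul_smul, Pi.sub_apply, Pi.add_apply, Pi.single_eq_same]
    rw [add_sub_cancel_right, sub_add_cancel, sub_add_cancel]
    have key : ((if IsNegInt (b j) then b j + 1 else 1) *
        if IsNegInt (b j + 1) then 1 else b j + 1) =
        ((if IsNegInt (b j) then 1 else b j) * if IsNegInt (b j - 1) then b j else 1) + 1 := by
      by_cases h1 : b j = -1
      · have h2 : IsNegInt (b j - 1) := ⟨-2, by norm_num, by rw [h1]; norm_num⟩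
        have h3 : IsNegInt (b j) := h1 ▸ isNegInt_neg_one
        rw [if_pos h3, if_pos h3, if_pos h2, h1]
        norm_num
      · simp only [isNegInt_add_one h1]
        by_cases h0 : b j = 0
        · have h3 : ¬ IsNegInt (b j) := h0 ▸ not_isNegInt_zero
          rw [if_neg h3, if_neg h3, if_neg h3, h0]
          norm_num
        · simp only [isNegInt_sub_one h0]
          split_ifs <;> ring
    rw [key, add_smul, one_smul]
  · simp only [Module.End.mul_apply, LinearMap.add_apply, if_neg hij, LinearMap.zero_apply,
      qOp_mono, pOp_mono, map_smul, smul_smul, Pi.sub_apply, Pi.add_apply]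
    rw [Pi.single_eq_of_ne hij, Pi.single_eq_of_ne (Ne.symm hij), add_zero, sub_zero,
      add_zero, add_sub_right_comm, mul_comm]

end Weyl

/-! ### The action of matrices: the elementary matrix `E_{ij}` acts as `q_i p_j` -/

section Action

theorem sum_pair_comm {ι : Type} [Fintype ι] (f : ι → ι → ι → ι → Module.End ℂ (Mono ι)) :
    ∑ i, ∑ j, ∑ k, ∑ l, f i j k l = ∑ k, ∑ l, ∑ i, ∑ j, f i j k l := by
  have h1 : ∀ g : ι → ι → ι → ι → Module.End ℂ (Mono ι),
      ∑ i, ∑ j, ∑ k, ∑ l, g i j k l = ∑ p : ι × ι, ∑ r : ι × ι, g p.1 p.2 r.1 r.2 := by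
    intro g
    simp only [Fintype.sum_prod_type]
  rw [h1, h1 fun k l i j => f i j k l, Finset.sum_comm]

variable {ι : Type} [Fintype ι] [DecidableEq ι]

/-- The operator by which a matrix acts; `E_{ij}` acts as `q_i p_j`. -/
def matAct (A : Matrix ι ι ℂ) : Module.End ℂ (Mono ι) :=
  ∑ i, ∑ j, A i j • (qOp i * pOp j)

theorem matAct_add (A B : Matrix ι ι ℂ) : matAct (A + B) = matAct A + matAct B := by
  simp [matAct, add_smul, Finset.sum_add_distrib]

theorem matAct_smul (c : ℂ) (A : Matrix ι ι ℂ) : matAct (c • A) = c • matAct A := by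
  simp [matAct, mul_smul, Finset.smul_sum]

theorem matAct_mul (A B : Matrix ι ι ℂ) :
    matAct A * matAct B = matAct (A * B) +
      ∑ i, ∑ j, ∑ k, ∑ l, (A i j * B k l) • (qOp i * qOp k * (pOp j * pOp l)) := by
  have key : ∀ i j k l : ι, (qOp i * pOp j) * (qOp k * pOp l) =
      qOp i * qOp k * (pOp j * pOp l) + (if j = k then qOp i * pOp l else 0) := by
    intro i j k l
    have : (qOp i * pOp j) * (qOp k * pOp l) = qOp i * (pOp j * qOp k) * pOp l := by
      simp only [mul_assoc]
    rw [this, pOp_qOp]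
    split_ifs <;> simp [mul_add, add_mul, mul_assoc]
  have h : matAct A * matAct B = ∑ i, ∑ j, ∑ k, ∑ l,
      (A i j * B k l) • ((qOp i * pOp j) * (qOp k * pOp l)) := by
    simp only [matAct, Finset.sum_mul, Finset.mul_sum, smul_mul_smul_comm]
    rw [sum_pair_comm]
  have h2 : matAct (A * B) = ∑ i, ∑ j, ∑ k, ∑ l,
      (A i j * B k l) • (if j = k then qOp i * pOp l else 0) := by
    simp only [matAct, Matrix.mul_apply, Finset.sum_smul, smul_ite, smul_zero]
    refine Finset.sum_congr rfl fun i _ => ?_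
    rw [Finset.sum_comm]
    refine Finset.sum_congr rfl fun j _ => ?_
    rw [Finset.sum_comm]
    refine Finset.sum_congr rfl fun l _ => ?_
    rw [Finset.sum_ite_eq, if_pos (Finset.mem_univ _)]
  rw [h, h2]
  simp only [key, smul_add, Finset.sum_add_distrib]
  rw [add_comm]

theorem matAct_comm (A B : Matrix ι ι ℂ) :
    matAct (A * B - B * A) = matAct A * matAct B - matAct B * matAct A := by
  have hs : matAct (A * B - B * A) = matAct (A * B) - matAct (B * A) := by
    rw [sub_eq_add_neg, ← neg_one_smul ℂ (B * A), matAct_add, matAct_smul, neg_one_smul,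
      sub_eq_add_neg]
  have hsym : ∑ i, ∑ j, ∑ k, ∑ l, (A i j * B k l) • (qOp i * qOp k * (pOp j * pOp l)) =
      ∑ i, ∑ j, ∑ k, ∑ l, (B i j * A k l) • (qOp i * qOp k * (pOp j * pOp l)) := by
    rw [sum_pair_comm]
    refine Finset.sum_congr rfl fun k _ => Finset.sum_congr rfl fun l _ =>
      Finset.sum_congr rfl fun i _ => Finset.sum_congr rfl fun j _ => ?_
    rw [mul_comm, qOp_comm i k, pOp_comm j l]
  rw [hs, matAct_mul A B, matAct_mul B A, hsym]
  abel

instance : LieRingModule (sl ι ℂ) (Mono ι) where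
  bracket A m := matAct A.val m
  add_lie A B m := by
    change matAct (A.val + B.val) m = _
    rw [matAct_add]; rfl
  lie_add A m m' := map_add _ _ _
  leibniz_lie A B m := by
    change matAct A.val (matAct B.val m) = matAct (A.val * B.val - B.val * A.val) m +
      matAct B.val (matAct A.val m)
    rw [matAct_comm]
    simp

instance : LieModule ℂ (sl ι ℂ) (Mono ι) where
  smul_lie c A m := by
    change matAct (c • A.val) m = _
    rw [matAct_smul]; rfl
  lie_smul c A m := map_smul _ _ _

end Action

/-! ### The module `N(a)` -/

/-- The set `P_a`: tuples which differ from `a` by integers and which have negative integer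
entries exactly where `a` has. -/
def expSet {ι : Type} (a : ι → ℂ) : Set (ι → ℂ) :=
  {b | ∀ i, (∃ k : ℤ, b i - a i = k) ∧ (IsNegInt (b i) ↔ IsNegInt (a i))}

/-- The set of admissible tuples: elements of `P_a` with the same sum of entries as `a`. -/
def admSet {ι : Type} [Fintype ι] (a : ι → ℂ) : Set (ι → ℂ) :=
  {b | b ∈ expSet a ∧ ∑ i, b i = ∑ i, a i}

section NMod

variable {ι : Type} [DecidableEq ι]

theorem qOp_pOp_mem (a : ι → ℂ) (i j : ι) {b : ι → ℂ} (hb : b ∈ expSet a) :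
    qOp i (pOp j (mono b)) = 0 ∨ b - Pi.single j 1 + Pi.single i 1 ∈ expSet a := by
  by_cases h0 : b j = 0
  · left
    rw [pOp_mono, if_neg (h0 ▸ not_isNegInt_zero), h0, zero_smul, map_zero]
  have h1 : b - Pi.single j 1 ∈ expSet a := by
    intro k
    obtain ⟨⟨m, hm⟩, hk⟩ := hb k
    by_cases hkj : k = j
    · subst hkj
      rw [Pi.sub_apply, Pi.single_eq_same, isNegInt_sub_one h0]
      exact ⟨⟨m - 1, by push_cast; rw [← hm]; ring⟩, hk⟩
    · rw [Pi.sub_apply, Pi.single_eq_of_ne hkj, sub_zero]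
      exact ⟨⟨m, hm⟩, hk⟩
  rw [pOp_mono, map_smul]
  generalize b - Pi.single j 1 = d at h1 ⊢
  by_cases h2 : d i = -1
  · left
    rw [qOp_mono, h2, if_pos isNegInt_neg_one]
    simp
  right
  intro k
  obtain ⟨⟨m, hm⟩, hk⟩ := h1 k
  by_cases hki : k = i
  · subst hki
    rw [Pi.add_apply, Pi.single_eq_same, isNegInt_add_one h2]
    exact ⟨⟨m + 1, by push_cast; rw [← hm]; ring⟩, hk⟩
  · rw [Pi.add_apply, Pi.single_eq_of_ne hki, add_zero]
    exact ⟨⟨m, hm⟩, hk⟩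

variable [Fintype ι]

/-- The `sl`-module `N(a)`: the span of the basis vectors `x(b)` for `b` admissible. -/
def modN (a : ι → ℂ) : LieSubmodule ℂ (sl ι ℂ) (Mono ι) where
  toSubmodule := Submodule.span ℂ (mono '' admSet a)
  lie_mem := by
    intro A m hm
    change matAct A.val m ∈ Submodule.span ℂ (mono '' admSet a)
    change m ∈ Submodule.span ℂ (mono '' admSet a) at hm
    induction hm using Submodule.span_induction with
    | zero => rw [map_zero]; exact Submodule.zero_mem _
    | add x y _ _ hx hy => rw [map_add]; exact Submodule.add_mem _ hx hy
    | smul c x _ hx => rw [map_smul]; exact Submodule.smul_mem _ _ hx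
    | mem x hx =>
      obtain ⟨b, hb, rfl⟩ := hx
      simp only [matAct, LinearMap.sum_apply, LinearMap.smul_apply, Module.End.mul_apply]
      refine Submodule.sum_mem _ fun i _ => Submodule.sum_mem _ fun j _ =>
        Submodule.smul_mem _ _ ?_
      rcases qOp_pOp_mem a i j hb.1 with h | h
      · rw [h]; exact Submodule.zero_mem _
      · rw [pOp_mono, map_smul, qOp_mono]
        refine Submodule.smul_mem _ _ (Submodule.smul_mem _ _ (Submodule.subset_span
          ⟨_, ⟨h, ?_⟩, rfl⟩))
        simp only [Pi.add_apply, Pi.sub_apply, Finset.sum_add_distrib, Finset.sum_sub_distrib,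
          Finset.sum_pi_single', Finset.mem_univ, if_true]
        rw [hb.2]; ring

end NMod

/-! ### The dual pair -/

section Pair

variable (n : ℕ)

/-- The embedding of `sl_n` in `sl_{2n}` given by `A ↦ diag(A, A)`. -/
def embB : sl (Fin n) ℂ →ₗ⁅ℂ⁆ sl (Fin n ⊕ Fin n) ℂ where
  toFun A := ⟨Matrix.fromBlocks A.val 0 0 A.val, by
    have hA : Matrix.trace A.val = 0 := A.2
    change Matrix.trace (Matrix.fromBlocks A.val 0 0 A.val) = 0
    simp only [Matrix.trace, Fintype.sum_sum_type] at hA ⊢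
    simpa using hA⟩
  map_add' A B := by
    apply Subtype.ext
    change Matrix.fromBlocks (A.val + B.val) 0 0 (A.val + B.val) =
      Matrix.fromBlocks A.val 0 0 A.val + Matrix.fromBlocks B.val 0 0 B.val
    simp [Matrix.fromBlocks_add]
  map_smul' c A := by
    apply Subtype.ext
    change Matrix.fromBlocks (c • A.val) 0 0 (c • A.val) = c • Matrix.fromBlocks A.val 0 0 A.val
    simp [Matrix.fromBlocks_smul]
  map_lie' {A B} := by
    apply Subtype.ext
    change Matrix.fromBlocks (A.val * B.val - B.val * A.val) 0 0 (A.val * B.val - B.val * A.val) =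
      Matrix.fromBlocks A.val 0 0 A.val * Matrix.fromBlocks B.val 0 0 B.val -
      Matrix.fromBlocks B.val 0 0 B.val * Matrix.fromBlocks A.val 0 0 A.val
    simp [Matrix.fromBlocks_multiply, sub_eq_add_neg, Matrix.fromBlocks_neg, Matrix.fromBlocks_add]

/-- The block matrix whose four blocks are the scalar matrices given by the entries of `M`. -/
def scalarBlocks (M : Matrix (Fin 2) (Fin 2) ℂ) : Matrix (Fin n ⊕ Fin n) (Fin n ⊕ Fin n) ℂ :=
  Matrix.fromBlocks (M 0 0 • 1) (M 0 1 • 1) (M 1 0 • 1) (M 1 1 • 1)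

theorem scalarBlocks_mul (M M' : Matrix (Fin 2) (Fin 2) ℂ) :
    scalarBlocks n (M * M') = scalarBlocks n M * scalarBlocks n M' := by
  simp only [scalarBlocks, Matrix.fromBlocks_multiply, Matrix.mul_apply, Fin.sum_univ_two,
    smul_mul_smul_comm, mul_one, add_smul]

theorem scalarBlocks_sub (M M' : Matrix (Fin 2) (Fin 2) ℂ) :
    scalarBlocks n (M - M') = scalarBlocks n M - scalarBlocks n M' := by
  simp [scalarBlocks, sub_eq_add_neg, Matrix.fromBlocks_neg, Matrix.fromBlocks_add, add_smul]

/-- The embedding of `sl_2` in `sl_{2n}` by matrices with scalar blocks. The image of the standard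
basis `E_{12}, E_{11} - E_{22}, E_{21}` of `sl_2` is `Y = ∑ E_{i,n+i}`,
`H = ∑ (E_{i,i} - E_{n+i,n+i})`, `X = ∑ E_{n+i,i}`. -/
def embA : sl (Fin 2) ℂ →ₗ⁅ℂ⁆ sl (Fin n ⊕ Fin n) ℂ where
  toFun M := ⟨scalarBlocks n M.val, by
    have hM : Matrix.trace M.val = 0 := M.2
    rw [Matrix.trace_fin_two] at hM
    change Matrix.trace (scalarBlocks n M.val) = 0
    simp only [scalarBlocks, Matrix.trace, Fintype.sum_sum_type, Matrix.diag_apply,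
      Matrix.fromBlocks_apply₁₁, Matrix.fromBlocks_apply₂₂, Matrix.smul_apply,
      Matrix.one_apply_eq, ← Finset.sum_add_distrib, ← add_smul, hM, zero_smul,
      Finset.sum_const_zero]⟩
  map_add' M M' := by
    apply Subtype.ext
    change scalarBlocks n (M.val + M'.val) = scalarBlocks n M.val + scalarBlocks n M'.val
    simp [scalarBlocks, Matrix.fromBlocks_add, add_smul]
  map_smul' c M := by
    apply Subtype.ext
    change scalarBlocks n (c • M.val) = c • scalarBlocks n M.val
    simp [scalarBlocks, Matrix.fromBlocks_smul, mul_smul]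
  map_lie' {M M'} := by
    apply Subtype.ext
    change scalarBlocks n (M.val * M'.val - M'.val * M.val) =
      scalarBlocks n M.val * scalarBlocks n M'.val - scalarBlocks n M'.val * scalarBlocks n M.val
    rw [scalarBlocks_sub, scalarBlocks_mul, scalarBlocks_mul]

theorem emb_commute (A : sl (Fin n) ℂ) (M : sl (Fin 2) ℂ) : ⁅embB n A, embA n M⁆ = 0 := by
  apply Subtype.ext
  change Matrix.fromBlocks A.val 0 0 A.val * scalarBlocks n M.val -
    scalarBlocks n M.val * Matrix.fromBlocks A.val 0 0 A.val = 0
  simp [scalarBlocks, Matrix.fromBlocks_multiply]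

/-- The homomorphism `sl_n ⊕ sl_2 → sl_{2n}` given by the two embeddings. -/
def embPair : sl (Fin n) ℂ × sl (Fin 2) ℂ →ₗ⁅ℂ⁆ sl (Fin n ⊕ Fin n) ℂ where
  toFun x := embB n x.1 + embA n x.2
  map_add' x y := by
    simp only [Prod.fst_add, Prod.snd_add, map_add]; abel
  map_smul' c x := by simp
  map_lie' {x y} := by
    have h : ⁅embA n x.2, embB n y.1⁆ = 0 := by rw [← lie_skew, emb_commute, neg_zero]
    change embB n ⁅x.1, y.1⁆ + embA n ⁅x.2, y.2⁆ = _
    simp [h, emb_commute]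

/-- Two Lie subalgebras are the commutant of each other. -/
def MutualCommutants {L : Type} [LieRing L] [LieAlgebra ℂ L] (𝔟 𝔞 : LieSubalgebra ℂ L) : Prop :=
  (∀ x : L, x ∈ 𝔞 ↔ ∀ y ∈ 𝔟, ⁅x, y⁆ = 0) ∧ (∀ x : L, x ∈ 𝔟 ↔ ∀ y ∈ 𝔞, ⁅x, y⁆ = 0)

/-- The tuple `(-1, …, -1, a₁, a₂, 0, …, 0)`, with `n - 1` entries `-1` and `n - 1` entries `0`;
its first `n` entries are indexed by the left copy of `Fin n`, the others by the right copy. -/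
def expTuple (a₁ a₂ : ℂ) : Fin n ⊕ Fin n → ℂ :=
  Sum.elim (fun i => if i.val + 1 = n then a₁ else -1) (fun i => if i.val = 0 then a₂ else 0)

/-- The restriction to `sl_n ⊕ sl_2` of the `sl_{2n}`-module `N_{a₁,a₂}`. -/
def NRes (a₁ a₂ : ℂ) : Type := modN (expTuple n a₁ a₂)

instance (a₁ a₂ : ℂ) : AddCommGroup (NRes n a₁ a₂) :=
  inferInstanceAs (AddCommGroup (modN (expTuple n a₁ a₂)))
instance (a₁ a₂ : ℂ) : Module ℂ (NRes n a₁ a₂) :=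
  inferInstanceAs (Module ℂ (modN (expTuple n a₁ a₂)))
instance (a₁ a₂ : ℂ) : LieRingModule (sl (Fin n) ℂ × sl (Fin 2) ℂ) (NRes n a₁ a₂) :=
  LieRingModule.compLieHom (modN (expTuple n a₁ a₂)) (embPair n)
instance (a₁ a₂ : ℂ) : LieModule ℂ (sl (Fin n) ℂ × sl (Fin 2) ℂ) (NRes n a₁ a₂) :=
  LieModule.compLieHom (modN (expTuple n a₁ a₂)) (embPair n)

end Pair

/-! ### Simple highest weight modules of `sl_n` -/

section HighestWeight

variable (n : ℕ)

/-- The universal enveloping algebra of `sl_n`. -/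
abbrev Usl : Type := UniversalEnvelopingAlgebra ℂ (sl (Fin n) ℂ)

variable {n}

/-- The simple coroot `H_i = E_{i,i} - E_{i+1,i+1}`. -/
def coroot (i : Fin (n - 1)) : sl (Fin n) ℂ :=
  LieAlgebra.SpecialLinear.singleSubSingle ⟨i.val, by omega⟩ ⟨i.val + 1, by omega⟩ 1

/-- The left ideal of the enveloping algebra generated by the strictly upper triangular elementary
matrices and by the elements `H_i - lam_i`. -/
def vermaIdeal (lam : Fin (n - 1) → ℂ) : Submodule (Usl n) (Usl n) :=
  Submodule.span (Usl n)
    ({u | ∃ (i j : Fin n) (h : i < j), u =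
        UniversalEnvelopingAlgebra.ι ℂ (LieAlgebra.SpecialLinear.single i j h.ne 1)} ∪
     {u | ∃ i : Fin (n - 1), u = UniversalEnvelopingAlgebra.ι ℂ (coroot i) -
        algebraMap ℂ (Usl n) (lam i)})

/-- The Verma module of highest weight `lam`, a weight being given by its values on the simple
coroots. -/
abbrev Verma (lam : Fin (n - 1) → ℂ) : Type := Usl n ⧸ vermaIdeal lam

/-- The sum of all proper submodules of the Verma module. -/
def vermaRadical (lam : Fin (n - 1) → ℂ) : Submodule (Usl n) (Verma lam) :=
  sSup {P | P ≠ ⊤}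

/-- The simple highest weight module `L(lam)` of `sl_n`, the quotient of the Verma module by its
largest proper submodule. -/
def SimpleHW (lam : Fin (n - 1) → ℂ) : Type := Verma lam ⧸ vermaRadical lam

instance (lam : Fin (n - 1) → ℂ) : AddCommGroup (SimpleHW lam) :=
  inferInstanceAs (AddCommGroup (Verma lam ⧸ vermaRadical lam))
instance (lam : Fin (n - 1) → ℂ) : Module (Usl n) (SimpleHW lam) :=
  inferInstanceAs (Module (Usl n) (Verma lam ⧸ vermaRadical lam))
instance (lam : Fin (n - 1) → ℂ) : Module ℂ (SimpleHW lam) :=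
  inferInstanceAs (Module ℂ (Verma lam ⧸ vermaRadical lam))
instance (lam : Fin (n - 1) → ℂ) : IsScalarTower ℂ (Usl n) (SimpleHW lam) :=
  inferInstanceAs (IsScalarTower ℂ (Usl n) (Verma lam ⧸ vermaRadical lam))

attribute [local instance 100] LieRing.ofAssociativeRing

instance (lam : Fin (n - 1) → ℂ) : LieRingModule (sl (Fin n) ℂ) (SimpleHW lam) where
  bracket x m := UniversalEnvelopingAlgebra.ι ℂ x • m
  add_lie x y m := by
    change UniversalEnvelopingAlgebra.ι ℂ (x + y) • m = _
    rw [map_add, add_smul]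
  lie_add x m m' := smul_add _ _ _
  leibniz_lie x y m := by
    change UniversalEnvelopingAlgebra.ι ℂ x • UniversalEnvelopingAlgebra.ι ℂ y • m =
      UniversalEnvelopingAlgebra.ι ℂ ⁅x, y⁆ • m +
        UniversalEnvelopingAlgebra.ι ℂ y • UniversalEnvelopingAlgebra.ι ℂ x • m
    rw [LieHom.map_lie, LieRing.of_associative_ring_bracket, sub_smul, mul_smul, mul_smul,
      sub_add_cancel]

instance (lam : Fin (n - 1) → ℂ) : LieModule ℂ (sl (Fin n) ℂ) (SimpleHW lam) where
  smul_lie c x m := by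
    change UniversalEnvelopingAlgebra.ι ℂ (c • x) • m = c • UniversalEnvelopingAlgebra.ι ℂ x • m
    rw [map_smul, smul_assoc]
  lie_smul c x m := by
    change UniversalEnvelopingAlgebra.ι ℂ x • c • m = c • UniversalEnvelopingAlgebra.ι ℂ x • m
    rw [← algebraMap_smul (Usl n) c m, ← algebraMap_smul (Usl n) c (_ • m), smul_smul, smul_smul,
      Algebra.commutes]

end HighestWeight

/-! ### External tensor products and multiplicity freeness -/

section External

variable (L₁ L₂ V W : Type) [LieRing L₁] [LieAlgebra ℂ L₁] [LieRing L₂] [LieAlgebra ℂ L₂]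
  [AddCommGroup V] [Module ℂ V] [AddCommGroup W] [Module ℂ W]

/-- The external tensor product of an `L₁`-module `V` and an `L₂`-module `W`, on which
`L₁ ⊕ L₂` acts by `(x, y) · (v ⊗ w) = x v ⊗ w + v ⊗ y w`. -/
def ExtTensor : Type := V ⊗[ℂ] W

instance : AddCommGroup (ExtTensor V W) := inferInstanceAs (AddCommGroup (V ⊗[ℂ] W))
instance : Module ℂ (ExtTensor V W) := inferInstanceAs (Module ℂ (V ⊗[ℂ] W))

variable [LieRingModule L₁ V] [LieModule ℂ L₁ V] [LieRingModule L₂ W] [LieModule ℂ L₂ W]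

/-- The operator by which an element of `L₁ ⊕ L₂` acts on the external tensor product. -/
def extAct (x : L₁ × L₂) : V ⊗[ℂ] W →ₗ[ℂ] V ⊗[ℂ] W :=
  (LieModule.toEnd ℂ L₁ V x.1).rTensor W + (LieModule.toEnd ℂ L₂ W x.2).lTensor V

theorem extAct_add (x y : L₁ × L₂) :
    extAct L₁ L₂ V W (x + y) = extAct L₁ L₂ V W x + extAct L₁ L₂ V W y := by
  simp only [extAct, Prod.fst_add, Prod.snd_add, map_add, LinearMap.rTensor_add,
    LinearMap.lTensor_add]
  abel

theorem extAct_smul (c : ℂ) (x : L₁ × L₂) :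
    extAct L₁ L₂ V W (c • x) = c • extAct L₁ L₂ V W x := by
  simp only [extAct, Prod.smul_fst, Prod.smul_snd, map_smul, LinearMap.rTensor_smul,
    LinearMap.lTensor_smul, smul_add]

theorem extAct_lie (x y : L₁ × L₂) :
    extAct L₁ L₂ V W x ∘ₗ extAct L₁ L₂ V W y =
      extAct L₁ L₂ V W ⁅x, y⁆ + extAct L₁ L₂ V W y ∘ₗ extAct L₁ L₂ V W x := by
  refine TensorProduct.ext' fun v w => ?_
  simp only [extAct, LinearMap.comp_apply, LinearMap.add_apply, LinearMap.rTensor_tmul,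
    LinearMap.lTensor_tmul, map_add, LieModule.toEnd_apply_apply,
    LieAlgebra.Prod.bracket_apply, lie_lie, TensorProduct.sub_tmul, TensorProduct.tmul_sub]
  abel

instance : LieRingModule (L₁ × L₂) (ExtTensor V W) where
  bracket x m := extAct L₁ L₂ V W x m
  add_lie x y m := LinearMap.congr_fun (extAct_add L₁ L₂ V W x y) m
  lie_add x m m' := map_add (extAct L₁ L₂ V W x) m m'
  leibniz_lie x y m := LinearMap.congr_fun (extAct_lie L₁ L₂ V W x y) m

instance : LieModule ℂ (L₁ × L₂) (ExtTensor V W) where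
  smul_lie c x m := LinearMap.congr_fun (extAct_smul L₁ L₂ V W c x) m
  lie_smul c x m := map_smul (extAct L₁ L₂ V W x) c m

end External

/-- A (semisimple) module is multiplicity free: isomorphic simple submodules are equal. -/
def MultiplicityFree (L M : Type) [LieRing L] [LieAlgebra ℂ L] [AddCommGroup M] [Module ℂ M]
    [LieRingModule L M] [LieModule ℂ L M] : Prop :=
  ∀ P Q : LieSubmodule ℂ L M, LieModule.IsIrreducible ℂ L P → LieModule.IsIrreducible ℂ L Q →
    Nonempty (P ≃ₗ⁅ℂ,L⁆ Q) → P = Q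

/-! ### The highest weights -/

/-- The weight of `sl_n` attached to the integer `b`: it is `(-1 - a₁ + a₂ - 2b)` if `n = 2`, and
`(a₂ - b, 0, …, 0, -1 - a₁ - b)` if `n > 2`. -/
def weightB (n : ℕ) (a₁ a₂ : ℂ) (b : ℤ) : Fin (n - 1) → ℂ := fun i =>
  if n = 2 then -1 - a₁ + a₂ - 2 * b
  else if i.val = 0 then a₂ - b
  else if i.val + 2 = n then -1 - a₁ - b
  else 0

/-- The weight `a₁ - a₂ + 2b - (n - 1)` of `sl_2` attached to the integer `b`. -/
def weightA (n : ℕ) (a₁ a₂ : ℂ) (b : ℤ) : Fin (2 - 1) → ℂ := fun _ =>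
  a₁ - a₂ + 2 * b - ((n : ℂ) - 1)

end DualPairSL

end

open DualPairSL

/-!
Let `N` be the module `N_{a₁,a₂}`. The element `(ρ_n, (n - 1) ρ_2)` of `sl_n ⊕ sl_2`, where `ρ_k` is
half the sum of the positive coroots, acts diagonally on the basis of the `x(b)`, and up to a shift
its eigenvalues are the negatives of natural numbers, the degrees. The basis vectors of degree `0`
are the `x(-1, …, -1, a₁ + s, a₂ - s, 0, …, 0)` for `s ∈ ℤ`; they are highest weight vectors, of
pairwise distinct weights for `sl_2`.

The key point is `apply_mono_eq_zero`: in positive degree, `N` is spanned by the images of the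
lowering operators. This is an elimination of exponents whose last step requires an inverse of a
number which differs from `a₁ - a₂` by a sign and an integer. It has two consequences.

* `N` is generated by its vectors of degree `0`.
* There is an explicit symmetric form on `N`, a product of Gamma factors, for which the `x(b)` are
  orthogonal of nonzero length and the transpose of a matrix acts as its adjoint. A singular vector
  is orthogonal to the images of the lowering operators, hence is of degree `0`
  (`coeff_eq_zero_of_isSingular`).

As the degrees are bounded below, every nonzero submodule of `N` contains a nonzero singular vector,
and, separating the `sl_2`-weights, one of the highest weight vectors (`exists_topVec_mem`). It
follows that each highest weight vector generates a simple submodule, that these submodules are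
independent with sum `N`, and that every simple submodule is one of them. They are identified with
`L(λ) ⊗ L(μ)` because a simple highest weight module is determined by its highest weight
(`nonempty_equiv_of_isHighestWeight`). That the `L(λ)` are simple, or that the Verma modules which
define them are not zero, does not require a basis of the enveloping algebra: a nonzero highest weight
vector in `N` shows that the generator of the Verma module is not zero.
-/

noncomputable section

namespace DualPairSL

/-! ### Modules graded by an element of the Lie algebra -/

section Graded

/-- If a subspace is stable under `T` and contains the sum of an eigenvector and of vectors in
eigenspaces for other eigenvalues, then it contains the eigenvector. -/
theorem mem_of_add_mem_eigenspaces {V : Type*} [AddCommGroup V] [Module ℂ V]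
    (T : Module.End ℂ V) (p : Submodule ℂ V) (hp : ∀ x ∈ p, T x ∈ p) (μ : ℂ) {x y : V}
    (hx : T x = μ • x) (hy : y ∈ ⨆ (ν : ℂ) (_ : ν ≠ μ), T.eigenspace ν) (hxy : x + y ∈ p) :
    x ∈ p := by
  -- some polynomial in `T` kills `y` and does not kill `x`
  have key : ∃ q : Polynomial ℂ, q.eval μ ≠ 0 ∧ Polynomial.aeval T q y = 0 := by
    clear hxy
    induction hy using Submodule.iSup_induction' with
    | zero => exact ⟨1, by simp, by simp⟩
    | add a b _ _ ha hb =>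
      obtain ⟨q, hq, hqa⟩ := ha
      obtain ⟨q', hq', hqb⟩ := hb
      refine ⟨q * q', by simp [hq, hq'], ?_⟩
      have h1 : Polynomial.aeval T (q * q') a = 0 := by
        rw [mul_comm, map_mul, Module.End.mul_apply, hqa, map_zero]
      rw [map_add, h1, map_mul, Module.End.mul_apply, hqb, map_zero, add_zero]
    | mem ν a ha =>
      by_cases hν : ν = μ
      · subst hν
        simp only [ne_eq, not_true_eq_false, iSup_false, Submodule.mem_bot] at ha
        exact ⟨1, by simp, by simp [ha]⟩
      · simp only [ne_eq, hν, not_false_eq_true, iSup_pos, Module.End.mem_eigenspace_iff] at ha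
        refine ⟨Polynomial.X - Polynomial.C ν, ?_, ?_⟩
        · simpa [sub_eq_zero] using fun h => hν h.symm
        · simp [ha, Module.algebraMap_end_apply]
  obtain ⟨q, hq, hqy⟩ := key
  have h1 := Polynomial.aeval_apply_smul_mem_of_le_comap hxy q T hp
  have h2 : Polynomial.aeval T q x = q.eval μ • x := by
    rcases eq_or_ne x 0 with rfl | h0
    · simp
    · exact Module.End.aeval_apply_of_hasEigenvector ⟨Module.End.mem_eigenspace_iff.2 hx, h0⟩
  rw [map_add, hqy, add_zero, h2] at h1
  exact (Submodule.smul_mem_iff _ hq).1 h1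

variable {L : Type*} [LieRing L] [LieAlgebra ℂ L]

/-- The component of degree `r` of a Lie algebra, with respect to the grading by the eigenvalues
of `ad h`. -/
def gr (h : L) (r : ℤ) : Submodule ℂ L := (LieAlgebra.ad ℂ L h).eigenspace (r : ℂ)

theorem mem_gr {h : L} {r : ℤ} {x : L} : x ∈ gr h r ↔ ⁅h, x⁆ = (r : ℂ) • x := by
  rw [gr, Module.End.mem_eigenspace_iff, LieAlgebra.ad_apply]

theorem lie_mem_gr {h : L} {r s : ℤ} {x y : L} (hx : x ∈ gr h r) (hy : y ∈ gr h s) :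
    ⁅x, y⁆ ∈ gr h (r + s) := by
  rw [mem_gr] at *
  rw [leibniz_lie, hx, hy, smul_lie, lie_smul, ← add_smul]
  push_cast; rfl

/-- The Lie algebra is the sum of the eigenspaces of `ad h` with integer eigenvalues. -/
def IsGradingElement (h : L) : Prop := ⨆ r : ℤ, gr h r = ⊤

/-- The eigenvalues of `ad h` are integers. -/
theorem IsGradingElement.eq_zero {h : L} (hh : IsGradingElement h) {x : L} {s : ℂ}
    (hx : ⁅h, x⁆ = s • x) (hs : ∀ r : ℤ, s ≠ r) : x = 0 := by
  have h1 := (LieAlgebra.ad ℂ L h).eigenspaces_iSupIndep s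
  have h2 : (⊤ : Submodule ℂ L) ≤ ⨆ (j : ℂ) (_ : j ≠ s), (LieAlgebra.ad ℂ L h).eigenspace j := by
    rw [← hh]
    exact iSup_le fun r => le_iSup₂_of_le (r : ℂ) (hs r).symm le_rfl
  exact Submodule.disjoint_def.1 h1 x (Module.End.mem_eigenspace_iff.2 (by simpa using hx))
    (h2 trivial)

theorem IsGradingElement.induction {h : L} (hh : IsGradingElement h) {p : L → Prop}
    (zero : p 0) (add : ∀ x y, p x → p y → p (x + y)) (mem : ∀ r, ∀ x ∈ gr h r, p x) (x : L) :
    p x := by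
  have hx : x ∈ ⨆ r : ℤ, gr h r := hh ▸ trivial
  exact Submodule.iSup_induction _ (motive := p) hx mem zero add

variable {V : Type*} [AddCommGroup V] [Module ℂ V] [LieRingModule L V] [LieModule ℂ L V]

/-- The eigenspace of `h` for the eigenvalue `κ - m`. -/
def layer (V : Type*) [AddCommGroup V] [Module ℂ V] [LieRingModule L V] [LieModule ℂ L V]
    (h : L) (κ : ℂ) (m : ℤ) : Submodule ℂ V :=
  (LieModule.toEnd ℂ L V h).eigenspace (κ - m)

/-- The sum of the eigenspaces of `h` for the eigenvalues `κ - 1, κ - 2, …`. -/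
def tail (V : Type*) [AddCommGroup V] [Module ℂ V] [LieRingModule L V] [LieModule ℂ L V]
    (h : L) (κ : ℂ) : Submodule ℂ V :=
  ⨆ m : {m : ℤ // 0 < m}, layer V h κ m

theorem mem_layer {h : L} {κ : ℂ} {m : ℤ} {f : V} : f ∈ layer V h κ m ↔ ⁅h, f⁆ = (κ - m) • f := by
  rw [layer, Module.End.mem_eigenspace_iff, LieModule.toEnd_apply_apply]

theorem lie_mem_layer {h : L} {κ : ℂ} {r m : ℤ} {x : L} {f : V} (hx : x ∈ gr h r)
    (hf : f ∈ layer V h κ m) : ⁅x, f⁆ ∈ layer V h κ (m - r) := by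
  rw [mem_layer] at hf ⊢
  rw [mem_gr] at hx
  rw [leibniz_lie, hx, hf, smul_lie, lie_smul, ← add_smul, Int.cast_sub]
  congr 1; ring

theorem lie_mem_tail {h : L} {κ : ℂ} {r : ℤ} (hr : r ≤ 0) {x : L} {f : V} (hx : x ∈ gr h r)
    (hf : f ∈ tail V h κ) : ⁅x, f⁆ ∈ tail V h κ := by
  refine Submodule.iSup_induction _ (motive := fun f => ⁅x, f⁆ ∈ tail V h κ) hf ?_ ?_ ?_
  · intro m f hf
    exact Submodule.mem_iSup_of_mem ⟨m - r, by have := m.2; omega⟩ (lie_mem_layer hx hf)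
  · simp
  · intro f g hf hg
    rw [lie_add]; exact Submodule.add_mem _ hf hg

theorem tail_le (h : L) (κ : ℂ) :
    tail V h κ ≤ ⨆ (ν : ℂ) (_ : ν ≠ κ), (LieModule.toEnd ℂ L V h).eigenspace ν := by
  refine iSup_le fun m => le_iSup₂_of_le (κ - (m : ℤ)) ?_ le_rfl
  have : ((m : ℤ) : ℂ) ≠ 0 := by exact_mod_cast m.2.ne'
  simpa using this

theorem eq_zero_of_mem_tail {h : L} {κ : ℂ} {v : V} (hv : ⁅h, v⁆ = κ • v) (ht : v ∈ tail V h κ) :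
    v = 0 :=
  Submodule.disjoint_def.1 ((LieModule.toEnd ℂ L V h).eigenspaces_iSupIndep κ) v
    (Module.End.mem_eigenspace_iff.2 (by simpa using hv)) (tail_le h κ ht)

/-- A subspace `Q` stable under the components of nonnegative degree generates a submodule which is
obtained by applying only elements of negative degree. -/
theorem lieSpan_le_of_graded {h : L} (hh : IsGradingElement h) {Q R : Submodule ℂ V}
    (hQ : ∀ r : ℤ, 0 ≤ r → ∀ x ∈ gr h r, ∀ f ∈ Q, ⁅x, f⁆ ∈ Q) (hQR : Q ≤ R)
    (hR : ∀ r : ℤ, r < 0 → ∀ x ∈ gr h r, ∀ f ∈ R, ⁅x, f⁆ ∈ R) :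
    (LieSubmodule.lieSpan ℂ L (Q : Set V)).toSubmodule ≤ R := by
  -- `S` is the closure of `Q` under the components of negative degree
  let 𝒮 : Set (Submodule ℂ V) :=
    {T | Q ≤ T ∧ ∀ r : ℤ, r < 0 → ∀ x ∈ gr h r, ∀ f ∈ T, ⁅x, f⁆ ∈ T}
  let S : Submodule ℂ V := sInf 𝒮
  have hQS : Q ≤ S := le_sInf fun T hT => hT.1
  have hS : ∀ r : ℤ, r < 0 → ∀ x ∈ gr h r, ∀ f ∈ S, ⁅x, f⁆ ∈ S := by
    intro r hr x hx f hf
    rw [Submodule.mem_sInf] at hf ⊢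
    exact fun T hT => hT.2 r hr x hx f (hf T hT)
  -- to see that `S` is a submodule, move an arbitrary element of `L` past those of negative degree
  let S' : Submodule ℂ V :=
    { carrier := {w | w ∈ S ∧ ∀ x : L, ⁅x, w⁆ ∈ S}
      zero_mem' := ⟨S.zero_mem, by simp⟩
      add_mem' := fun ha hb => ⟨S.add_mem ha.1 hb.1, fun x => by
        rw [lie_add]; exact S.add_mem (ha.2 x) (hb.2 x)⟩
      smul_mem' := fun c a ha => ⟨S.smul_mem c ha.1, fun x => by
        rw [lie_smul]; exact S.smul_mem c (ha.2 x)⟩ }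
  have hSS' : S ≤ S' := by
    refine sInf_le ⟨fun q hq => ⟨hQS hq, ?_⟩, fun r hr x hx f hf => ⟨hS r hr x hx f hf.1, ?_⟩⟩
    · refine hh.induction (by simp) (fun x y hx hy => ?_) fun r x hx => ?_
      · rw [add_lie]; exact S.add_mem hx hy
      · rcases le_or_gt 0 r with hr | hr
        · exact hQS (hQ r hr x hx q hq)
        · exact hS r hr x hx q (hQS hq)
    · intro y
      rw [leibniz_lie]
      exact S.add_mem (hf.2 _) (hS r hr x hx _ (hf.2 y))
  let S'' : LieSubmodule ℂ L V := { S with lie_mem := fun {x m} hm => (hSS' hm).2 x }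
  have h1 : LieSubmodule.lieSpan ℂ L (Q : Set V) ≤ S'' := LieSubmodule.lieSpan_le.2 hQS
  exact le_trans h1 (sInf_le ⟨hQR, hR⟩)

/-- A vector killed by the components of positive degree. -/
def IsSingular (h : L) (f : V) : Prop := ∀ r : ℤ, 0 < r → ∀ x ∈ gr h r, ⁅x, f⁆ = 0

/-- A nonzero singular vector on which the component of degree zero acts by scalars. -/
structure IsHighestWeight (h : L) (v : V) : Prop where
  ne_zero : v ≠ 0
  isSingular : IsSingular h v
  exists_smul : ∀ x ∈ gr h 0, ∃ c : ℂ, ⁅x, v⁆ = c • v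

theorem self_mem_gr (h : L) : h ∈ gr h 0 := by rw [mem_gr]; simp

/-- The submodule generated by a highest weight vector `v` lies in the sum of the line spanned by `v`
and of the lower eigenspaces of `h`. -/
theorem IsHighestWeight.lieSpan_le {h : L} (hh : IsGradingElement h) {v : V} {κ : ℂ}
    (hv : IsHighestWeight h v) (hκ : ⁅h, v⁆ = κ • v) :
    (LieSubmodule.lieSpan ℂ L {v}).toSubmodule ≤ ℂ ∙ v ⊔ tail V h κ := by
  have h1 : LieSubmodule.lieSpan ℂ L {v} ≤
      LieSubmodule.lieSpan ℂ L ((ℂ ∙ v : Submodule ℂ V) : Set V) :=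
    LieSubmodule.lieSpan_mono (by simp)
  refine le_trans h1 (lieSpan_le_of_graded hh ?_ le_sup_left ?_)
  · intro r hr x hx f hf
    obtain ⟨c, rfl⟩ := Submodule.mem_span_singleton.1 hf
    rw [lie_smul]
    refine Submodule.smul_mem _ _ ?_
    rcases hr.eq_or_lt with rfl | hr
    · obtain ⟨d, hd⟩ := hv.exists_smul x hx
      rw [hd]; exact Submodule.smul_mem _ _ (Submodule.mem_span_singleton_self v)
    · rw [hv.isSingular r hr x hx]; exact Submodule.zero_mem _
  · intro r hr x hx f hf
    obtain ⟨a, ha, b, hb, rfl⟩ := Submodule.mem_sup.1 hf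
    obtain ⟨c, rfl⟩ := Submodule.mem_span_singleton.1 ha
    rw [lie_add, lie_smul]
    refine Submodule.mem_sup_right (Submodule.add_mem _ (Submodule.smul_mem _ _ ?_)
      (lie_mem_tail hr.le hx hb))
    refine Submodule.mem_iSup_of_mem ⟨-r, by omega⟩ ?_
    have := lie_mem_layer (κ := κ) (m := 0) hx (mem_layer.2 (by simpa using hκ) : v ∈ _)
    simpa using this

omit [LieAlgebra ℂ L] [LieModule ℂ L V] in
theorem exists_mem_ne_zero {P : LieSubmodule ℂ L V} (hP : P ≠ ⊥) : ∃ f ∈ P, f ≠ 0 := by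
  by_contra! h
  exact hP ((LieSubmodule.eq_bot_iff P).2 h)

omit [LieAlgebra ℂ L] [LieModule ℂ L V] in
theorem eq_top_of_ne_zero [LieModule.IsIrreducible ℂ L V] (P : LieSubmodule ℂ L V) {f : V}
    (hf : f ∈ P) (h0 : f ≠ 0) : P = ⊤ :=
  (IsSimpleOrder.eq_bot_or_eq_top P).resolve_left fun h => h0 (by simpa [h] using hf)

/-- The singular vectors of a simple highest weight module are the multiples of a highest weight
vector. -/
theorem IsHighestWeight.singular_mem_span [LieModule.IsIrreducible ℂ L V] {h : L}
    (hh : IsGradingElement h) {v : V} (hv : IsHighestWeight h v) {f : V} (hf : IsSingular h f) :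
    ∃ c : ℂ, f = c • v := by
  obtain ⟨κ, hκ⟩ := hv.exists_smul h (self_mem_gr h)
  have htop : LieSubmodule.lieSpan ℂ L {v} = ⊤ :=
    eq_top_of_ne_zero _ (LieSubmodule.subset_lieSpan rfl) hv.ne_zero
  have h1 : f ∈ ℂ ∙ v ⊔ tail V h κ := hv.lieSpan_le hh hκ (by rw [htop]; trivial)
  obtain ⟨a, ha, b, hb, rfl⟩ := Submodule.mem_sup.1 h1
  obtain ⟨c, rfl⟩ := Submodule.mem_span_singleton.1 ha
  refine ⟨c, ?_⟩
  by_contra hne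
  have hb0 : b ≠ 0 := by simpa using hne
  have hbs : IsSingular h b := by
    intro r hr x hx
    have := hf r hr x hx
    rwa [lie_add, lie_smul, hv.isSingular r hr x hx, smul_zero, zero_add] at this
  -- the singular vectors of `tail` generate a submodule contained in `tail`
  let Q : Submodule ℂ V :=
    { carrier := {w | w ∈ tail V h κ ∧ IsSingular h w}
      zero_mem' := ⟨Submodule.zero_mem _, fun r _ x _ => lie_zero x⟩
      add_mem' := fun ha hb => ⟨Submodule.add_mem _ ha.1 hb.1, fun r hr x hx => by
        rw [lie_add, ha.2 r hr x hx, hb.2 r hr x hx, add_zero]⟩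
      smul_mem' := fun c a ha => ⟨Submodule.smul_mem _ c ha.1, fun r hr x hx => by
        rw [lie_smul, ha.2 r hr x hx, smul_zero]⟩ }
  have h2 : (LieSubmodule.lieSpan ℂ L (Q : Set V)).toSubmodule ≤ tail V h κ := by
    refine lieSpan_le_of_graded hh ?_ (fun w hw => hw.1) fun r hr x hx f hf =>
      lie_mem_tail hr.le hx hf
    intro r hr x hx w hw
    rcases hr.eq_or_lt with rfl | hr
    · refine ⟨lie_mem_tail le_rfl hx hw.1, fun s hs y hy => ?_⟩
      have hyx := lie_mem_gr hy hx
      rw [add_zero] at hyx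
      rw [leibniz_lie, hw.2 s hs y hy, hw.2 s hs _ hyx, lie_zero, add_zero]
    · rw [hw.2 r hr x hx]; exact Q.zero_mem
  have h3 : LieSubmodule.lieSpan ℂ L (Q : Set V) = ⊤ :=
    eq_top_of_ne_zero _ (LieSubmodule.subset_lieSpan (show b ∈ (Q : Set V) from ⟨hb, hbs⟩)) hb0
  exact hv.ne_zero (eq_zero_of_mem_tail hκ (h2 (by rw [h3]; trivial)))

/-- In a module whose `h`-eigenvalues are bounded above, every nonzero submodule contains a nonzero
singular vector. -/
theorem exists_singular {h : L} {κ : ℂ} (hV : ⨆ m : ℕ, layer V h κ m = ⊤)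
    (P : LieSubmodule ℂ L V) (hP : P ≠ ⊥) : ∃ f ∈ P, f ≠ 0 ∧ IsSingular h f := by
  -- elements of positive degree map `F (k + 1)` to `F k`, so the nonzero elements of `P` in the
  -- smallest possible `F k` are singular
  let F : ℕ → Submodule ℂ V := fun k => ⨆ m : {m : ℕ // m < k}, layer V h κ (m.1 : ℤ)
  have hneg : ∀ m : ℤ, m < 0 → ∀ f ∈ layer V h κ m, f = 0 := by
    intro m hm f hf
    refine Submodule.disjoint_def.1
      ((LieModule.toEnd ℂ L V h).eigenspaces_iSupIndep (κ - m)) f hf ?_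
    have h1 : (⊤ : Submodule ℂ V) ≤ ⨆ (ν : ℂ) (_ : ν ≠ κ - m),
        (LieModule.toEnd ℂ L V h).eigenspace ν := by
      rw [← hV]
      refine iSup_le fun k => le_iSup₂_of_le (κ - ((k : ℤ) : ℂ)) ?_ le_rfl
      intro h2
      have h3 : (k : ℤ) = m := by exact_mod_cast sub_right_injective h2
      omega
    exact h1 trivial
  have hF : ∀ k, ∀ f ∈ F (k + 1), ∀ r : ℤ, 0 < r → ∀ x ∈ gr h r, ⁅x, f⁆ ∈ F k := by
    intro k f hf r hr x hx
    refine Submodule.iSup_induction _ (motive := fun f => ⁅x, f⁆ ∈ F k) hf ?_ ?_ ?_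
    · intro m f hf
      have h1 := lie_mem_layer hx hf
      rcases lt_or_ge ((m : ℤ) - r) 0 with h2 | h2
      · rw [hneg _ h2 _ h1]; exact Submodule.zero_mem _
      · have h3 := m.2
        refine Submodule.mem_iSup_of_mem ⟨((m : ℤ) - r).toNat, by omega⟩ ?_
        rwa [Int.toNat_of_nonneg h2]
    · simp
    · intro f g hf hg
      rw [lie_add]; exact Submodule.add_mem _ hf hg
  have hmono : Monotone F := fun k l hkl =>
    iSup_le fun m => le_iSup (fun m : {m : ℕ // m < l} => layer V h κ (m.1 : ℤ))
      ⟨m.1, m.2.trans_le hkl⟩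
  have hex : ∃ k, ∃ f ∈ P, f ≠ 0 ∧ f ∈ F k := by
    obtain ⟨f, hf, h0⟩ := exists_mem_ne_zero hP
    have hf' : f ∈ ⨆ m : ℕ, layer V h κ m := hV ▸ trivial
    have : ∃ k, f ∈ F k := by
      refine Submodule.iSup_induction _ (motive := fun f => ∃ k, f ∈ F k) hf' ?_ ?_ ?_
      · exact fun m f hf => ⟨m + 1, Submodule.mem_iSup_of_mem ⟨m, m.lt_succ_self⟩ hf⟩
      · exact ⟨0, Submodule.zero_mem _⟩
      · rintro f g ⟨k, hk⟩ ⟨l, hl⟩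
        exact ⟨max k l, Submodule.add_mem _ (hmono (le_max_left k l) hk)
          (hmono (le_max_right k l) hl)⟩
    obtain ⟨k, hk⟩ := this
    exact ⟨k, f, hf, h0, hk⟩
  classical
  obtain ⟨f, hf, h0, hfk⟩ := Nat.find_spec hex
  refine ⟨f, hf, h0, fun r hr x hx => ?_⟩
  by_contra hne
  have hk : Nat.find hex ≠ 0 := by
    intro hk
    rw [hk] at hfk
    have : F 0 = ⊥ := iSup_eq_bot.2 fun m => absurd m.2 (Nat.not_lt_zero _)
    rw [this] at hfk
    exact h0 hfk
  obtain ⟨k, hk⟩ := Nat.exists_eq_succ_of_ne_zero hk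
  rw [hk] at hfk
  refine Nat.find_min hex (m := k) (by omega) ⟨_, P.lie_mem hf, hne, hF k f hfk r hr x hx⟩

end Graded

/-! ### Simple highest weight modules with the same weight are isomorphic -/

section Uniqueness

variable {L : Type*} [LieRing L] [LieAlgebra ℂ L]
variable {V : Type*} [AddCommGroup V] [Module ℂ V] [LieRingModule L V] [LieModule ℂ L V]
variable {W : Type*} [AddCommGroup W] [Module ℂ W] [LieRingModule L W] [LieModule ℂ L W]

/-- The componentwise action on the direct sum of two modules. -/
local instance prodLieRingModule : LieRingModule L (V × W) where
  bracket x m := (⁅x, m.1⁆, ⁅x, m.2⁆)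
  add_lie x y m := by simp
  lie_add x m m' := by simp
  leibniz_lie x y m := by simp

local instance prodLieModule : LieModule ℂ L (V × W) where
  smul_lie c x m := by ext <;> exact smul_lie c x _
  lie_smul c x m := by ext <;> exact lie_smul c x _

omit [LieAlgebra ℂ L] [Module ℂ V] [LieModule ℂ L V] [Module ℂ W] [LieModule ℂ L W] in
theorem prod_lie (x : L) (m : V × W) : ⁅x, m⁆ = (⁅x, m.1⁆, ⁅x, m.2⁆) := rfl

theorem tail_prod_le (h : L) (κ : ℂ) : tail (V × W) h κ ≤ (tail V h κ).prod (tail W h κ) := by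
  refine iSup_le fun m f hf => ?_
  rw [mem_layer, prod_lie] at hf
  exact ⟨Submodule.mem_iSup_of_mem m (mem_layer.2 (congrArg Prod.fst hf)),
    Submodule.mem_iSup_of_mem m (mem_layer.2 (congrArg Prod.snd hf))⟩

/-- Two simple modules with highest weight vectors of the same weight are isomorphic: the pair of
these vectors generates the graph of an isomorphism. -/
theorem nonempty_equiv_of_isHighestWeight [LieModule.IsIrreducible ℂ L V]
    [LieModule.IsIrreducible ℂ L W] {h : L} (hh : IsGradingElement h) {v : V} {w : W}
    (hv : IsHighestWeight h v) (hw : IsHighestWeight h w)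
    (hvw : ∀ x ∈ gr h 0, ∃ c : ℂ, ⁅x, v⁆ = c • v ∧ ⁅x, w⁆ = c • w) :
    Nonempty (V ≃ₗ⁅ℂ,L⁆ W) := by
  obtain ⟨κ, hκv, hκw⟩ := hvw h (self_mem_gr h)
  have hp : IsHighestWeight h (v, w) := by
    refine ⟨fun h0 => hv.ne_zero (congrArg Prod.fst h0), fun r hr x hx => ?_, fun x hx => ?_⟩
    · rw [prod_lie, hv.isSingular r hr x hx, hw.isSingular r hr x hx]; rfl
    · obtain ⟨c, h1, h2⟩ := hvw x hx
      exact ⟨c, by rw [prod_lie, h1, h2]; rfl⟩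
  let G := LieSubmodule.lieSpan ℂ L {(v, w)}
  have hG : ∀ g ∈ G, ∃ c : ℂ, ∃ a ∈ tail V h κ, ∃ b ∈ tail W h κ, g = (c • v + a, c • w + b) := by
    intro g hg
    have := hp.lieSpan_le hh (κ := κ) (by rw [prod_lie, hκv, hκw]; rfl) hg
    obtain ⟨a, ha, b, hb, rfl⟩ := Submodule.mem_sup.1 this
    obtain ⟨c, rfl⟩ := Submodule.mem_span_singleton.1 ha
    exact ⟨c, b.1, (tail_prod_le h κ hb).1, b.2, (tail_prod_le h κ hb).2, rfl⟩
  let f₁ : G →ₗ⁅ℂ,L⁆ V :=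
    { (LinearMap.fst ℂ V W).comp G.toSubmodule.subtype with map_lie' := rfl }
  let f₂ : G →ₗ⁅ℂ,L⁆ W :=
    { (LinearMap.snd ℂ V W).comp G.toSubmodule.subtype with map_lie' := rfl }
  have hvwG : (v, w) ∈ G := LieSubmodule.subset_lieSpan rfl
  -- the kernel of `f₁` is a submodule of the simple module `W`, proper since `(0, w)` is not in `G`
  have b₁ : Function.Bijective f₁ := by
    constructor
    · rw [← LieModuleHom.coe_toLinearMap, injective_iff_map_eq_zero]
      rintro ⟨⟨a, m⟩, hm⟩ h0
      obtain rfl : a = 0 := h0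
      by_contra hne
      have hm0 : m ≠ 0 := by rintro rfl; exact hne rfl
      let K : LieSubmodule ℂ L W :=
        { G.toSubmodule.comap (LinearMap.inr ℂ V W) with
          lie_mem := fun {x m} hm => by
            have : ⁅x, ((0 : V), m)⁆ ∈ G := G.lie_mem hm
            rwa [prod_lie, lie_zero] at this }
      have hK : K = ⊤ := eq_top_of_ne_zero K hm hm0
      have hwK : ((0 : V), w) ∈ G := (by rw [hK]; trivial : w ∈ K)
      obtain ⟨c, a, ha, b, hb, he⟩ := hG _ hwK
      rw [Prod.mk.injEq] at he
      have h1 : c • v ∈ tail V h κ := by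
        rw [eq_neg_of_add_eq_zero_left he.1.symm]; exact Submodule.neg_mem _ ha
      have h2 := eq_zero_of_mem_tail (by rw [lie_smul, hκv, smul_comm]) h1
      rw [smul_eq_zero_iff_left hv.ne_zero] at h2
      simp only [h2, zero_smul, zero_add] at he
      exact hw.ne_zero (eq_zero_of_mem_tail hκw (he.2 ▸ hb))
    · rw [← LieModuleHom.range_eq_top]
      exact eq_top_of_ne_zero _ (LieModuleHom.mem_range _ _ |>.2 ⟨⟨_, hvwG⟩, rfl⟩) hv.ne_zero
  have b₂ : Function.Bijective f₂ := by
    constructor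
    · rw [← LieModuleHom.coe_toLinearMap, injective_iff_map_eq_zero]
      rintro ⟨⟨m, a⟩, hm⟩ h0
      obtain rfl : a = 0 := h0
      by_contra hne
      have hm0 : m ≠ 0 := by rintro rfl; exact hne rfl
      let K : LieSubmodule ℂ L V :=
        { G.toSubmodule.comap (LinearMap.inl ℂ V W) with
          lie_mem := fun {x m} hm => by
            have : ⁅x, (m, (0 : W))⁆ ∈ G := G.lie_mem hm
            rwa [prod_lie, lie_zero] at this }
      have hK : K = ⊤ := eq_top_of_ne_zero K hm hm0
      have hwK : (v, (0 : W)) ∈ G := (by rw [hK]; trivial : v ∈ K)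
      obtain ⟨c, a, ha, b, hb, he⟩ := hG _ hwK
      rw [Prod.mk.injEq] at he
      have h1 : c • w ∈ tail W h κ := by
        rw [eq_neg_of_add_eq_zero_left he.2.symm]; exact Submodule.neg_mem _ hb
      have h2 := eq_zero_of_mem_tail (by rw [lie_smul, hκw, smul_comm]) h1
      rw [smul_eq_zero_iff_left hw.ne_zero] at h2
      simp only [h2, zero_smul, zero_add] at he
      exact hv.ne_zero (eq_zero_of_mem_tail hκv (he.1 ▸ ha))
    · rw [← LieModuleHom.range_eq_top]
      exact eq_top_of_ne_zero _ (LieModuleHom.mem_range _ _ |>.2 ⟨⟨_, hvwG⟩, rfl⟩) hw.ne_zero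
  let e₁ : G ≃ₗ⁅ℂ,L⁆ V :=
    { LinearEquiv.ofBijective (f₁ : G →ₗ[ℂ] V) b₁ with map_lie' := f₁.map_lie' }
  let e₂ : G ≃ₗ⁅ℂ,L⁆ W :=
    { LinearEquiv.ofBijective (f₂ : G →ₗ[ℂ] W) b₂ with map_lie' := f₂.map_lie' }
  exact ⟨e₁.symm.trans e₂⟩

end Uniqueness

/-! ### External tensor products of simple highest weight modules -/

section ExternalTensor

variable {L₁ L₂ : Type} [LieRing L₁] [LieAlgebra ℂ L₁] [LieRing L₂] [LieAlgebra ℂ L₂]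

/-- The element `(h₁, c h₂)`. The multiple `c` weighs the degrees of the second factor. -/
def pairElt (c : ℕ) (h₁ : L₁) (h₂ : L₂) : L₁ × L₂ := (h₁, (c : ℂ) • h₂)

theorem inl_mem_gr {c : ℕ} {h₁ : L₁} {h₂ : L₂} {r : ℤ} {x : L₁} (hx : x ∈ gr h₁ r) :
    (x, (0 : L₂)) ∈ gr (pairElt c h₁ h₂) r := by
  rw [mem_gr] at hx ⊢
  rw [pairElt, LieAlgebra.Prod.bracket_apply, hx, lie_zero, Prod.smul_mk, smul_zero]

theorem inr_mem_gr {c : ℕ} {h₁ : L₁} {h₂ : L₂} {r : ℤ} {y : L₂} (hy : y ∈ gr h₂ r) :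
    ((0 : L₁), y) ∈ gr (pairElt c h₁ h₂) (c * r) := by
  rw [mem_gr] at hy ⊢
  rw [pairElt, LieAlgebra.Prod.bracket_apply, smul_lie, hy, lie_zero, Prod.smul_mk, smul_zero,
    smul_smul]
  push_cast; rfl

theorem isGradingElement_pairElt {c : ℕ} {h₁ : L₁} {h₂ : L₂} (H₁ : IsGradingElement h₁)
    (H₂ : IsGradingElement h₂) : IsGradingElement (pairElt c h₁ h₂) := by
  rw [IsGradingElement, eq_top_iff]
  rintro ⟨x, y⟩ -
  have h1 : (x, (0 : L₂)) ∈ ⨆ r, gr (pairElt c h₁ h₂) r := by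
    refine H₁.induction (p := fun x => (x, (0 : L₂)) ∈ ⨆ r, gr (pairElt c h₁ h₂) r)
      (Submodule.zero_mem _) (fun a b ha hb => ?_)
      (fun r a ha => Submodule.mem_iSup_of_mem r (inl_mem_gr ha)) x
    simpa using Submodule.add_mem _ ha hb
  have h2 : ((0 : L₁), y) ∈ ⨆ r, gr (pairElt c h₁ h₂) r := by
    refine H₂.induction (p := fun y => ((0 : L₁), y) ∈ ⨆ r, gr (pairElt c h₁ h₂) r)
      (Submodule.zero_mem _) (fun a b ha hb => ?_)
      (fun r a ha => Submodule.mem_iSup_of_mem _ (inr_mem_gr ha)) y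
    simpa using Submodule.add_mem _ ha hb
  simpa using Submodule.add_mem _ h1 h2

/-- The components of an element of degree `r` have degrees `r` and `r / c`; the second one is zero
if `c` does not divide `r`. -/
theorem of_mem_gr_pairElt {c : ℕ} (hc : c ≠ 0) {h₁ : L₁} {h₂ : L₂} (H₂ : IsGradingElement h₂)
    {r : ℤ} {z : L₁ × L₂} (hz : z ∈ gr (pairElt c h₁ h₂) r) :
    z.1 ∈ gr h₁ r ∧ (z.2 = 0 ∨ ∃ s : ℤ, c * s = r ∧ z.2 ∈ gr h₂ s) := by
  rw [mem_gr, pairElt, LieAlgebra.Prod.bracket_apply, Prod.ext_iff] at hz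
  obtain ⟨h1, h2⟩ := hz
  refine ⟨mem_gr.2 h1, ?_⟩
  have hc' : (c : ℂ) ≠ 0 := by exact_mod_cast hc
  have h3 : ⁅h₂, z.2⁆ = ((c : ℂ)⁻¹ * r) • z.2 := by
    have : (c : ℂ) • ⁅h₂, z.2⁆ = (r : ℂ) • z.2 := by rw [← smul_lie]; exact h2
    rw [mul_smul, ← this, smul_smul, inv_mul_cancel₀ hc', one_smul]
  by_cases hs : ∃ s : ℤ, (c : ℂ)⁻¹ * r = s
  · obtain ⟨s, hs⟩ := hs
    rw [hs] at h3
    refine Or.inr ⟨s, ?_, mem_gr.2 h3⟩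
    have : (r : ℂ) = c * s := by rw [← hs, mul_inv_cancel_left₀ hc']
    exact_mod_cast this.symm
  · push Not at hs
    exact Or.inl (H₂.eq_zero h3 hs)

variable {V W : Type} [AddCommGroup V] [Module ℂ V] [AddCommGroup W] [Module ℂ W]
variable [LieRingModule L₁ V] [LieModule ℂ L₁ V] [LieRingModule L₂ W] [LieModule ℂ L₂ W]

/-- The pure tensor `v ⊗ w`, as a bilinear map to the external tensor product. -/
def extMk : V →ₗ[ℂ] W →ₗ[ℂ] ExtTensor V W := TensorProduct.mk ℂ V W

theorem extTensor_induction {p : ExtTensor V W → Prop} (zero : p 0)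
    (tmul : ∀ v w, p (extMk v w)) (add : ∀ f g, p f → p g → p (f + g)) (f : ExtTensor V W) : p f :=
  TensorProduct.induction_on (motive := p) f zero tmul add

theorem lie_extMk (z : L₁ × L₂) (v : V) (w : W) :
    ⁅z, extMk v w⁆ = extMk ⁅z.1, v⁆ w + extMk v ⁅z.2, w⁆ := rfl

/-- Contraction of the second factor against a linear form. -/
def contract (φ : Module.Dual ℂ W) : ExtTensor V W →ₗ[ℂ] V :=
  (TensorProduct.rid ℂ V : V ⊗[ℂ] ℂ →ₗ[ℂ] V) ∘ₗ φ.lTensor V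

theorem contract_extMk (φ : Module.Dual ℂ W) (v : V) (w : W) :
    contract φ (extMk v w) = φ w • v := by
  change TensorProduct.rid ℂ V (φ.lTensor V (v ⊗ₜ w)) = _
  simp

/-- Contraction of the second factor commutes with the first Lie algebra. -/
theorem contract_lie (φ : Module.Dual ℂ W) (x : L₁) (f : ExtTensor V W) :
    contract φ ⁅(x, (0 : L₂)), f⁆ = ⁅x, contract φ f⁆ := by
  induction f using extTensor_induction with
  | zero => simp
  | add f g hf hg => rw [lie_add, map_add, hf, hg, map_add, lie_add]
  | tmul v w => rw [lie_extMk, zero_lie, map_zero, add_zero, contract_extMk, contract_extMk,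
      lie_smul]

/-- If all contractions of a tensor against linear forms are multiples of `v`, the tensor is
`v ⊗ w` for some `w`. -/
theorem exists_eq_extMk {v : V} (f : ExtTensor V W)
    (hf : ∀ φ : Module.Dual ℂ W, ∃ c : ℂ, contract φ f = c • v) :
    ∃ w : W, f = extMk v w := by
  classical
  let b := Module.Basis.ofVectorSpace ℂ W
  choose c hc using fun i => hf (b.coord i)
  obtain ⟨g, rfl⟩ := (TensorProduct.equivFinsuppOfBasisRight (M := V) b).symm.surjective f
  have hg' : (TensorProduct.equivFinsuppOfBasisRight (M := V) b).symm g =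
      ∑ i ∈ g.support, extMk (g i) (b i) :=
    TensorProduct.equivFinsuppOfBasisRight_symm_apply b g
  have hg : ∀ i, g i = c i • v := by
    intro i
    rw [← hc i]
    refine Eq.trans ?_ (congrArg (contract (b.coord i)) hg').symm
    rw [map_sum]
    simp [contract_extMk, Finsupp.single_apply]
  refine ⟨∑ i ∈ g.support, c i • b i, hg'.trans ?_⟩
  rw [map_sum]
  refine Finset.sum_congr rfl fun i _ => ?_
  rw [hg, map_smul, map_smul, LinearMap.smul_apply]

theorem eq_zero_of_extMk_eq_zero {v : V} (hv : v ≠ 0) {w : W} (h : extMk v w = 0) : w = 0 := by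
  by_contra hw
  obtain ⟨φ, hφ⟩ := Module.Projective.exists_dual_ne_zero ℂ hw
  have h1 := contract_extMk φ v w
  rw [h, map_zero] at h1
  exact smul_ne_zero hφ hv h1.symm

theorem isHighestWeight_extMk {c : ℕ} (hc : c ≠ 0) {h₁ : L₁} {h₂ : L₂}
    (H₂ : IsGradingElement h₂) {v : V} {w : W} (hv : IsHighestWeight h₁ v)
    (hw : IsHighestWeight h₂ w) : IsHighestWeight (pairElt c h₁ h₂) (extMk v w) := by
  refine ⟨fun h0 => hw.ne_zero (eq_zero_of_extMk_eq_zero hv.ne_zero h0), fun r hr z hz => ?_,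
    fun z hz => ?_⟩
  · obtain ⟨h1, h2⟩ := of_mem_gr_pairElt hc H₂ hz
    rw [lie_extMk, hv.isSingular r hr _ h1, map_zero, LinearMap.zero_apply, zero_add]
    rcases h2 with h2 | ⟨s, rfl, h2⟩
    · rw [h2, zero_lie, map_zero]
    · rw [hw.isSingular s (pos_of_mul_pos_right hr (by positivity)) _ h2, map_zero]
  · obtain ⟨h1, h2⟩ := of_mem_gr_pairElt hc H₂ hz
    obtain ⟨a, ha⟩ := hv.exists_smul _ h1
    have : z.2 ∈ gr h₂ 0 := by
      rcases h2 with h2 | ⟨s, h3, h2⟩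
      · rw [h2]; exact Submodule.zero_mem _
      · have : s = 0 := by simpa [hc] using h3
        rwa [← this]
    obtain ⟨b, hb⟩ := hw.exists_smul _ this
    refine ⟨a + b, ?_⟩
    rw [lie_extMk, ha, hb, map_smul, map_smul, LinearMap.smul_apply, add_smul]

theorem iSup_layer_extTensor {h₁ : L₁} {h₂ : L₂} (c : ℕ) {κ₁ κ₂ : ℂ}
    (hV : ⨆ m : ℕ, layer V h₁ κ₁ m = ⊤) (hW : ⨆ m : ℕ, layer W h₂ κ₂ m = ⊤) :
    ⨆ m : ℕ, layer (ExtTensor V W) (pairElt c h₁ h₂) (κ₁ + c * κ₂) m = ⊤ := by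
  rw [eq_top_iff]
  rintro f -
  induction f using extTensor_induction with
  | zero => exact Submodule.zero_mem _
  | add f g hf hg => exact Submodule.add_mem _ hf hg
  | tmul v w =>
    have hv : v ∈ ⨆ m : ℕ, layer V h₁ κ₁ m := hV ▸ trivial
    have hw : w ∈ ⨆ m : ℕ, layer W h₂ κ₂ m := hW ▸ trivial
    let S := ⨆ m : ℕ, layer (ExtTensor V W) (pairElt c h₁ h₂) (κ₁ + c * κ₂) m
    refine Submodule.iSup_induction _ (motive := fun v => extMk v w ∈ S) hv
      (fun m v hv => ?_) ?_ fun v v' hv hv' => ?_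
    · refine Submodule.iSup_induction _ (motive := fun w => extMk v w ∈ S) hw
        (fun k w hw => ?_) ?_ fun w w' hw hw' => ?_
      · refine Submodule.mem_iSup_of_mem (m + c * k) ?_
        rw [mem_layer] at hv hw ⊢
        rw [lie_extMk, pairElt, hv, smul_lie, hw, smul_smul, map_smul, map_smul,
          LinearMap.smul_apply, ← add_smul]
        congr 1
        push_cast; ring
      · rw [map_zero]; exact Submodule.zero_mem _
      · rw [map_add]; exact Submodule.add_mem _ hw hw'
    · rw [map_zero]; exact Submodule.zero_mem _
    · rw [map_add]; exact Submodule.add_mem _ hv hv'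

/-- In a simple highest weight module the `h`-eigenvalues are bounded above. -/
theorem IsHighestWeight.iSup_layer {L : Type*} [LieRing L] [LieAlgebra ℂ L] {V : Type*}
    [AddCommGroup V] [Module ℂ V] [LieRingModule L V] [LieModule ℂ L V]
    [LieModule.IsIrreducible ℂ L V] {h : L}
    (hh : IsGradingElement h) {v : V} (hv : IsHighestWeight h v) :
    ∃ κ : ℂ, ⨆ m : ℕ, layer V h κ m = ⊤ := by
  obtain ⟨κ, hκ⟩ := hv.exists_smul h (self_mem_gr h)
  refine ⟨κ, ?_⟩
  have htop : LieSubmodule.lieSpan ℂ L {v} = ⊤ :=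
    eq_top_of_ne_zero _ (LieSubmodule.subset_lieSpan rfl) hv.ne_zero
  rw [eq_top_iff]
  intro f _
  have hf : f ∈ LieSubmodule.lieSpan ℂ L {v} := htop ▸ trivial
  refine (sup_le ?_ ?_ : _ ≤ ⨆ m : ℕ, layer V h κ m) (hv.lieSpan_le hh hκ hf)
  · rw [Submodule.span_singleton_le_iff_mem]
    exact Submodule.mem_iSup_of_mem 0 (mem_layer.2 (by simpa using hκ))
  · refine iSup_le fun m => le_trans (le_of_eq ?_)
      (le_iSup (fun k : ℕ => layer V h κ k) m.1.toNat)
    rw [Int.toNat_of_nonneg m.2.le]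

/-- The external tensor product of simple highest weight modules is simple: a submodule contains a
singular vector, and the singular vectors are the multiples of `v ⊗ w`. -/
theorem isIrreducible_extTensor [LieModule.IsIrreducible ℂ L₁ V] [LieModule.IsIrreducible ℂ L₂ W]
    {h₁ : L₁} {h₂ : L₂} (H₁ : IsGradingElement h₁) (H₂ : IsGradingElement h₂) {v : V} {w : W}
    (hv : IsHighestWeight h₁ v) (hw : IsHighestWeight h₂ w) :
    LieModule.IsIrreducible ℂ (L₁ × L₂) (ExtTensor V W) := by
  have : Nontrivial (ExtTensor V W) :=
    ⟨⟨_, _, (isHighestWeight_extMk one_ne_zero H₂ hv hw).ne_zero⟩⟩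
  refine LieModule.IsIrreducible.mk fun P hP => ?_
  obtain ⟨κ₁, hκ₁⟩ := hv.iSup_layer H₁
  obtain ⟨κ₂, hκ₂⟩ := hw.iSup_layer H₂
  obtain ⟨f, hfP, hf0, hf⟩ := exists_singular (iSup_layer_extTensor 1 hκ₁ hκ₂) P hP
  obtain ⟨w', rfl⟩ := exists_eq_extMk (v := v) f fun φ => by
    refine hv.singular_mem_span H₁ fun r hr x hx => ?_
    rw [← contract_lie (L₂ := L₂), hf r hr _ (inl_mem_gr hx), map_zero]
  have hw's : IsSingular h₂ w' := by
    intro r hr y hy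
    have h1 := hf _ (by simpa using hr) _ (inr_mem_gr hy)
    rw [lie_extMk, zero_lie, map_zero, LinearMap.zero_apply, zero_add] at h1
    exact eq_zero_of_extMk_eq_zero hv.ne_zero h1
  obtain ⟨c, rfl⟩ := hw.singular_mem_span H₂ hw's
  have hc : c ≠ 0 := by
    rintro rfl
    exact hf0 (by rw [zero_smul, map_zero])
  have hvw : extMk v w ∈ P.toSubmodule := by
    rw [map_smul] at hfP
    exact (Submodule.smul_mem_iff _ hc).1 hfP
  have h1 : ∀ v' : V, extMk v' w ∈ P.toSubmodule := by
    let K : LieSubmodule ℂ L₁ V :=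
      { P.toSubmodule.comap (extMk.flip w) with
        lie_mem := fun {x m} hm => by
          have h2 := P.lie_mem (x := (x, (0 : L₂))) hm
          rwa [LinearMap.flip_apply, lie_extMk, zero_lie, map_zero, add_zero] at h2 }
    intro v'
    have : K = ⊤ := eq_top_of_ne_zero K (show v ∈ K from hvw) hv.ne_zero
    exact (by rw [this]; trivial : v' ∈ K)
  have h2 : ∀ (v' : V) (w' : W), extMk v' w' ∈ P.toSubmodule := by
    intro v' w'
    let K : LieSubmodule ℂ L₂ W :=
      { P.toSubmodule.comap (extMk v') with
        lie_mem := fun {y m} hm => by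
          have h2 := P.lie_mem (x := ((0 : L₁), y)) hm
          rwa [lie_extMk, zero_lie, map_zero, LinearMap.zero_apply, zero_add] at h2 }
    have : K = ⊤ := eq_top_of_ne_zero K (show w ∈ K from h1 v') hw.ne_zero
    exact (by rw [this]; trivial : w' ∈ K)
  rw [eq_top_iff]
  rintro f -
  change f ∈ P.toSubmodule
  induction f using extTensor_induction with
  | zero => exact Submodule.zero_mem _
  | add f g hf hg => exact Submodule.add_mem _ hf hg
  | tmul v w => exact h2 v w

end ExternalTensor

/-! ### The principal grading of the special linear Lie algebra -/

section Principal

open LieAlgebra.SpecialLinear (single singleSubSingle val_single val_singleSubSingle)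

variable {n : ℕ}

/-- The diagonal matrix with entries `(n - 1) / 2, (n - 3) / 2, …, -(n - 1) / 2`; the elementary
matrix `E_{ij}` has degree `j - i` in the grading which it defines. -/
def rhoElt (n : ℕ) : sl (Fin n) ℂ :=
  ⟨Matrix.diagonal fun i => ((n : ℂ) - 1) / 2 - (i.val : ℂ), by
    change Matrix.trace (Matrix.diagonal fun i : Fin n => ((n : ℂ) - 1) / 2 - (i.val : ℂ)) = 0
    rw [Matrix.trace_diagonal, Finset.sum_sub_distrib, Fin.sum_univ_eq_sum_range (fun i => (i : ℂ)),
      ← Nat.cast_sum, Finset.sum_const, Finset.card_univ, Fintype.card_fin]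
    have h : ((∑ i ∈ Finset.range n, i : ℕ) : ℂ) * 2 = n * (n - 1) := by
      have := Finset.sum_range_id_mul_two n
      rcases n with _ | n
      · simp
      · have h2 := congrArg (Nat.cast (R := ℂ)) this
        push_cast at h2 ⊢
        simpa using h2
    rw [nsmul_eq_mul]
    linear_combination -h / 2⟩

theorem rhoElt_lie_apply (x : sl (Fin n) ℂ) (i j : Fin n) :
    (⁅rhoElt n, x⁆ : sl (Fin n) ℂ).val i j = ((j.val : ℂ) - i.val) * x.val i j := by
  change ((rhoElt n).val * x.val - x.val * (rhoElt n).val) i j = _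
  rw [rhoElt]
  rw [Matrix.sub_apply, Matrix.diagonal_mul, Matrix.mul_diagonal]
  ring

theorem mem_gr_rhoElt {r : ℤ} {x : sl (Fin n) ℂ} :
    x ∈ gr (rhoElt n) r ↔ ∀ i j : Fin n, x.val i j ≠ 0 → (j.val : ℤ) - i.val = r := by
  rw [mem_gr]
  constructor
  · intro h i j hij
    have h1 := congrArg (fun y : sl (Fin n) ℂ => y.val i j) h
    simp only [rhoElt_lie_apply] at h1
    have h2 := mul_right_cancel₀ hij (h1.trans (rfl : _ = (r : ℂ) * x.val i j))
    exact_mod_cast h2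
  · intro h
    apply Subtype.ext
    ext i j
    rw [rhoElt_lie_apply]
    change _ = (r : ℂ) * x.val i j
    by_cases hij : x.val i j = 0
    · rw [hij, mul_zero, mul_zero]
    · rw [← h i j hij]; push_cast; rfl

/-- As the trace of `x` vanishes, each `E_{ii}` in the expansion of `x` in elementary matrices can be
replaced by `E_{ii} - E_{kk}`. -/
theorem sl_eq_sum (k : Fin n) (x : sl (Fin n) ℂ) :
    x = ∑ i, ∑ j, if h : i = j then singleSubSingle i k (x.val i i)
      else single i j h (x.val i j) := by
  apply Subtype.ext
  have hx : ∑ i, x.val i i = 0 := x.2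
  have key : ∀ i j : Fin n, ((if h : i = j then singleSubSingle i k (x.val i i)
      else single i j h (x.val i j) : sl (Fin n) ℂ)).val = Matrix.single i j (x.val i j) -
        if i = j then Matrix.single k k (x.val i i) else 0 := by
    intro i j
    split_ifs with h
    · subst h; rw [val_singleSubSingle]
    · rw [val_single, sub_zero]
  have hval : ∀ f : Fin n → Fin n → sl (Fin n) ℂ,
      (∑ i, ∑ j, f i j).val = ∑ i, ∑ j, (f i j).val := by
    intro f
    simp only [AddSubmonoidClass.coe_finsetSum]
  rw [hval]
  simp only [key, Finset.sum_sub_distrib, ← Matrix.matrix_eq_sum_single]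
  have h0 : ∑ i, Matrix.single k k (x.val i i) = (0 : Matrix (Fin n) (Fin n) ℂ) := by
    have := (map_sum (Matrix.singleAddMonoidHom k k) (fun i => x.val i i) Finset.univ).symm
    rw [hx, map_zero] at this
    exact this
  simp [h0]

theorem single_mem_gr {i j : Fin n} (h : i ≠ j) (c : ℂ) :
    single i j h c ∈ gr (rhoElt n) ((j.val : ℤ) - i.val) := by
  rw [mem_gr_rhoElt]
  intro i' j' hne
  rw [val_single, Matrix.single_apply] at hne
  obtain ⟨rfl, rfl⟩ : i = i' ∧ j = j' := by
    by_contra h'; exact hne (if_neg h')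
  rfl

theorem singleSubSingle_mem_gr (i j : Fin n) (c : ℂ) :
    singleSubSingle i j c ∈ gr (rhoElt n) 0 := by
  rw [mem_gr_rhoElt]
  intro i' j' hne
  by_contra h
  have h' : i' ≠ j' := by rintro rfl; exact h (sub_self _)
  apply hne
  rw [val_singleSubSingle, Matrix.sub_apply, Matrix.single_apply, Matrix.single_apply,
    if_neg (by rintro ⟨rfl, rfl⟩; exact h' rfl), if_neg (by rintro ⟨rfl, rfl⟩; exact h' rfl),
    sub_zero]

theorem isGradingElement_rhoElt (hn : 0 < n) : IsGradingElement (rhoElt n) := by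
  rw [IsGradingElement, eq_top_iff]
  rintro x -
  rw [sl_eq_sum ⟨0, hn⟩ x]
  refine Submodule.sum_mem _ fun i _ => Submodule.sum_mem _ fun j _ => ?_
  split_ifs with h
  · exact Submodule.mem_iSup_of_mem _ (singleSubSingle_mem_gr _ _ _)
  · exact Submodule.mem_iSup_of_mem _ (single_mem_gr _ _)

theorem singleSubSingle_zero_mem_span (hn : 0 < n) (m : ℕ) (hm : m < n) (c : ℂ) :
    singleSubSingle ⟨m, hm⟩ ⟨0, hn⟩ c ∈ Submodule.span ℂ (Set.range (coroot (n := n))) := by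
  induction m with
  | zero =>
    have : singleSubSingle (⟨0, hm⟩ : Fin n) ⟨0, hn⟩ c = 0 := Subtype.ext (by simp)
    rw [this]; exact Submodule.zero_mem _
  | succ m ih =>
    have h1 := ih (by omega)
    have h2 : c • coroot (⟨m, by omega⟩ : Fin (n - 1)) ∈
        Submodule.span ℂ (Set.range (coroot (n := n))) :=
      Submodule.smul_mem _ _ (Submodule.subset_span ⟨_, rfl⟩)
    rw [coroot, ← map_smul, smul_eq_mul, mul_one] at h2
    have h3 := Submodule.sub_mem _ h1 h2
    rwa [LieAlgebra.SpecialLinear.singleSubSingle_sub_singleSubSingle] at h3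

/-- The component of degree zero is spanned by the simple coroots. -/
theorem gr_zero_le_span_coroot (hn : 0 < n) :
    gr (rhoElt n) 0 ≤ Submodule.span ℂ (Set.range (coroot (n := n))) := by
  intro x hx
  rw [mem_gr_rhoElt] at hx
  rw [sl_eq_sum ⟨0, hn⟩ x]
  refine Submodule.sum_mem _ fun i _ => Submodule.sum_mem _ fun j _ => ?_
  split_ifs with h
  · exact singleSubSingle_zero_mem_span hn i.val i.2 _
  · have : x.val i j = 0 := by
      by_contra h0
      have := hx i j h0
      exact h (Fin.ext (by omega))
    rw [this, map_zero]; exact Submodule.zero_mem _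

variable {V : Type*} [AddCommGroup V] [Module ℂ V] [LieRingModule (sl (Fin n) ℂ) V]
  [LieModule ℂ (sl (Fin n) ℂ) V]

theorem isSingular_rhoElt (hn : 0 < n) {v : V}
    (hv : ∀ (i j : Fin n) (h : i < j), ⁅single i j h.ne (1 : ℂ), v⁆ = 0) :
    IsSingular (rhoElt n) v := by
  intro r hr x hx
  rw [mem_gr_rhoElt] at hx
  rw [sl_eq_sum ⟨0, hn⟩ x, sum_lie]
  refine Finset.sum_eq_zero fun i _ => ?_
  rw [sum_lie]
  refine Finset.sum_eq_zero fun j _ => ?_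
  by_cases h0 : x.val i j = 0
  · split_ifs with h
    · subst h; rw [h0, map_zero, zero_lie]
    · rw [h0, map_zero, zero_lie]
  · have hij : i < j := Fin.lt_def.2 (by have := hx i j h0; omega)
    rw [dif_neg hij.ne, ← mul_one (x.val i j), ← smul_eq_mul, map_smul, smul_lie, hv i j hij,
      smul_zero]

/-- A vector on which the simple coroots act by scalars is an eigenvector of the component of degree
zero, with eigenvalues determined by these scalars. -/
theorem exists_smul_of_coroot (hn : 0 < n) {W : Type*} [AddCommGroup W] [Module ℂ W]
    [LieRingModule (sl (Fin n) ℂ) W] [LieModule ℂ (sl (Fin n) ℂ) W] {v : V} {w : W}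
    {lam : Fin (n - 1) → ℂ} (hv : ∀ i, ⁅coroot i, v⁆ = lam i • v)
    (hw : ∀ i, ⁅coroot i, w⁆ = lam i • w) {x : sl (Fin n) ℂ} (hx : x ∈ gr (rhoElt n) 0) :
    ∃ c : ℂ, ⁅x, v⁆ = c • v ∧ ⁅x, w⁆ = c • w := by
  refine Submodule.span_induction (p := fun x _ => ∃ c : ℂ, ⁅x, v⁆ = c • v ∧ ⁅x, w⁆ = c • w)
    ?_ ?_ ?_ ?_ (gr_zero_le_span_coroot hn hx)
  · rintro _ ⟨i, rfl⟩
    exact ⟨lam i, hv i, hw i⟩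
  · exact ⟨0, by simp, by simp⟩
  · rintro x y _ _ ⟨a, ha, ha'⟩ ⟨b, hb, hb'⟩
    exact ⟨a + b, by rw [add_lie, ha, hb, add_smul], by rw [add_lie, ha', hb', add_smul]⟩
  · rintro a x _ ⟨c, hc, hc'⟩
    exact ⟨a * c, by rw [smul_lie, hc, smul_smul], by rw [smul_lie, hc', smul_smul]⟩

theorem isHighestWeight_rhoElt (hn : 0 < n) {v : V} (h0 : v ≠ 0) {lam : Fin (n - 1) → ℂ}
    (hv : ∀ (i j : Fin n) (h : i < j), ⁅single i j h.ne (1 : ℂ), v⁆ = 0)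
    (hl : ∀ i, ⁅coroot i, v⁆ = lam i • v) : IsHighestWeight (rhoElt n) v :=
  ⟨h0, isSingular_rhoElt hn hv, fun _ hx =>
    let ⟨c, hc, _⟩ := exists_smul_of_coroot hn hl hl hx
    ⟨c, hc⟩⟩

end Principal

/-! ### The modules `L(lam)` are simple highest weight modules -/

section Simple

attribute [local instance 100] LieRing.ofAssociativeRing

variable {n : ℕ}

/-- A subspace of a module over the enveloping algebra which is stable under the Lie algebra is
stable under the enveloping algebra. -/
theorem smul_mem_of_lie_stable {M : Type*} [AddCommGroup M] [Module ℂ M] [Module (Usl n) M]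
    [IsScalarTower ℂ (Usl n) M] (p : Submodule ℂ M)
    (hp : ∀ (x : sl (Fin n) ℂ), ∀ m ∈ p, UniversalEnvelopingAlgebra.ι ℂ x • m ∈ p)
    (u : Usl n) : ∀ m ∈ p, u • m ∈ p := by
  let A : Subalgebra ℂ (Usl n) :=
    { carrier := {u | ∀ m ∈ p, u • m ∈ p}
      mul_mem' := fun {a b} ha hb m hm => by rw [mul_smul]; exact ha _ (hb _ hm)
      add_mem' := fun {a b} ha hb m hm => by rw [add_smul]; exact p.add_mem (ha _ hm) (hb _ hm)
      algebraMap_mem' := fun c m hm => by rw [algebraMap_smul]; exact p.smul_mem c hm }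
  let g : sl (Fin n) ℂ →ₗ⁅ℂ⁆ A :=
    { toFun := fun x => ⟨UniversalEnvelopingAlgebra.ι ℂ x, hp x⟩
      map_add' := fun x y => Subtype.ext (map_add _ x y)
      map_smul' := fun c x => Subtype.ext (map_smul _ c x)
      map_lie' := fun {x y} => Subtype.ext (LieHom.map_lie _ x y) }
  have h : A.val.comp (UniversalEnvelopingAlgebra.lift ℂ g) = AlgHom.id ℂ (Usl n) := by
    apply UniversalEnvelopingAlgebra.hom_ext
    ext x
    change ((UniversalEnvelopingAlgebra.lift ℂ g (UniversalEnvelopingAlgebra.ι ℂ x) : A) : Usl n) =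
      UniversalEnvelopingAlgebra.ι ℂ x
    rw [UniversalEnvelopingAlgebra.lift_ι_apply]
    rfl
  have h2 := DFunLike.congr_fun h u
  rw [AlgHom.id_apply] at h2
  rw [← h2]
  exact (UniversalEnvelopingAlgebra.lift ℂ g u).2

/-- The action of `sl_n` on the Verma module. -/
local instance vermaLieRingModule (lam : Fin (n - 1) → ℂ) :
    LieRingModule (sl (Fin n) ℂ) (Verma lam) where
  bracket x m := UniversalEnvelopingAlgebra.ι ℂ x • m
  add_lie x y m := by
    change UniversalEnvelopingAlgebra.ι ℂ (x + y) • m = _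
    rw [map_add, add_smul]
  lie_add x m m' := smul_add _ _ _
  leibniz_lie x y m := by
    change UniversalEnvelopingAlgebra.ι ℂ x • UniversalEnvelopingAlgebra.ι ℂ y • m =
      UniversalEnvelopingAlgebra.ι ℂ ⁅x, y⁆ • m +
        UniversalEnvelopingAlgebra.ι ℂ y • UniversalEnvelopingAlgebra.ι ℂ x • m
    rw [LieHom.map_lie, LieRing.of_associative_ring_bracket, sub_smul, mul_smul, mul_smul,
      sub_add_cancel]

local instance vermaLieModule (lam : Fin (n - 1) → ℂ) :
    LieModule ℂ (sl (Fin n) ℂ) (Verma lam) where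
  smul_lie c x m := by
    change UniversalEnvelopingAlgebra.ι ℂ (c • x) • m = c • UniversalEnvelopingAlgebra.ι ℂ x • m
    rw [map_smul, smul_assoc]
  lie_smul c x m := by
    change UniversalEnvelopingAlgebra.ι ℂ x • c • m = c • UniversalEnvelopingAlgebra.ι ℂ x • m
    rw [← algebraMap_smul (Usl n) c m, ← algebraMap_smul (Usl n) c (_ • m), smul_smul, smul_smul,
      Algebra.commutes]

/-- The canonical generator of the Verma module. -/
def vermaGen (lam : Fin (n - 1) → ℂ) : Verma lam := (vermaIdeal lam).mkQ 1

theorem verma_lie (lam : Fin (n - 1) → ℂ) (x : sl (Fin n) ℂ) (m : Verma lam) :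
    ⁅x, m⁆ = UniversalEnvelopingAlgebra.ι ℂ x • m := rfl

theorem smul_vermaGen (lam : Fin (n - 1) → ℂ) (u : Usl n) :
    u • vermaGen lam = (vermaIdeal lam).mkQ u := by
  rw [vermaGen, ← map_smul, smul_eq_mul, mul_one]

theorem single_lie_vermaGen (lam : Fin (n - 1) → ℂ) (i j : Fin n) (h : i < j) :
    ⁅LieAlgebra.SpecialLinear.single i j h.ne (1 : ℂ), vermaGen lam⁆ = 0 := by
  rw [verma_lie, smul_vermaGen]
  exact (Submodule.Quotient.mk_eq_zero _).2 (Submodule.subset_span (Or.inl ⟨i, j, h, rfl⟩))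

theorem coroot_lie_vermaGen (lam : Fin (n - 1) → ℂ) (i : Fin (n - 1)) :
    ⁅coroot i, vermaGen lam⁆ = lam i • vermaGen lam := by
  rw [verma_lie, ← algebraMap_smul (Usl n) (lam i) (vermaGen lam), smul_vermaGen, smul_vermaGen,
    ← sub_eq_zero, ← map_sub]
  exact (Submodule.Quotient.mk_eq_zero _).2 (Submodule.subset_span (Or.inr ⟨i, rfl⟩))

theorem exists_smul_vermaGen {lam : Fin (n - 1) → ℂ} (m : Verma lam) :
    ∃ u : Usl n, m = u • vermaGen lam := by
  obtain ⟨u, rfl⟩ := (vermaIdeal lam).mkQ_surjective m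
  exact ⟨u, (smul_vermaGen lam u).symm⟩

/-- If some `sl_n`-module has a highest weight vector of weight `lam`, the Verma module of highest
weight `lam` is not zero. -/
theorem vermaGen_ne_zero {V : Type*} [AddCommGroup V] [Module ℂ V] [LieRingModule (sl (Fin n) ℂ) V]
    [LieModule ℂ (sl (Fin n) ℂ) V] {v : V} (h0 : v ≠ 0) {lam : Fin (n - 1) → ℂ}
    (hv : ∀ (i j : Fin n) (h : i < j),
      ⁅LieAlgebra.SpecialLinear.single i j h.ne (1 : ℂ), v⁆ = 0)
    (hl : ∀ i, ⁅coroot i, v⁆ = lam i • v) : vermaGen lam ≠ 0 := by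
  let T := UniversalEnvelopingAlgebra.lift ℂ (LieModule.toEnd ℂ (sl (Fin n) ℂ) V)
  have hT : ∀ x : sl (Fin n) ℂ, T (UniversalEnvelopingAlgebra.ι ℂ x) v = ⁅x, v⁆ := by
    intro x
    rw [UniversalEnvelopingAlgebra.lift_ι_apply]; rfl
  have h1 : ∀ u ∈ vermaIdeal lam, T u v = 0 := by
    intro u hu
    refine Submodule.span_induction (p := fun u _ => T u v = 0) ?_ ?_ ?_ ?_ hu
    · rintro u (⟨i, j, h, rfl⟩ | ⟨i, rfl⟩)
      · rw [hT, hv i j h]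
      · rw [map_sub, LinearMap.sub_apply, hT, hl, AlgHom.commutes, Module.algebraMap_end_apply,
          sub_self]
    · rw [map_zero, LinearMap.zero_apply]
    · intro a b _ _ ha hb
      rw [map_add, LinearMap.add_apply, ha, hb, add_zero]
    · intro a b _ hb
      rw [smul_eq_mul, map_mul, Module.End.mul_apply, hb, map_zero]
  intro h
  have h2 := h1 1 ((Submodule.Quotient.mk_eq_zero _).1 h)
  rw [map_one, Module.End.one_apply] at h2
  exact h0 h2

theorem lieSpan_vermaGen (lam : Fin (n - 1) → ℂ) :
    LieSubmodule.lieSpan ℂ (sl (Fin n) ℂ) {vermaGen lam} = ⊤ := by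
  rw [eq_top_iff]
  rintro m -
  obtain ⟨u, rfl⟩ := exists_smul_vermaGen m
  exact smul_mem_of_lie_stable
    (LieSubmodule.lieSpan ℂ (sl (Fin n) ℂ) {vermaGen lam}).toSubmodule
    (fun x m hm => LieSubmodule.lie_mem _ hm) u _ (LieSubmodule.subset_lieSpan rfl)

/-- The sum of all proper submodules of a nonzero Verma module is proper, since each of them lies
in the sum of the eigenspaces of `rhoElt n` not containing the generator. -/
theorem vermaRadical_ne_top (hn : 0 < n) {lam : Fin (n - 1) → ℂ} (h0 : vermaGen lam ≠ 0) :
    vermaRadical lam ≠ ⊤ := by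
  have hv : IsHighestWeight (rhoElt n) (vermaGen lam) :=
    isHighestWeight_rhoElt hn h0 (single_lie_vermaGen lam) (coroot_lie_vermaGen lam)
  obtain ⟨κ, hκ⟩ := hv.exists_smul _ (self_mem_gr _)
  have key : ∀ P : Submodule (Usl n) (Verma lam), P ≠ ⊤ → ∀ x ∈ P,
      x ∈ tail (Verma lam) (rhoElt n) κ := by
    intro P hP x hx
    have h1 : x ∈ LieSubmodule.lieSpan ℂ (sl (Fin n) ℂ) {vermaGen lam} := by
      rw [lieSpan_vermaGen]; trivial
    obtain ⟨a, ha, b, hb, rfl⟩ :=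
      Submodule.mem_sup.1 (hv.lieSpan_le (isGradingElement_rhoElt hn) hκ h1)
    obtain ⟨c, rfl⟩ := Submodule.mem_span_singleton.1 ha
    have h2 : c • vermaGen lam ∈ P.restrictScalars ℂ :=
      mem_of_add_mem_eigenspaces (LieModule.toEnd ℂ (sl (Fin n) ℂ) (Verma lam) (rhoElt n))
        (P.restrictScalars ℂ) (fun y hy => P.smul_mem _ hy) κ
        (by rw [LieModule.toEnd_apply_apply, lie_smul, hκ, smul_comm]) (tail_le _ _ hb) hx
    by_cases hc : c = 0
    · rw [hc, zero_smul, zero_add]; exact hb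
    · refine absurd (eq_top_iff.2 fun m _ => ?_) hP
      obtain ⟨u, rfl⟩ := exists_smul_vermaGen m
      exact P.smul_mem u ((Submodule.smul_mem_iff (P.restrictScalars ℂ) hc).1 h2)
  intro htop
  have h1 : vermaGen lam ∈ vermaRadical lam := by rw [htop]; trivial
  rw [vermaRadical, sSup_eq_iSup'] at h1
  exact h0 (eq_zero_of_mem_tail hκ (Submodule.iSup_induction _
    (motive := fun x => x ∈ tail (Verma lam) (rhoElt n) κ) h1 (fun P x hx => key P.1 P.2 x hx)
    (Submodule.zero_mem _) fun x y hx hy => Submodule.add_mem _ hx hy))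

/-- The canonical generator of `L(lam)`. -/
def hwVec (lam : Fin (n - 1) → ℂ) : SimpleHW lam := (vermaRadical lam).mkQ (vermaGen lam)

theorem mkQ_lie (lam : Fin (n - 1) → ℂ) (x : sl (Fin n) ℂ) (m : Verma lam) :
    (⁅x, ((vermaRadical lam).mkQ m : SimpleHW lam)⁆ : SimpleHW lam) =
      (vermaRadical lam).mkQ ⁅x, m⁆ := rfl

theorem single_lie_hwVec (lam : Fin (n - 1) → ℂ) (i j : Fin n) (h : i < j) :
    ⁅LieAlgebra.SpecialLinear.single i j h.ne (1 : ℂ), hwVec lam⁆ = 0 := by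
  rw [hwVec, mkQ_lie, single_lie_vermaGen lam i j h]
  exact map_zero _

theorem coroot_lie_hwVec (lam : Fin (n - 1) → ℂ) (i : Fin (n - 1)) :
    ⁅coroot i, hwVec lam⁆ = lam i • hwVec lam := by
  rw [hwVec, mkQ_lie, coroot_lie_vermaGen]
  exact ((vermaRadical lam).mkQ.restrictScalars ℂ).map_smul _ _

theorem hwVec_ne_zero (hn : 0 < n) {lam : Fin (n - 1) → ℂ} (h0 : vermaGen lam ≠ 0) :
    hwVec lam ≠ 0 := by
  intro h
  refine vermaRadical_ne_top hn h0 (eq_top_iff.2 fun m _ => ?_)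
  obtain ⟨u, rfl⟩ := exists_smul_vermaGen m
  exact Submodule.smul_mem _ u ((Submodule.Quotient.mk_eq_zero _).1 h)

theorem isHighestWeight_hwVec (hn : 0 < n) {lam : Fin (n - 1) → ℂ} (h0 : vermaGen lam ≠ 0) :
    IsHighestWeight (rhoElt n) (hwVec lam) :=
  isHighestWeight_rhoElt hn (hwVec_ne_zero hn h0) (single_lie_hwVec lam) (coroot_lie_hwVec lam)

/-- The preimage in the Verma module of a proper submodule of `L(lam)` is proper, hence contained in
the radical. The hypothesis says that the Verma module is not zero. -/
theorem isIrreducible_simpleHW (hn : 0 < n) {lam : Fin (n - 1) → ℂ} (h0 : vermaGen lam ≠ 0) :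
    LieModule.IsIrreducible ℂ (sl (Fin n) ℂ) (SimpleHW lam) := by
  have : Nontrivial (SimpleHW lam) := ⟨⟨_, _, hwVec_ne_zero hn h0⟩⟩
  refine LieModule.IsIrreducible.mk fun P hP => ?_
  obtain ⟨f, hf, hf0⟩ := exists_mem_ne_zero hP
  let q : Verma lam →ₗ[Usl n] SimpleHW lam := (vermaRadical lam).mkQ
  have hq : Function.Surjective q := (vermaRadical lam).mkQ_surjective
  let P' : Submodule (Usl n) (Verma lam) :=
    { carrier := {m | q m ∈ P.toSubmodule}
      zero_mem' := by
        change q 0 ∈ P.toSubmodule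
        rw [map_zero]; exact Submodule.zero_mem _
      add_mem' := fun {a b} ha hb => by
        change q (a + b) ∈ P.toSubmodule
        rw [map_add]; exact Submodule.add_mem _ ha hb
      smul_mem' := fun u m hm => by
        change q (u • m) ∈ P.toSubmodule
        rw [map_smul]
        exact smul_mem_of_lie_stable P.toSubmodule (fun x m hm => P.lie_mem hm) u _ hm }
  have hP' : P' = ⊤ := by
    by_contra hne
    have h1 : P' ≤ vermaRadical lam := le_sSup hne
    obtain ⟨m, rfl⟩ := hq f
    exact hf0 ((Submodule.Quotient.mk_eq_zero _).2 (h1 hf))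
  rw [eq_top_iff]
  rintro g -
  obtain ⟨m, rfl⟩ := hq g
  have : m ∈ P' := by rw [hP']; trivial
  exact this

/-- Isomorphic modules `L(lam)` have the same highest weight. -/
theorem weight_eq_of_equiv (hn : 0 < n) {lam mu : Fin (n - 1) → ℂ} (h0 : vermaGen lam ≠ 0)
    (h0' : vermaGen mu ≠ 0) (e : SimpleHW lam ≃ₗ⁅ℂ, sl (Fin n) ℂ⁆ SimpleHW mu) : lam = mu := by
  have := isIrreducible_simpleHW hn h0'
  have hlie : ∀ (x : sl (Fin n) ℂ) m, e ⁅x, m⁆ = ⁅x, e m⁆ := fun x m =>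
    LieModuleHom.map_lie e.toLieModuleHom x m
  obtain ⟨c, hc⟩ := (isHighestWeight_hwVec hn h0').singular_mem_span (isGradingElement_rhoElt hn)
    (f := e (hwVec lam)) fun r hr x hx => by
      rw [← hlie, (isHighestWeight_hwVec hn h0).isSingular r hr x hx]
      exact e.toLinearEquiv.map_zero
  have hne : e (hwVec lam) ≠ 0 := fun h =>
    hwVec_ne_zero hn h0 (e.toLinearEquiv.map_eq_zero_iff.1 h)
  funext i
  have h1 : lam i • e (hwVec lam) = mu i • e (hwVec lam) := by
    have h2 := hlie (coroot i) (hwVec lam)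
    rw [coroot_lie_hwVec] at h2
    rw [← show e (lam i • hwVec lam) = lam i • e (hwVec lam) from e.toLinearEquiv.map_smul _ _, h2,
      hc, lie_smul, coroot_lie_hwVec, smul_comm]
  exact smul_left_injective ℂ hne h1

end Simple

/-! ### The contravariant form -/

section Form

/-- The coefficient of `q_i x(b)`, as a function of `b_i`. -/
def qCoeff (z : ℂ) : ℂ := if IsNegInt z then z + 1 else 1

/-- The coefficient of `p_i x(b)`, as a function of `b_i`. -/
def pCoeff (z : ℂ) : ℂ := if IsNegInt z then 1 else z

theorem pCoeff_mul_qCoeff (z : ℂ) : pCoeff z * qCoeff (z - 1) = z := by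
  by_cases h0 : z = 0
  · rw [pCoeff, if_neg (h0 ▸ not_isNegInt_zero), h0, zero_mul]
  · rw [pCoeff, qCoeff]
    simp only [isNegInt_sub_one h0]
    split_ifs <;> ring

/-- The square length of `x(b)` for the contravariant form is the product of these numbers at the
entries of `b`. On negative integers the value is `(-1)^z (-1 - z)!`. -/
def gammaFactor (z : ℂ) : ℂ :=
  if IsNegInt z then Complex.cos (Real.pi * z) * Complex.Gamma (-z) else Complex.Gamma (z + 1)

theorem gammaFactor_ne_zero (z : ℂ) : gammaFactor z ≠ 0 := by
  rw [gammaFactor]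
  split_ifs with h
  · obtain ⟨k, hk, rfl⟩ := h
    refine mul_ne_zero ?_ (Complex.Gamma_ne_zero fun m hm => ?_)
    · have h1 : Complex.cos (Real.pi * k) = ((-1 : ℝ) ^ k : ℝ) := by
        rw [← Real.cos_int_mul_pi, mul_comm]; push_cast; rfl
      rw [h1]
      exact_mod_cast zpow_ne_zero k (by norm_num : (-1 : ℝ) ≠ 0)
    · have : k = m := by exact_mod_cast neg_injective hm
      omega
  · refine Complex.Gamma_ne_zero fun m hm => h ⟨-m - 1, by omega, ?_⟩
    push_cast
    linear_combination hm

theorem gammaFactor_add_one (z : ℂ) :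
    gammaFactor (z + 1) * qCoeff z = pCoeff (z + 1) * gammaFactor z := by
  by_cases h1 : z = -1
  · subst h1
    rw [qCoeff, if_pos isNegInt_neg_one, neg_add_cancel, mul_zero, pCoeff,
      if_neg not_isNegInt_zero, zero_mul]
  have h1' : z + 1 ≠ 0 := fun h => h1 (by linear_combination h)
  rw [gammaFactor, gammaFactor, qCoeff, pCoeff]
  simp only [isNegInt_add_one h1]
  split_ifs with h
  · have h2 : Complex.Gamma (-z) = -(z + 1) * Complex.Gamma (-(z + 1)) := by
      rw [← Complex.Gamma_add_one _ (neg_ne_zero.2 h1')]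
      congr 1; ring
    have h3 : Complex.cos (Real.pi * (z + 1)) = -Complex.cos (Real.pi * z) := by
      rw [mul_add, mul_one, Complex.cos_add_pi]
    rw [h2, h3]; ring
  · rw [mul_one, Complex.Gamma_add_one _ h1']

variable {ι : Type} [Fintype ι]

/-- The coefficient of `x(b)`. -/
def coeff (b : ι → ℂ) : Mono ι →ₗ[ℂ] ℂ := Finsupp.lapply b

/-- The bilinear form for which the `x(b)` are orthogonal and `q_i`, `p_i` are adjoint. -/
def form : Mono ι →ₗ[ℂ] Mono ι →ₗ[ℂ] ℂ :=
  Finsupp.linearCombination ℂ fun b : ι → ℂ => (∏ i, gammaFactor (b i)) • coeff b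

theorem form_mono (b : ι → ℂ) (g : Mono ι) :
    form (mono b) g = (∏ i, gammaFactor (b i)) * coeff b g := by
  have : form (mono b) = (1 : ℂ) • ((∏ i, gammaFactor (b i)) • coeff b) :=
    Finsupp.linearCombination_single ℂ 1 b
  rw [this, one_smul]; rfl

theorem coeff_mono (b b' : ι → ℂ) :
    coeff b' (mono b) = if b = b' then 1 else 0 := Finsupp.single_apply

theorem form_mono_mono (b b' : ι → ℂ) :
    form (mono b) (mono b') = if b = b' then ∏ i, gammaFactor (b i) else 0 := by
  rw [form_mono, coeff_mono, mul_ite, mul_one, mul_zero]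
  simp only [eq_comm]

omit [Fintype ι] in
theorem form_ext {F G : Mono ι →ₗ[ℂ] Mono ι →ₗ[ℂ] ℂ}
    (h : ∀ b b', F (mono b) (mono b') = G (mono b) (mono b')) : F = G :=
  Finsupp.lhom_ext' fun b => LinearMap.ext_ring <|
    Finsupp.lhom_ext' fun b' => LinearMap.ext_ring (h b b')

theorem form_symm (f g : Mono ι) : form f g = form g f := by
  have : (form : Mono ι →ₗ[ℂ] Mono ι →ₗ[ℂ] ℂ) = form.flip := form_ext fun b b' => by
    rw [LinearMap.flip_apply, form_mono_mono, form_mono_mono]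
    by_cases h : b = b'
    · subst h; rfl
    · rw [if_neg h, if_neg (Ne.symm h)]
  exact DFunLike.congr_fun (DFunLike.congr_fun this f) g

theorem form_mono_right (f : Mono ι) (b : ι → ℂ) :
    form f (mono b) = (∏ i, gammaFactor (b i)) * coeff b f := by
  rw [form_symm, form_mono]

variable [DecidableEq ι]

theorem form_qOp (i : ι) (f g : Mono ι) : form (qOp i f) g = form f (pOp i g) := by
  have : form.comp (qOp i) = (form (ι := ι)).compl₂ (pOp i) := form_ext fun b b' => by
    rw [LinearMap.comp_apply, LinearMap.compl₂_apply, qOp_mono, pOp_mono, map_smul, map_smul,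
      LinearMap.smul_apply, form_mono_mono, form_mono_mono]
    by_cases h : b' = b + Pi.single i 1
    · subst h
      rw [if_pos rfl, if_pos (add_sub_cancel_right b _).symm,
        ← Finset.mul_prod_erase _ _ (Finset.mem_univ i),
        ← Finset.mul_prod_erase _ (fun j => gammaFactor (b j)) (Finset.mem_univ i)]
      have h1 : ∏ j ∈ Finset.univ.erase i, gammaFactor ((b + Pi.single i 1 : ι → ℂ) j) =
          ∏ j ∈ Finset.univ.erase i, gammaFactor (b j) := by
        refine Finset.prod_congr rfl fun j hj => ?_
        rw [Pi.add_apply, Pi.single_eq_of_ne (Finset.ne_of_mem_erase hj), add_zero]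
      have h2 := gammaFactor_add_one (b i)
      rw [qCoeff, pCoeff] at h2
      rw [h1, Pi.add_apply, Pi.single_eq_same, smul_eq_mul, smul_eq_mul, ← mul_assoc, ← mul_assoc,
        ← h2, mul_comm (gammaFactor _)]
    · have h1 : b + Pi.single i 1 ≠ b' := fun h' => h h'.symm
      have h2 : b ≠ b' - Pi.single i 1 := fun h' => h (by rw [h', sub_add_cancel])
      rw [if_neg h1, if_neg h2, smul_zero, smul_zero]
  exact DFunLike.congr_fun (DFunLike.congr_fun this f) g

/-- The form is contravariant for the transposition of matrices. -/
theorem form_matAct (A : Matrix ι ι ℂ) (f g : Mono ι) :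
    form (matAct A f) g = form f (matAct A.transpose g) := by
  have h : ∀ i j : ι, form (qOp i (pOp j f)) g = form f (qOp j (pOp i g)) := by
    intro i j
    rw [form_qOp, form_symm, ← form_qOp, form_symm]
  simp only [matAct, LinearMap.sum_apply, LinearMap.smul_apply, Module.End.mul_apply, map_sum,
    map_smul, h, Matrix.transpose_apply]
  exact Finset.sum_comm

omit [Fintype ι] in
theorem qOp_pOp_mono {i j : ι} (hij : i ≠ j) (b : ι → ℂ) :
    qOp i (pOp j (mono b)) =
      (pCoeff (b j) * qCoeff (b i)) • mono (b - Pi.single j 1 + Pi.single i 1) := by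
  rw [pOp_mono, map_smul, qOp_mono, smul_smul, Pi.sub_apply, Pi.single_eq_of_ne hij, sub_zero]
  rfl

omit [Fintype ι] in
theorem qOp_pOp_mono_self (i : ι) (b : ι → ℂ) : qOp i (pOp i (mono b)) = b i • mono b := by
  rw [pOp_mono, map_smul, qOp_mono, smul_smul, sub_add_cancel, Pi.sub_apply, Pi.single_eq_same]
  exact congrArg (· • mono b) (pCoeff_mul_qCoeff (b i))

end Form

/-! ### Admissible tuples and their degree -/

section Tuples

variable {n : ℕ}

/-- A tuple stays admissible when a unit is moved from one entry to another, unless this changes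
an entry `0` to `-1` or an entry `-1` to `0`. -/
theorem admSet_shift {ι : Type} [Fintype ι] [DecidableEq ι] {a b : ι → ℂ} (hb : b ∈ admSet a)
    {i j : ι} (hij : i ≠ j) (hj : b j ≠ 0) (hi : b i ≠ -1) :
    b - Pi.single j 1 + Pi.single i 1 ∈ admSet a := by
  refine ⟨fun k => ?_, ?_⟩
  · obtain ⟨⟨m, hm⟩, hk⟩ := hb.1 k
    rw [Pi.add_apply, Pi.sub_apply]
    by_cases hkj : k = j
    · subst hkj
      rw [Pi.single_eq_same, Pi.single_eq_of_ne hij.symm, add_zero, isNegInt_sub_one hj]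
      exact ⟨⟨m - 1, by push_cast; linear_combination hm⟩, hk⟩
    · rw [Pi.single_eq_of_ne hkj, sub_zero]
      by_cases hki : k = i
      · subst hki
        rw [Pi.single_eq_same, isNegInt_add_one hi]
        exact ⟨⟨m + 1, by push_cast; linear_combination hm⟩, hk⟩
      · rw [Pi.single_eq_of_ne hki, add_zero]
        exact ⟨⟨m, hm⟩, hk⟩
  · simp only [Pi.add_apply, Pi.sub_apply, Finset.sum_add_distrib, Finset.sum_sub_distrib,
      Finset.sum_pi_single', Finset.mem_univ, if_true]
    rw [hb.2]; ring

/-- The weights of the entries in the degree of a tuple. -/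
def degWeight (n : ℕ) : Fin n ⊕ Fin n → ℂ :=
  Sum.elim (fun i => (i.val : ℂ) - ((n : ℂ) - 1)) (fun j => (j.val : ℂ))

/-- The degree of a tuple: up to a constant and a sign, the eigenvalue on `x(b)` of
`(ρ, (n - 1) ρ)`, where `ρ` stands for `rhoElt n` and `rhoElt 2`. On admissible tuples it is a
natural number, which vanishes exactly on the tuples `(-1, …, -1, a₁ + s, a₂ - s, 0, …, 0)`. -/
def deg (a₁ a₂ : ℂ) (b : Fin n ⊕ Fin n → ℂ) : ℂ :=
  ∑ k, degWeight n k * (b k - expTuple n a₁ a₂ k)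

theorem deg_shift (a₁ a₂ : ℂ) (b : Fin n ⊕ Fin n → ℂ) (i j : Fin n ⊕ Fin n) :
    deg a₁ a₂ (b - Pi.single j 1 + Pi.single i 1) =
      deg a₁ a₂ b - degWeight n j + degWeight n i := by
  have h : ∀ k l : Fin n ⊕ Fin n, degWeight n k * Pi.single (M := fun _ => ℂ) l 1 k =
      Pi.single (M := fun _ => ℂ) l (degWeight n l) k := by
    intro k l
    by_cases hkl : k = l
    · subst hkl; simp
    · simp [hkl]
  have h2 : ∀ k, degWeight n k *
      ((b - Pi.single j 1 + Pi.single i 1 : Fin n ⊕ Fin n → ℂ) k - expTuple n a₁ a₂ k) =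
      degWeight n k * (b k - expTuple n a₁ a₂ k) -
        Pi.single (M := fun _ => ℂ) j (degWeight n j) k +
        Pi.single (M := fun _ => ℂ) i (degWeight n i) k := by
    intro k
    rw [← h, ← h, Pi.add_apply, Pi.sub_apply]; ring
  simp only [deg, h2, Finset.sum_add_distrib, Finset.sum_sub_distrib, Finset.sum_pi_single',
    Finset.mem_univ, if_true]

theorem not_isNegInt_of_ne {z : ℂ} (hz : ∀ k : ℤ, z ≠ k) : ¬ IsNegInt z :=
  fun ⟨k, _, h⟩ => hz k h

/-- The entries of an admissible tuple. -/
structure AdmEntries (n : ℕ) (a₁ a₂ : ℂ) (b : Fin n ⊕ Fin n → ℂ) : Prop where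
  left : ∀ i : Fin n, i.val + 1 ≠ n → ∃ k : ℕ, b (Sum.inl i) = -1 - k
  left_last : ∀ i : Fin n, i.val + 1 = n → ∃ s : ℤ, b (Sum.inl i) = a₁ + s
  right_zero : ∀ j : Fin n, j.val = 0 → ∃ t : ℤ, b (Sum.inr j) = a₂ + t
  right : ∀ j : Fin n, j.val ≠ 0 → ∃ k : ℕ, b (Sum.inr j) = k

theorem admEntries {a₁ a₂ : ℂ} {b : Fin n ⊕ Fin n → ℂ} (hb : b ∈ admSet (expTuple n a₁ a₂)) :
    AdmEntries n a₁ a₂ b where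
  left i hi := by
    have h1 := (hb.1 (Sum.inl i)).2
    rw [expTuple, Sum.elim_inl, if_neg hi] at h1
    obtain ⟨k, hk, h⟩ := h1.2 isNegInt_neg_one
    refine ⟨(-1 - k).toNat, ?_⟩
    have h2 : (((-1 - k).toNat : ℤ) : ℂ) = ((-1 - k : ℤ) : ℂ) := by
      rw [Int.toNat_of_nonneg (by omega)]
    rw [Int.cast_natCast] at h2
    rw [h, h2]; push_cast; ring
  left_last i hi := by
    obtain ⟨m, hm⟩ := (hb.1 (Sum.inl i)).1
    rw [expTuple, Sum.elim_inl, if_pos hi] at hm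
    exact ⟨m, by linear_combination hm⟩
  right_zero j hj := by
    obtain ⟨m, hm⟩ := (hb.1 (Sum.inr j)).1
    rw [expTuple, Sum.elim_inr, if_pos hj] at hm
    exact ⟨m, by linear_combination hm⟩
  right j hj := by
    obtain ⟨⟨m, hm⟩, h1⟩ := hb.1 (Sum.inr j)
    rw [expTuple, Sum.elim_inr, if_neg hj] at hm h1
    have hm' : b (Sum.inr j) = m := by linear_combination hm
    have h2 : 0 ≤ m := by
      by_contra h
      exact not_isNegInt_zero (h1.1 ⟨m, by omega, hm'⟩)
    refine ⟨m.toNat, ?_⟩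
    rw [hm', ← Int.cast_natCast, Int.toNat_of_nonneg h2]

theorem AdmEntries.left_isNegInt {a₁ a₂ : ℂ} {b : Fin n ⊕ Fin n → ℂ} (hb : AdmEntries n a₁ a₂ b)
    {i : Fin n} (hi : i.val + 1 ≠ n) : IsNegInt (b (Sum.inl i)) := by
  obtain ⟨k, hk⟩ := hb.left i hi
  exact ⟨-1 - k, by omega, by rw [hk]; push_cast; ring⟩

theorem AdmEntries.left_last_ne {a₁ a₂ : ℂ} (h₁ : ∀ k : ℤ, a₁ ≠ k) {b : Fin n ⊕ Fin n → ℂ}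
    (hb : AdmEntries n a₁ a₂ b) {i : Fin n} (hi : i.val + 1 = n) (k : ℤ) :
    b (Sum.inl i) ≠ k := by
  obtain ⟨s, hs⟩ := hb.left_last i hi
  intro h
  exact h₁ (k - s) (by push_cast; linear_combination h - hs)

theorem AdmEntries.right_zero_ne {a₁ a₂ : ℂ} (h₂ : ∀ k : ℤ, a₂ ≠ k) {b : Fin n ⊕ Fin n → ℂ}
    (hb : AdmEntries n a₁ a₂ b) {j : Fin n} (hj : j.val = 0) (k : ℤ) :
    b (Sum.inr j) ≠ k := by
  obtain ⟨s, hs⟩ := hb.right_zero j hj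
  intro h
  exact h₂ (k - s) (by push_cast; linear_combination h - hs)

theorem AdmEntries.left_ne_zero {a₁ a₂ : ℂ} (h₁ : ∀ k : ℤ, a₁ ≠ k) {b : Fin n ⊕ Fin n → ℂ}
    (hb : AdmEntries n a₁ a₂ b) (i : Fin n) : b (Sum.inl i) ≠ 0 := by
  by_cases hi : i.val + 1 = n
  · simpa using hb.left_last_ne h₁ hi 0
  · intro h
    exact not_isNegInt_zero (h ▸ hb.left_isNegInt hi)

theorem AdmEntries.right_ne_neg_one {a₁ a₂ : ℂ} (h₂ : ∀ k : ℤ, a₂ ≠ k) {b : Fin n ⊕ Fin n → ℂ}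
    (hb : AdmEntries n a₁ a₂ b) (j : Fin n) : b (Sum.inr j) ≠ -1 := by
  by_cases hj : j.val = 0
  · simpa using hb.right_zero_ne h₂ hj (-1)
  · obtain ⟨k, hk⟩ := hb.right j hj
    rw [hk]
    intro h
    have : (k : ℤ) = -1 := by exact_mod_cast h
    omega

theorem not_isNegInt_natCast (k : ℕ) : ¬ IsNegInt (k : ℂ) := by
  rintro ⟨m, hm, h⟩
  have : (k : ℤ) = m := by exact_mod_cast h
  omega

end Tuples

/-! ### The quotient by the lowering operators -/

section Lowering

variable {n : ℕ}

theorem matAct_blockDiag_single (i j : Fin n) (f : Mono (Fin n ⊕ Fin n)) :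
    matAct (Matrix.fromBlocks (Matrix.single j i 1) 0 0 (Matrix.single j i 1)) f =
      qOp (Sum.inl j) (pOp (Sum.inl i) f) + qOp (Sum.inr j) (pOp (Sum.inr i) f) := by
  simp [matAct, Fintype.sum_sum_type, Matrix.single_apply, ite_and, Finset.sum_add_distrib,
    ite_smul]

theorem matAct_scalarBlocks_single (f : Mono (Fin n ⊕ Fin n)) :
    matAct (scalarBlocks n (Matrix.single 1 0 1)) f =
      ∑ i, qOp (Sum.inr i) (pOp (Sum.inl i) f) := by
  simp [matAct, scalarBlocks, Fintype.sum_sum_type, Matrix.one_apply,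
    ite_smul, LinearMap.sum_apply]

variable {a₁ a₂ : ℂ} {V : Type*} [AddCommGroup V] [Module ℂ V]

/-- A linear map which vanishes on the images of the lowering operators in degree `D ≠ 0` vanishes
in degree `D`. First, `E_{j0}` expresses `x(b)` modulo these images by tuples with a smaller
`j`-th entry on the right. Second, if the entries on the right other than the first one vanish,
then either some `E_{n-1,i}` maps a basis vector to `x(b)`, or the relation
`(v₀ - ∑_{i ≥ 1} u_i) x(b) = 0` follows from the image of `X = ∑ E_{n+i,i}`. The coefficient in it
is not zero as `a₁ - a₂` is not an integer. -/
theorem apply_mono_eq_zero (hn : 1 < n) (h₁ : ∀ k : ℤ, a₁ ≠ k) (h₂ : ∀ k : ℤ, a₂ ≠ k)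
    (h₁₂ : ∀ k : ℤ, a₁ - a₂ ≠ k) (φ : Mono (Fin n ⊕ Fin n) →ₗ[ℂ] V) {D : ℂ} (hD : D ≠ 0)
    (hE : ∀ i j : Fin n, i < j → ∀ b ∈ admSet (expTuple n a₁ a₂),
      deg a₁ a₂ b = D - ((j.val : ℂ) - i.val) →
      φ (matAct (Matrix.fromBlocks (Matrix.single j i 1) 0 0 (Matrix.single j i 1)) (mono b)) = 0)
    (hX : ∀ b ∈ admSet (expTuple n a₁ a₂), deg a₁ a₂ b = D - ((n : ℂ) - 1) →
      φ (matAct (scalarBlocks n (Matrix.single 1 0 1)) (mono b)) = 0)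
    (b : Fin n ⊕ Fin n → ℂ) (hb : b ∈ admSet (expTuple n a₁ a₂)) (hbD : deg a₁ a₂ b = D) :
    φ (mono b) = 0 := by
  let z : Fin n := ⟨0, by omega⟩
  let l : Fin n := ⟨n - 1, by omega⟩
  have hl : l.val + 1 = n := by simp only [l]; omega
  have hlC : (l.val : ℂ) = n - 1 := by
    rw [eq_sub_iff_add_eq]; exact_mod_cast hl
  -- the relations in terms of exponents
  have hE' : ∀ i j : Fin n, i < j → ∀ b ∈ admSet (expTuple n a₁ a₂),
      deg a₁ a₂ b = D - ((j.val : ℂ) - i.val) →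
      (pCoeff (b (Sum.inl i)) * qCoeff (b (Sum.inl j))) •
        φ (mono (b - Pi.single (Sum.inl i) 1 + Pi.single (Sum.inl j) 1)) +
      (pCoeff (b (Sum.inr i)) * qCoeff (b (Sum.inr j))) •
        φ (mono (b - Pi.single (Sum.inr i) 1 + Pi.single (Sum.inr j) 1)) = 0 := by
    intro i j hij b hb hbD
    have h := hE i j hij b hb hbD
    rwa [matAct_blockDiag_single, qOp_pOp_mono (by simpa using hij.ne'),
      qOp_pOp_mono (by simpa using hij.ne'), map_add, map_smul, map_smul] at h
  -- induction on the sum of the entries on the right other than the first one, which are naturals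
  induction hN : ∑ j : Fin n, (if j.val = 0 then 0 else ⌊(b (Sum.inr j)).re⌋₊)
    using Nat.strong_induction_on generalizing b with
  | _ N ih =>
  have hA := admEntries hb
  have hz0 : b (Sum.inr z) ≠ 0 := by simpa using hA.right_zero_ne h₂ rfl 0
  by_cases hv : ∃ j : Fin n, j.val ≠ 0 ∧ b (Sum.inr j) ≠ 0
  · obtain ⟨j, hj, hvj⟩ := hv
    have hzj : z < j := Fin.lt_def.2 (by simp only [z]; omega)
    have hzj' : z ≠ j := hzj.ne
    obtain ⟨k, hk⟩ := hA.right j hj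
    have hk0 : k ≠ 0 := by rintro rfl; exact hvj (by simpa using hk)
    obtain ⟨k, rfl⟩ := Nat.exists_eq_succ_of_ne_zero hk0
    -- the other term in the image of `x(b₀)` under `E_{j0}` has a smaller `j`-th entry on the right
    set b₀ := b - Pi.single (Sum.inr j) 1 + Pi.single (Sum.inr z) 1 with hb₀
    have hb₀A : b₀ ∈ admSet (expTuple n a₁ a₂) :=
      admSet_shift hb (by simpa using hzj') hvj (hA.right_ne_neg_one h₂ z)
    have hb₀D : deg a₁ a₂ b₀ = D - ((j.val : ℂ) - z.val) := by
      rw [hb₀, deg_shift, hbD]; simp [degWeight, z]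
    have hrel := hE' z j hzj b₀ hb₀A hb₀D
    have e1 : b₀ - Pi.single (Sum.inr z) 1 + Pi.single (Sum.inr j) 1 = b := by
      rw [hb₀]; abel
    have e2 : b₀ (Sum.inr z) = b (Sum.inr z) + 1 := by simp [hb₀, hzj']
    have e3 : b₀ (Sum.inr j) = k := by
      simp [hb₀, hzj'.symm, hk]
    have hc2 : pCoeff (b₀ (Sum.inr z)) * qCoeff (b₀ (Sum.inr j)) ≠ 0 := by
      rw [e2, e3, pCoeff, qCoeff, if_neg (not_isNegInt_natCast k), mul_one]
      split_ifs
      · exact one_ne_zero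
      · have := hA.right_ne_neg_one h₂ z
        intro h0; exact this (by linear_combination h0)
    have hc1 : (pCoeff (b₀ (Sum.inl z)) * qCoeff (b₀ (Sum.inl j))) •
        φ (mono (b₀ - Pi.single (Sum.inl z) 1 + Pi.single (Sum.inl j) 1)) = 0 := by
      by_cases h0 : b₀ (Sum.inl j) = -1
      · rw [h0, qCoeff, if_pos isNegInt_neg_one, neg_add_cancel, mul_zero, zero_smul]
      · have hA₀ := admEntries hb₀A
        rw [ih _ ?_ (b₀ - Pi.single (Sum.inl z) 1 + Pi.single (Sum.inl j) 1)
          (admSet_shift hb₀A (by simpa using hzj'.symm) (hA₀.left_ne_zero h₁ z) h0) ?_ rfl,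
          smul_zero]
        · have e5 : ⌊((b₀ - Pi.single (Sum.inl z) 1 + Pi.single (Sum.inl j) 1 :
              Fin n ⊕ Fin n → ℂ) (Sum.inr j)).re⌋₊ = k := by simp [e3]
          have e6 : ⌊(b (Sum.inr j)).re⌋₊ = k + 1 := by
            rw [hk, Complex.natCast_re, Nat.floor_natCast]
          rw [← hN]
          refine Finset.sum_lt_sum (fun i _ => ?_) ⟨j, Finset.mem_univ _, ?_⟩
          · by_cases hi : i.val = 0
            · simp [hi]
            · have hiz : i ≠ z := fun h => hi (by rw [h])
              by_cases hij : i = j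
              · subst hij
                rw [if_neg hi, if_neg hi, e5, e6]
                exact k.le_succ
              · simp [hi, hb₀, hiz, hij]
          · rw [if_neg hj, if_neg hj, e5, e6]
            exact k.lt_succ_self
        · rw [deg_shift, hb₀D]; simp [degWeight, z]; ring
    rw [e1, hc1, zero_add] at hrel
    exact (smul_eq_zero_iff_right hc2).1 hrel
  · push Not at hv
    have hlz : z ≠ l := by simp only [z, l, ne_eq, Fin.mk.injEq]; omega
    have hl0 : l.val ≠ 0 := by simp only [l]; omega
    have hll := hA.left_last_ne h₁ hl
    by_cases hu : ∃ i : Fin n, i.val ≠ 0 ∧ i.val + 1 ≠ n ∧ b (Sum.inl i) ≠ -1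
    · obtain ⟨i, hi0, hil, hui⟩ := hu
      have hil' : i < l := Fin.lt_def.2 (by have := i.2; simp only [l]; omega)
      -- `x(b)` is the image of `x(b₀)` under `E_{n-1,i}`, as the `i`-th entry on the right is zero
      set b₀ := b - Pi.single (Sum.inl l) 1 + Pi.single (Sum.inl i) 1 with hb₀
      have hb₀A : b₀ ∈ admSet (expTuple n a₁ a₂) :=
        admSet_shift hb (by simpa using hil'.ne) (hA.left_ne_zero h₁ l) hui
      have hb₀D : deg a₁ a₂ b₀ = D - ((l.val : ℂ) - i.val) := by
        rw [hb₀, deg_shift, hbD]; simp [degWeight, hlC]; ring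
      have hrel := hE' i l hil' b₀ hb₀A hb₀D
      have e1 : b₀ - Pi.single (Sum.inl i) 1 + Pi.single (Sum.inl l) 1 = b := by
        rw [hb₀]; abel
      have e2 : b₀ (Sum.inl i) = b (Sum.inl i) + 1 := by simp [hb₀, hil'.ne]
      have e3 : b₀ (Sum.inl l) = b (Sum.inl l) - 1 := by simp [hb₀, hil'.ne']
      have e4 : b₀ (Sum.inr i) = 0 := by simp [hb₀, hv i hi0]
      have e5 : ¬ IsNegInt (b (Sum.inl l) - 1) := not_isNegInt_of_ne fun k h =>
        hll (k + 1) (by push_cast; linear_combination h)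
      rw [e1, e2, e3, e4, pCoeff, if_pos ((isNegInt_add_one hui).2 (hA.left_isNegInt hil)), qCoeff,
        if_neg e5, pCoeff, if_neg not_isNegInt_zero, zero_mul, zero_smul, add_zero, mul_one,
        one_smul] at hrel
      exact hrel
    · push Not at hu
      by_cases huz : b (Sum.inl z) = -1
      · -- the tuple has degree zero
        refine absurd ?_ hD
        rw [← hbD, deg, Fintype.sum_sum_type]
        have s1 : ∀ i : Fin n, degWeight n (Sum.inl i) *
            (b (Sum.inl i) - expTuple n a₁ a₂ (Sum.inl i)) = 0 := by
          intro i
          by_cases hil : i.val + 1 = n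
          · have : ((i.val : ℂ) + 1) = n := by exact_mod_cast hil
            rw [degWeight, Sum.elim_inl, ← this]; ring
          · rw [expTuple, Sum.elim_inl, if_neg hil]
            by_cases hi0 : i.val = 0
            · have : i = z := Fin.ext hi0
              rw [this, huz, sub_self, mul_zero]
            · rw [hu i hi0 hil, sub_self, mul_zero]
        have s2 : ∀ j : Fin n, degWeight n (Sum.inr j) *
            (b (Sum.inr j) - expTuple n a₁ a₂ (Sum.inr j)) = 0 := by
          intro j
          by_cases hj0 : j.val = 0
          · rw [degWeight, Sum.elim_inr, hj0, Nat.cast_zero, zero_mul]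
          · rw [expTuple, Sum.elim_inr, if_neg hj0, hv j hj0, sub_self, mul_zero]
        simp [s1, s2]
      · -- `X x(b₀)` is a sum of `x(b)` and of terms which occur in the relations for `E_{i0}`
        set b₀ := b - Pi.single (Sum.inr z) 1 + Pi.single (Sum.inl z) 1 with hb₀
        have hb₀A : b₀ ∈ admSet (expTuple n a₁ a₂) := admSet_shift hb (by simp) hz0 huz
        have hb₀D : deg a₁ a₂ b₀ = D - ((n : ℂ) - 1) := by
          rw [hb₀, deg_shift, hbD]; simp [degWeight, z]; ring
        have hzl : z.val + 1 ≠ n := by simp only [z]; omega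
        have huz1 : IsNegInt (b (Sum.inl z) + 1) :=
          (isNegInt_add_one huz).2 (hA.left_isNegInt hzl)
        have hrel := hX b₀ hb₀A hb₀D
        rw [matAct_scalarBlocks_single] at hrel
        simp only [qOp_pOp_mono Sum.inr_ne_inl, map_sum, map_smul] at hrel
        -- after multiplication by `v₀` all terms are multiples of `x(b)`
        have hterm : ∀ i : Fin n, b (Sum.inr z) • ((pCoeff (b₀ (Sum.inl i)) *
            qCoeff (b₀ (Sum.inr i))) •
              φ (mono (b₀ - Pi.single (Sum.inl i) 1 + Pi.single (Sum.inr i) 1))) =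
            (if i = z then b (Sum.inr z) else -b (Sum.inl i)) • φ (mono b) := by
          intro i
          by_cases hi : i = z
          · subst hi
            have e1 : b₀ - Pi.single (Sum.inl z) 1 + Pi.single (Sum.inr z) 1 = b := by
              rw [hb₀]; abel
            have e2 : b₀ (Sum.inl z) = b (Sum.inl z) + 1 := by simp [hb₀]
            have e3 : b₀ (Sum.inr z) = b (Sum.inr z) - 1 := by simp [hb₀]
            have e5 : ¬ IsNegInt (b (Sum.inr z) - 1) := not_isNegInt_of_ne fun k h =>
              hA.right_zero_ne h₂ rfl (k + 1) (by push_cast; linear_combination h)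
            rw [if_pos rfl, e1, e2, e3, pCoeff, if_pos huz1, qCoeff, if_neg e5, one_mul, one_smul]
          · have hzi : z < i := Fin.lt_def.2 (by
              have : i.val ≠ 0 := fun h => hi (Fin.ext h)
              simp only [z]; omega)
            have hi0 : i.val ≠ 0 := fun h => hi (Fin.ext h)
            set b₁ := b - Pi.single (Sum.inl i) 1 + Pi.single (Sum.inl z) 1 with hb₁
            have hb₁A : b₁ ∈ admSet (expTuple n a₁ a₂) :=
              admSet_shift hb (by simpa using hzi.ne) (hA.left_ne_zero h₁ i) huz
            have hb₁D : deg a₁ a₂ b₁ = D - ((i.val : ℂ) - z.val) := by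
              rw [hb₁, deg_shift, hbD]; simp [degWeight, z]; ring
            have hrel := hE' z i hzi b₁ hb₁A hb₁D
            have e1 : b₁ - Pi.single (Sum.inl z) 1 + Pi.single (Sum.inl i) 1 = b := by
              rw [hb₁]; abel
            have e2 : b₁ - Pi.single (Sum.inr z) 1 + Pi.single (Sum.inr i) 1 =
                b₀ - Pi.single (Sum.inl i) 1 + Pi.single (Sum.inr i) 1 := by
              rw [hb₁, hb₀]; abel
            have e3 : b₁ (Sum.inl z) = b (Sum.inl z) + 1 := by simp [hb₁, hzi.ne]
            have e4 : b₁ (Sum.inl i) = b (Sum.inl i) - 1 := by simp [hb₁, hi]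
            have e5 : b₁ (Sum.inr z) = b (Sum.inr z) := by simp [hb₁]
            have e6 : b₁ (Sum.inr i) = 0 := by simp [hb₁, hv i hi0]
            have e7 : b₀ (Sum.inl i) = b (Sum.inl i) := by simp [hb₀, hi]
            have e8 : b₀ (Sum.inr i) = 0 := by simp [hb₀, hi, hv i hi0]
            have e9 : pCoeff (b (Sum.inr z)) = b (Sum.inr z) :=
              if_neg (not_isNegInt_of_ne (hA.right_zero_ne h₂ rfl))
            have e10 : qCoeff 0 = 1 := if_neg not_isNegInt_zero
            have e11 : pCoeff (b (Sum.inl z) + 1) = 1 := if_pos huz1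
            rw [e1, e2, e3, e4, e5, e6, e9, e10, e11, one_mul, mul_one] at hrel
            rw [e7, e8, e10, mul_one, smul_comm, eq_neg_of_add_eq_zero_right hrel, if_neg hi,
              smul_neg, smul_smul, pCoeff_mul_qCoeff, neg_smul]
        have hsum := congrArg (fun w => b (Sum.inr z) • w) hrel
        simp only [Finset.smul_sum, hterm, smul_zero, ← Finset.sum_smul] at hsum
        refine (smul_eq_zero_iff_right ?_).1 hsum
        -- up to an integer the coefficient is `a₂ - a₁`
        obtain ⟨s, hs⟩ := hA.left_last l hl
        obtain ⟨t, ht⟩ := hA.right_zero z rfl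
        have hint : ∀ i : Fin n, ∃ k : ℤ, (if i = z then b (Sum.inr z) else -b (Sum.inl i)) =
            (if i = z then a₂ else 0) - (if i = l then a₁ else 0) + k := by
          intro i
          by_cases hi : i = z
          · subst hi
            exact ⟨t, by rw [if_pos rfl, if_pos rfl, if_neg hlz, ht]; ring⟩
          · rw [if_neg hi, if_neg hi]
            by_cases hil : i = l
            · subst hil
              exact ⟨-s, by rw [if_pos rfl, hs]; push_cast; ring⟩
            · obtain ⟨k, hk⟩ := hA.left i fun h => hil (Fin.ext (by simp only [l]; omega))
              exact ⟨1 + k, by rw [if_neg hil, hk]; push_cast; ring⟩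
        choose k hk using hint
        simp only [hk, Finset.sum_add_distrib, Finset.sum_sub_distrib, Finset.sum_ite_eq',
          Finset.mem_univ, if_true, ← Int.cast_sum]
        intro h0
        exact h₁₂ (∑ i, k i) (by linear_combination -h0)

end Lowering

/-! ### Restriction of a module over a product of Lie algebras to the factors -/

section Restriction

variable (L₁ L₂ M : Type) [LieRing L₁] [LieAlgebra ℂ L₁] [LieRing L₂] [LieAlgebra ℂ L₂]
  [AddCommGroup M] [Module ℂ M] [LieRingModule (L₁ × L₂) M] [LieModule ℂ (L₁ × L₂) M]

/-- An `L₁ ⊕ L₂`-module, regarded as an `L₁`-module. -/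
def ResFst (_L₁ _L₂ M : Type) : Type := M

/-- An `L₁ ⊕ L₂`-module, regarded as an `L₂`-module. -/
def ResSnd (_L₁ _L₂ M : Type) : Type := M

instance : AddCommGroup (ResFst L₁ L₂ M) := inferInstanceAs (AddCommGroup M)
instance : Module ℂ (ResFst L₁ L₂ M) := inferInstanceAs (Module ℂ M)
instance : LieRingModule L₁ (ResFst L₁ L₂ M) :=
  LieRingModule.compLieHom M (LieHom.inl ℂ L₁ L₂)
instance : LieModule ℂ L₁ (ResFst L₁ L₂ M) :=
  LieModule.compLieHom M (LieHom.inl ℂ L₁ L₂)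
instance : AddCommGroup (ResSnd L₁ L₂ M) := inferInstanceAs (AddCommGroup M)
instance : Module ℂ (ResSnd L₁ L₂ M) := inferInstanceAs (Module ℂ M)
instance : LieRingModule L₂ (ResSnd L₁ L₂ M) :=
  LieRingModule.compLieHom M (LieHom.inr ℂ L₁ L₂)
instance : LieModule ℂ L₂ (ResSnd L₁ L₂ M) :=
  LieModule.compLieHom M (LieHom.inr ℂ L₁ L₂)

variable {L₁ L₂ M}

/-- A vector of an `L₁ ⊕ L₂`-module in the restriction to `L₁`. -/
def toResFst : M →ₗ[ℂ] ResFst L₁ L₂ M := LinearMap.id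

/-- A vector of an `L₁ ⊕ L₂`-module in the restriction to `L₂`. -/
def toResSnd : M →ₗ[ℂ] ResSnd L₁ L₂ M := LinearMap.id

omit [LieAlgebra ℂ L₁] [LieAlgebra ℂ L₂] [Module ℂ M] [LieModule ℂ (L₁ × L₂) M] in
theorem lie_eq_add (z : L₁ × L₂) (m : M) :
    ⁅z, m⁆ = ⁅(z.1, (0 : L₂)), m⁆ + ⁅((0 : L₁), z.2), m⁆ := by
  rw [← add_lie]; simp

omit [LieModule ℂ (L₁ × L₂) M] in
theorem isHighestWeight_pairElt {c : ℕ} (hc : c ≠ 0) {h₁ : L₁} {h₂ : L₂}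
    (H₂ : IsGradingElement h₂) {v : M}
    (hv₁ : IsHighestWeight h₁ (toResFst v : ResFst L₁ L₂ M))
    (hv₂ : IsHighestWeight h₂ (toResSnd v : ResSnd L₁ L₂ M)) :
    IsHighestWeight (pairElt c h₁ h₂) v := by
  refine ⟨hv₁.ne_zero, fun r hr z hz => ?_, fun z hz => ?_⟩
  · obtain ⟨h1, h2⟩ := of_mem_gr_pairElt hc H₂ hz
    have e1 : ⁅(z.1, (0 : L₂)), v⁆ = 0 := hv₁.isSingular r hr _ h1
    have e2 : ⁅((0 : L₁), z.2), v⁆ = 0 := by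
      rcases h2 with h2 | ⟨s, rfl, h2⟩
      · rw [h2, Prod.mk_zero_zero, zero_lie]
      · exact hv₂.isSingular s (pos_of_mul_pos_right hr (by positivity)) _ h2
    rw [lie_eq_add, e1, e2, add_zero]
  · obtain ⟨h1, h2⟩ := of_mem_gr_pairElt hc H₂ hz
    obtain ⟨a, ha⟩ := hv₁.exists_smul _ h1
    have : z.2 ∈ gr h₂ 0 := by
      rcases h2 with h2 | ⟨s, h3, h2⟩
      · rw [h2]; exact Submodule.zero_mem _
      · have : s = 0 := by simpa [hc] using h3
        rwa [← this]
    obtain ⟨b, hb⟩ := hv₂.exists_smul _ this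
    have e1 : ⁅(z.1, (0 : L₂)), v⁆ = a • v := ha
    have e2 : ⁅((0 : L₁), z.2), v⁆ = b • v := hb
    exact ⟨a + b, by rw [lie_eq_add, e1, e2, add_smul]⟩

end Restriction

/-! ### The basis of `N`, its grading and its singular vectors -/

section ModuleN

open LieAlgebra.SpecialLinear (single singleSubSingle val_single val_singleSubSingle)

theorem matAct_sub {ι : Type} [Fintype ι] [DecidableEq ι] (A B : Matrix ι ι ℂ) :
    matAct (A - B) = matAct A - matAct B := by
  simp [matAct, sub_smul, Finset.sum_sub_distrib]

theorem matAct_diagonal_mono {ι : Type} [Fintype ι] [DecidableEq ι] (d b : ι → ℂ) :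
    matAct (Matrix.diagonal d) (mono b) = (∑ k, d k * b k) • mono b := by
  have h : matAct (Matrix.diagonal d) = ∑ k, d k • (qOp k * pOp k) := by
    simp [matAct, Matrix.diagonal_apply, ite_smul]
  rw [h, LinearMap.sum_apply, Finset.sum_smul]
  refine Finset.sum_congr rfl fun k _ => ?_
  rw [LinearMap.smul_apply, Module.End.mul_apply, qOp_pOp_mono_self, smul_smul]

variable {n : ℕ} {a₁ a₂ : ℂ}

/-- The inclusion of `N` in the space with basis all `x(b)`. -/
def inclN : NRes n a₁ a₂ →ₗ[ℂ] Mono (Fin n ⊕ Fin n) :=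
  (modN (expTuple n a₁ a₂)).toSubmodule.subtype

theorem inclN_injective : Function.Injective (inclN (n := n) (a₁ := a₁) (a₂ := a₂)) :=
  Subtype.val_injective

theorem inclN_lie (z : sl (Fin n) ℂ × sl (Fin 2) ℂ) (f : NRes n a₁ a₂) :
    inclN ⁅z, f⁆ = matAct (embPair n z).val (inclN f) := rfl

/-- The basis vector `x(b)` of `N`. -/
def monoN (b : Fin n ⊕ Fin n → ℂ) (hb : b ∈ admSet (expTuple n a₁ a₂)) : NRes n a₁ a₂ :=
  ⟨mono b, Submodule.subset_span ⟨b, hb, rfl⟩⟩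

theorem inclN_monoN (b : Fin n ⊕ Fin n → ℂ) (hb : b ∈ admSet (expTuple n a₁ a₂)) :
    inclN (monoN b hb) = mono b := rfl

theorem NRes_induction {p : NRes n a₁ a₂ → Prop} (zero : p 0)
    (add : ∀ f g, p f → p g → p (f + g)) (smul : ∀ (c : ℂ) f, p f → p (c • f))
    (mono : ∀ b hb, p (monoN b hb)) (f : NRes n a₁ a₂) : p f := by
  have key : ∀ m (hm : m ∈ Submodule.span ℂ (DualPairSL.mono '' admSet (expTuple n a₁ a₂))),
      p (⟨m, hm⟩ : modN (expTuple n a₁ a₂)) := by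
    intro m hm
    induction hm using Submodule.span_induction with
    | zero => exact zero
    | add x y hx hy hpx hpy => exact add _ _ hpx hpy
    | smul c x hx hpx => exact smul c _ hpx
    | mem x hx =>
      obtain ⟨b, hb, rfl⟩ := hx
      exact mono b hb
  exact key f.1 f.2

theorem mem_admSet_of_coeff_ne_zero (f : NRes n a₁ a₂) {b : Fin n ⊕ Fin n → ℂ}
    (hb : coeff b (inclN f) ≠ 0) : b ∈ admSet (expTuple n a₁ a₂) := by
  by_contra h
  refine hb ?_
  clear hb
  induction f using NRes_induction with
  | zero => rw [map_zero, map_zero]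
  | add f g hf hg => rw [map_add, map_add, hf, hg, add_zero]
  | smul c f hf => rw [map_smul, map_smul, hf, smul_zero]
  | mono b' hb' => rw [inclN_monoN, coeff_mono, if_neg]; rintro rfl; exact h hb'

theorem embPair_inl (x : sl (Fin n) ℂ) :
    (embPair n (x, 0)).val = Matrix.fromBlocks x.val 0 0 x.val := by
  change (embB n x + embA n 0).val = _
  rw [map_zero, add_zero]; rfl

theorem embPair_inr (y : sl (Fin 2) ℂ) : (embPair n (0, y)).val = scalarBlocks n y.val := by
  change (embB n 0 + embA n y).val = _
  rw [map_zero, zero_add]; rfl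

/-- The element of the Cartan subalgebra of `sl_n ⊕ sl_2` defining the grading of `N`. The factor
`n - 1` makes the degrees of all `x(-1, …, -1, a₁ + s, a₂ - s, 0, …, 0)` equal, and minimal in `N`. -/
def gradElt (n : ℕ) : sl (Fin n) ℂ × sl (Fin 2) ℂ := pairElt (n - 1) (rhoElt n) (rhoElt 2)

theorem isGradingElement_gradElt (hn : 1 < n) : IsGradingElement (gradElt n) :=
  isGradingElement_pairElt (isGradingElement_rhoElt (by omega))
    (isGradingElement_rhoElt (by omega))

theorem embPair_gradElt (hn : 1 < n) :
    (embPair n (gradElt n)).val = Matrix.diagonal (-degWeight n) := by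
  have hc : ((n - 1 : ℕ) : ℂ) = n - 1 := by rw [Nat.cast_sub (by omega), Nat.cast_one]
  have h : (embPair n (gradElt n)).val = Matrix.fromBlocks (rhoElt n).val 0 0 (rhoElt n).val +
      scalarBlocks n (((n - 1 : ℕ) : ℂ) • (rhoElt 2).val) := rfl
  rw [h, hc, rhoElt, rhoElt]
  ext (i | i) (j | j) <;> by_cases hij : i = j <;>
    simp [scalarBlocks, degWeight, hij] <;> ring

/-- The eigenvalue of `gradElt n` on the vectors of degree zero. -/
def topEig (n : ℕ) (a₁ a₂ : ℂ) : ℂ := -∑ k, degWeight n k * expTuple n a₁ a₂ k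

theorem gradElt_lie_monoN (hn : 1 < n) (b : Fin n ⊕ Fin n → ℂ)
    (hb : b ∈ admSet (expTuple n a₁ a₂)) :
    ⁅gradElt n, monoN b hb⁆ = (topEig n a₁ a₂ - deg a₁ a₂ b) • monoN b hb := by
  apply inclN_injective
  rw [inclN_lie, embPair_gradElt hn, map_smul, inclN_monoN, matAct_diagonal_mono]
  congr 1
  simp only [topEig, deg, Pi.neg_apply, neg_mul, mul_sub, Finset.sum_sub_distrib,
    Finset.sum_neg_distrib]
  ring

theorem coeff_gradElt_lie (hn : 1 < n) (b : Fin n ⊕ Fin n → ℂ) (f : NRes n a₁ a₂) :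
    coeff b (inclN ⁅gradElt n, f⁆) = (topEig n a₁ a₂ - deg a₁ a₂ b) * coeff b (inclN f) := by
  induction f using NRes_induction with
  | zero => simp
  | add f g hf hg => rw [lie_add, map_add, map_add, hf, hg, map_add, map_add, mul_add]
  | smul c f hf => rw [lie_smul, map_smul, map_smul, hf, map_smul, map_smul, smul_eq_mul,
      smul_eq_mul, mul_left_comm]
  | mono b' hb' =>
    rw [gradElt_lie_monoN hn, map_smul, map_smul, inclN_monoN, coeff_mono, smul_eq_mul]
    split_ifs with h
    · rw [h]
    · rw [mul_zero, mul_zero]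

/-- The degree of an admissible tuple is a natural number, and it is zero only if all the
contributions are zero. -/
theorem exists_nat_deg_terms {b : Fin n ⊕ Fin n → ℂ} (hb : b ∈ admSet (expTuple n a₁ a₂)) :
    ∃ m : Fin n ⊕ Fin n → ℕ, ∀ k,
      degWeight n k * (b k - expTuple n a₁ a₂ k) = m k := by
  have hA := admEntries hb
  refine Classical.axiomOfChoice (r := fun k (m : ℕ) =>
    degWeight n k * (b k - expTuple n a₁ a₂ k) = m) ?_
  rintro (i | j)
  · by_cases hi : i.val + 1 = n
    · refine ⟨0, ?_⟩
      have : ((i.val : ℂ) + 1) = n := by exact_mod_cast hi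
      rw [degWeight, Sum.elim_inl, ← this]; push_cast; ring
    · obtain ⟨k, hk⟩ := hA.left i hi
      refine ⟨(n - 1 - i.val) * k, ?_⟩
      rw [degWeight, Sum.elim_inl, expTuple, Sum.elim_inl, if_neg hi, hk, Nat.cast_mul,
        Nat.sub_sub, Nat.cast_sub (by have := i.2; omega)]
      push_cast; ring
  · by_cases hj : j.val = 0
    · refine ⟨0, ?_⟩
      rw [degWeight, Sum.elim_inr, hj]; simp
    · obtain ⟨k, hk⟩ := hA.right j hj
      refine ⟨j.val * k, ?_⟩
      rw [degWeight, Sum.elim_inr, expTuple, Sum.elim_inr, if_neg hj, hk]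
      push_cast; ring

theorem exists_nat_deg {b : Fin n ⊕ Fin n → ℂ} (hb : b ∈ admSet (expTuple n a₁ a₂)) :
    ∃ m : ℕ, deg a₁ a₂ b = m := by
  obtain ⟨m, hm⟩ := exists_nat_deg_terms hb
  exact ⟨∑ k, m k, by rw [deg, Finset.sum_congr rfl fun k _ => hm k, Nat.cast_sum]⟩

/-- The exponents `(-1, …, -1, a₁ + s, a₂ - s, 0, …, 0)` of the highest weight vectors. -/
def topTuple (n : ℕ) (a₁ a₂ : ℂ) (s : ℤ) : Fin n ⊕ Fin n → ℂ := expTuple n (a₁ + s) (a₂ - s)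

theorem topTuple_eq (hn : 1 < n) (s : ℤ) : topTuple n a₁ a₂ s = expTuple n a₁ a₂ +
    Pi.single (Sum.inl ⟨n - 1, by omega⟩) (s : ℂ) - Pi.single (Sum.inr ⟨0, by omega⟩) (s : ℂ) := by
  funext k
  rcases k with i | j
  · by_cases hi : i.val + 1 = n
    · have : i = ⟨n - 1, by omega⟩ := Fin.ext (by simp only; omega)
      simp [topTuple, expTuple, ← this, hi]
    · have : i ≠ ⟨n - 1, by omega⟩ := fun h => hi (by rw [h]; simp only; omega)
      simp [topTuple, expTuple, hi, this]
  · by_cases hj : j.val = 0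
    · have : j = ⟨0, by omega⟩ := Fin.ext hj
      rw [this]
      simp [topTuple, expTuple]
    · have : j ≠ ⟨0, by omega⟩ := fun h => hj (by rw [h])
      simp [topTuple, expTuple, hj, this]

theorem topTuple_injective (hn : 1 < n) : Function.Injective (topTuple n a₁ a₂) := by
  intro s t h
  have h1 := congrFun h (Sum.inl ⟨n - 1, by omega⟩)
  have h2 : n - 1 + 1 = n := by omega
  simp only [topTuple, expTuple, Sum.elim_inl, h2, if_true] at h1
  exact_mod_cast add_left_cancel h1

theorem topTuple_mem (hn : 1 < n) (h₁ : ∀ k : ℤ, a₁ ≠ k) (h₂ : ∀ k : ℤ, a₂ ≠ k) (s : ℤ) :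
    topTuple n a₁ a₂ s ∈ admSet (expTuple n a₁ a₂) := by
  refine ⟨fun k => ?_, ?_⟩
  · rcases k with i | j
    · simp only [topTuple, expTuple, Sum.elim_inl]
      split_ifs
      · refine ⟨⟨s, by ring⟩, iff_of_false ?_ (not_isNegInt_of_ne h₁)⟩
        exact not_isNegInt_of_ne fun k hk => h₁ (k - s) (by push_cast; linear_combination hk)
      · exact ⟨⟨0, by simp⟩, Iff.rfl⟩
    · simp only [topTuple, expTuple, Sum.elim_inr]
      split_ifs
      · refine ⟨⟨-s, by push_cast; ring⟩, iff_of_false ?_ (not_isNegInt_of_ne h₂)⟩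
        exact not_isNegInt_of_ne fun k hk => h₂ (k + s) (by push_cast; linear_combination hk)
      · exact ⟨⟨0, by simp⟩, Iff.rfl⟩
  · rw [topTuple_eq hn]
    simp [Finset.sum_add_distrib, Finset.sum_sub_distrib]

theorem deg_topTuple (s : ℤ) : deg a₁ a₂ (topTuple n a₁ a₂ s) = 0 := by
  rw [deg]
  refine Finset.sum_eq_zero fun k _ => ?_
  rcases k with i | j
  · simp only [topTuple, expTuple, Sum.elim_inl, degWeight]
    split_ifs with hi
    · have : ((i.val : ℂ) + 1) = n := by exact_mod_cast hi
      rw [← this]; ring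
    · ring
  · simp only [topTuple, expTuple, Sum.elim_inr, degWeight]
    split_ifs with hj
    · rw [hj]; simp
    · ring

theorem exists_eq_topTuple (hn : 1 < n) {b : Fin n ⊕ Fin n → ℂ}
    (hb : b ∈ admSet (expTuple n a₁ a₂)) (hd : deg a₁ a₂ b = 0) :
    ∃ s : ℤ, b = topTuple n a₁ a₂ s := by
  obtain ⟨m, hm⟩ := exists_nat_deg_terms hb
  have hm0 : ∀ k, m k = 0 := by
    rw [deg, Finset.sum_congr rfl fun k _ => hm k, ← Nat.cast_sum, Nat.cast_eq_zero,
      Finset.sum_eq_zero_iff] at hd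
    exact fun k => hd k (Finset.mem_univ k)
  have hA := admEntries hb
  obtain ⟨s, hs⟩ := hA.left_last ⟨n - 1, by omega⟩ (by simp only; omega)
  refine ⟨s, ?_⟩
  -- all entries but two are determined by the degree, the last one by the sum
  have hoff : ∀ k, k ≠ Sum.inl ⟨n - 1, by omega⟩ → k ≠ Sum.inr ⟨0, by omega⟩ →
      b k = expTuple n a₁ a₂ k := by
    intro k hk1 hk2
    have h1 := hm k
    rw [hm0 k, Nat.cast_zero, mul_eq_zero, sub_eq_zero] at h1
    refine h1.resolve_left ?_
    rcases k with i | j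
    · intro h
      rw [degWeight, Sum.elim_inl, sub_eq_zero, eq_sub_iff_add_eq] at h
      have h3 : i.val + 1 = n := by exact_mod_cast h
      exact hk1 (congrArg Sum.inl (Fin.ext (by simp only; omega)))
    · intro h
      rw [degWeight, Sum.elim_inr, Nat.cast_eq_zero] at h
      exact hk2 (congrArg Sum.inr (Fin.ext h))
  have hlast : expTuple n a₁ a₂ (Sum.inl ⟨n - 1, by omega⟩) = a₁ := by
    have h2 : n - 1 + 1 = n := by omega
    simp [expTuple, h2]
  have hdiff : ∀ k, k ≠ Sum.inr ⟨0, by omega⟩ → b k - topTuple n a₁ a₂ s k = 0 := by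
    intro k hk2
    rw [topTuple_eq hn]
    by_cases hk1 : k = Sum.inl ⟨n - 1, by omega⟩
    · rw [hk1, hs, Pi.sub_apply, Pi.add_apply, hlast]; simp
    · rw [hoff k hk1 hk2]; simp [Pi.single_eq_of_ne hk1, Pi.single_eq_of_ne hk2]
  have hsum : ∑ k, (b k - topTuple n a₁ a₂ s k) = 0 := by
    rw [Finset.sum_sub_distrib, hb.2, topTuple_eq hn]
    simp [Finset.sum_add_distrib, Finset.sum_sub_distrib]
  rw [Finset.sum_eq_single (Sum.inr ⟨0, by omega⟩) (fun k _ hk => hdiff k hk) (by simp)] at hsum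
  funext k
  by_cases hk : k = Sum.inr ⟨0, by omega⟩
  · rw [hk]; exact sub_eq_zero.1 hsum
  · exact sub_eq_zero.1 (hdiff k hk)

/-- `N` is the sum of the layers with natural degrees. -/
theorem iSup_layer_NRes (hn : 1 < n) :
    ⨆ m : ℕ, layer (NRes n a₁ a₂) (gradElt n) (topEig n a₁ a₂) m = ⊤ := by
  rw [eq_top_iff]
  rintro f -
  induction f using NRes_induction with
  | zero => exact Submodule.zero_mem _
  | add f g hf hg => exact Submodule.add_mem _ hf hg
  | smul c f hf => exact Submodule.smul_mem _ c hf
  | mono b hb =>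
    obtain ⟨m, hm⟩ := exists_nat_deg hb
    refine Submodule.mem_iSup_of_mem m (mem_layer.2 ?_)
    rw [gradElt_lie_monoN hn, hm, Int.cast_natCast]

theorem coeff_eq_zero_of_mem_tail (hn : 1 < n) {f : NRes n a₁ a₂}
    (hf : f ∈ tail (NRes n a₁ a₂) (gradElt n) (topEig n a₁ a₂)) {b : Fin n ⊕ Fin n → ℂ}
    (hb : deg a₁ a₂ b = 0) : coeff b (inclN f) = 0 := by
  refine Submodule.iSup_induction _ (motive := fun f => coeff b (inclN f) = 0) hf ?_ ?_ ?_
  · intro m f hf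
    rw [mem_layer] at hf
    have h1 := coeff_gradElt_lie hn b f
    rw [hf, map_smul, map_smul, hb, sub_zero, smul_eq_mul, sub_mul, sub_eq_self, mul_eq_zero] at h1
    have hm : ((m : ℤ) : ℂ) ≠ 0 := by exact_mod_cast m.2.ne'
    exact h1.resolve_left hm
  · rw [map_zero, map_zero]
  · intro f g hf hg
    rw [map_add, map_add, hf, hg, add_zero]

theorem single_inl_mem_gr_gradElt {i j : Fin n} (h : i ≠ j) :
    (single i j h (1 : ℂ), (0 : sl (Fin 2) ℂ)) ∈ gr (gradElt n) ((j.val : ℤ) - i.val) :=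
  inl_mem_gr (single_mem_gr h 1)

theorem single_inr_mem_gr_gradElt {i j : Fin 2} (h : i ≠ j) :
    ((0 : sl (Fin n) ℂ), single i j h (1 : ℂ)) ∈
      gr (gradElt n) ((n - 1 : ℕ) * ((j.val : ℤ) - i.val)) :=
  inr_mem_gr (single_mem_gr h 1)

/-- A singular vector of `N` is a combination of the basis vectors of degree zero: its product
with any vector in the image of a lowering operator vanishes, by contravariance. -/
theorem coeff_eq_zero_of_isSingular (hn : 1 < n) (h₁ : ∀ k : ℤ, a₁ ≠ k) (h₂ : ∀ k : ℤ, a₂ ≠ k)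
    (h₁₂ : ∀ k : ℤ, a₁ - a₂ ≠ k) {f : NRes n a₁ a₂} (hf : IsSingular (gradElt n) f)
    {b : Fin n ⊕ Fin n → ℂ} (hb : b ∈ admSet (expTuple n a₁ a₂)) (hd : deg a₁ a₂ b ≠ 0) :
    coeff b (inclN f) = 0 := by
  have h := apply_mono_eq_zero hn h₁ h₂ h₁₂ (form (inclN f)) hd ?_ ?_ b hb rfl
  · rw [form_mono_right] at h
    exact (mul_eq_zero.1 h).resolve_left
      (Finset.prod_ne_zero_iff.2 fun k _ => gammaFactor_ne_zero _)
  · intro i j hij b _ _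
    have h1 := congrArg inclN
      (hf _ (by have := Fin.lt_def.1 hij; omega) _ (single_inl_mem_gr_gradElt hij.ne))
    rw [inclN_lie, embPair_inl, val_single, map_zero] at h1
    rw [← Matrix.transpose_transpose (Matrix.fromBlocks _ _ _ _), ← form_matAct,
      Matrix.fromBlocks_transpose, Matrix.transpose_single, Matrix.transpose_zero, h1, map_zero,
      LinearMap.zero_apply]
  · intro b _ _
    have h1 := congrArg inclN (hf _ (by simp; omega) _ (single_inr_mem_gr_gradElt zero_ne_one))
    rw [inclN_lie, embPair_inr, val_single, map_zero] at h1
    have h2 : (scalarBlocks n (Matrix.single 1 0 1)) =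
        (scalarBlocks n (Matrix.single 0 1 1)).transpose := by
      simp [scalarBlocks, Matrix.fromBlocks_transpose]
    rw [h2, ← form_matAct, h1, map_zero, LinearMap.zero_apply]

end ModuleN

/-! ### The highest weight vectors of `N` -/

section TopVec

open LieAlgebra.SpecialLinear (single singleSubSingle val_single val_singleSubSingle)

variable {n : ℕ} {a₁ a₂ : ℂ}

theorem qCoeff_neg_one : qCoeff (-1) = 0 := by
  rw [qCoeff, if_pos isNegInt_neg_one, neg_add_cancel]

theorem pCoeff_zero : pCoeff 0 = 0 := if_neg not_isNegInt_zero

theorem topTuple_inl {i : Fin n} (hi : i.val + 1 ≠ n) (s : ℤ) :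
    topTuple n a₁ a₂ s (Sum.inl i) = -1 := by
  rw [topTuple, expTuple, Sum.elim_inl, if_neg hi]

theorem topTuple_inl_last {i : Fin n} (hi : i.val + 1 = n) (s : ℤ) :
    topTuple n a₁ a₂ s (Sum.inl i) = a₁ + s := by
  rw [topTuple, expTuple, Sum.elim_inl, if_pos hi]

theorem topTuple_inr {j : Fin n} (hj : j.val ≠ 0) (s : ℤ) :
    topTuple n a₁ a₂ s (Sum.inr j) = 0 := by
  rw [topTuple, expTuple, Sum.elim_inr, if_neg hj]

theorem topTuple_inr_zero {j : Fin n} (hj : j.val = 0) (s : ℤ) :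
    topTuple n a₁ a₂ s (Sum.inr j) = a₂ - s := by
  rw [topTuple, expTuple, Sum.elim_inr, if_pos hj]

/-- The standing hypotheses: `n > 1`, and none of `a₁`, `a₂`, `a₁ - a₂` is an integer. -/
structure Generic (n : ℕ) (a₁ a₂ : ℂ) : Prop where
  one_lt : 1 < n
  left : ∀ k : ℤ, a₁ ≠ k
  right : ∀ k : ℤ, a₂ ≠ k
  diff : ∀ k : ℤ, a₁ - a₂ ≠ k

/-- The highest weight vector of `N` with exponents `(-1, …, -1, a₁ + s, a₂ - s, 0, …, 0)`. -/
def topVec (hg : Generic n a₁ a₂) (s : ℤ) : NRes n a₁ a₂ :=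
  monoN (topTuple n a₁ a₂ s) (topTuple_mem hg.one_lt hg.left hg.right s)

theorem weightA_injective : Function.Injective (weightA n a₁ a₂) := by
  intro s t h
  have h1 := congrFun h 0
  simp only [weightA] at h1
  have h2 : (s : ℂ) = t := by linear_combination h1 / 2
  exact_mod_cast h2

variable (hg : Generic n a₁ a₂)
include hg

theorem inclN_topVec (s : ℤ) : inclN (topVec hg s) = mono (topTuple n a₁ a₂ s) := rfl

theorem coeff_topVec (s t : ℤ) :
    coeff (topTuple n a₁ a₂ t) (inclN (topVec hg s)) = if s = t then 1 else 0 := by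
  rw [inclN_topVec, coeff_mono]
  simp only [(topTuple_injective hg.one_lt).eq_iff]

theorem topVec_ne_zero (s : ℤ) : topVec hg s ≠ 0 := by
  intro h
  have := coeff_topVec hg s s
  rw [h, map_zero, map_zero, if_pos rfl] at this
  exact zero_ne_one this

theorem single_inl_lie_topVec (s : ℤ) (i j : Fin n) (h : i < j) :
    ⁅(single i j h.ne (1 : ℂ), (0 : sl (Fin 2) ℂ)), topVec hg s⁆ = 0 := by
  apply inclN_injective
  have hi : i.val + 1 ≠ n := by have := Fin.lt_def.1 h; omega
  have hj : j.val ≠ 0 := by have := Fin.lt_def.1 h; omega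
  rw [inclN_lie, embPair_inl, val_single, matAct_blockDiag_single, inclN_topVec,
    qOp_pOp_mono (by simpa using h.ne), qOp_pOp_mono (by simpa using h.ne), topTuple_inl hi,
    topTuple_inr hj, qCoeff_neg_one, pCoeff_zero]
  simp

theorem single_inr_lie_topVec (s : ℤ) (i j : Fin 2) (h : i < j) :
    ⁅((0 : sl (Fin n) ℂ), single i j h.ne (1 : ℂ)), topVec hg s⁆ = 0 := by
  obtain rfl : i = 0 := by omega
  obtain rfl : j = 1 := by omega
  apply inclN_injective
  have hact : ∀ f : Mono (Fin n ⊕ Fin n), matAct (scalarBlocks n (Matrix.single 0 1 1)) f =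
      ∑ i, qOp (Sum.inl i) (pOp (Sum.inr i) f) := by
    intro f
    simp [matAct, scalarBlocks, Fintype.sum_sum_type, Matrix.one_apply, ite_smul,
      LinearMap.sum_apply]
  rw [inclN_lie, embPair_inr, val_single, hact, inclN_topVec, map_zero]
  refine Finset.sum_eq_zero fun k _ => ?_
  rw [qOp_pOp_mono Sum.inl_ne_inr]
  by_cases hk : k.val + 1 = n
  · rw [topTuple_inr (by have := hg.one_lt; omega), pCoeff_zero, zero_mul, zero_smul]
  · rw [topTuple_inl hk, qCoeff_neg_one, mul_zero, zero_smul]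

theorem coroot_inl_lie_topVec (s : ℤ) (i : Fin (n - 1)) :
    ⁅(coroot i, (0 : sl (Fin 2) ℂ)), topVec hg s⁆ = weightB n a₁ a₂ s i • topVec hg s := by
  apply inclN_injective
  set k : Fin n := ⟨i.val, by omega⟩ with hk
  set l : Fin n := ⟨i.val + 1, by omega⟩ with hl
  have h1 : Matrix.fromBlocks (coroot i).val 0 0 (coroot i).val =
      Matrix.fromBlocks (Matrix.single k k (1 : ℂ)) 0 0 (Matrix.single k k 1) -
      Matrix.fromBlocks (Matrix.single l l (1 : ℂ)) 0 0 (Matrix.single l l 1) := by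
    rw [coroot, val_singleSubSingle]
    ext (a | a) (b | b) <;> simp [hk, hl]
  rw [inclN_lie, embPair_inl, h1, matAct_sub, LinearMap.sub_apply, matAct_blockDiag_single,
    matAct_blockDiag_single, map_smul, inclN_topVec, qOp_pOp_mono_self, qOp_pOp_mono_self,
    qOp_pOp_mono_self, qOp_pOp_mono_self, ← add_smul, ← add_smul, ← sub_smul]
  congr 1
  have hkl : k.val + 1 ≠ n := by simp only [hk]; omega
  have hl0 : l.val ≠ 0 := by simp [hl]
  rw [topTuple_inl hkl, topTuple_inr hl0, weightB]
  by_cases h2 : n = 2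
  · have : i.val = 0 := by omega
    rw [topTuple_inr_zero (by simpa [hk] using this), topTuple_inl_last (by simp only [hl]; omega),
      if_pos h2]
    ring
  · rw [if_neg h2]
    by_cases hi : i.val = 0
    · rw [topTuple_inr_zero (by simpa [hk] using hi),
        topTuple_inl (by simp only [hl]; have := hg.one_lt; omega), if_pos hi]
      ring
    · rw [if_neg hi, topTuple_inr (by simpa [hk] using hi)]
      by_cases hin : i.val + 2 = n
      · rw [if_pos hin, topTuple_inl_last (by simp only [hl]; omega)]; ring
      · rw [if_neg hin, topTuple_inl (by simp only [hl]; omega)]; ring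

theorem coroot_inr_lie_topVec (s : ℤ) (i : Fin (2 - 1)) :
    ⁅((0 : sl (Fin n) ℂ), coroot i), topVec hg s⁆ = weightA n a₁ a₂ s i • topVec hg s := by
  obtain rfl : i = 0 := Fin.ext (by omega)
  apply inclN_injective
  have h1 : scalarBlocks n (coroot (n := 2) 0).val = Matrix.diagonal (Sum.elim 1 (-1)) := by
    rw [coroot, val_singleSubSingle]
    ext (a | a) (b | b) <;> by_cases hab : a = b <;> simp [scalarBlocks, hab]
  rw [inclN_lie, embPair_inr, h1, map_smul, inclN_topVec, matAct_diagonal_mono]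
  congr 1
  have hn := hg.one_lt
  rw [Fintype.sum_sum_type, weightA]
  have s1 : ∑ i : Fin n, topTuple n a₁ a₂ s (Sum.inl i) = a₁ + s - ((n : ℂ) - 1) := by
    rw [Finset.sum_congr rfl (g := fun i : Fin n =>
      (if i = ⟨n - 1, by omega⟩ then a₁ + s + 1 else 0) - 1)]
    · rw [Finset.sum_sub_distrib, Finset.sum_ite_eq' Finset.univ, if_pos (Finset.mem_univ _)]
      simp; ring
    · intro i _
      by_cases hi : i.val + 1 = n
      · rw [topTuple_inl_last hi, if_pos (Fin.ext (by simp only; omega))]; ring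
      · rw [topTuple_inl hi, if_neg (fun h => hi (by rw [h]; simp only; omega))]; ring
  have s2 : ∑ j : Fin n, topTuple n a₁ a₂ s (Sum.inr j) = a₂ - s := by
    rw [Finset.sum_eq_single ⟨0, by omega⟩ (fun j _ hj => topTuple_inr
      (fun h => hj (Fin.ext h)) s) (by simp), topTuple_inr_zero rfl]
  simp only [Sum.elim_inl, Sum.elim_inr, Pi.one_apply, Pi.neg_apply, one_mul, neg_mul,
    Finset.sum_neg_distrib, s1, s2]
  ring

theorem weightB_injective : Function.Injective (weightB n a₁ a₂) := by
  intro s t h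
  have hn := hg.one_lt
  have h1 := congrFun h ⟨0, by omega⟩
  simp only [weightB] at h1
  have h2 : (s : ℂ) = t := by
    split_ifs at h1
    · linear_combination -h1 / 2
    · linear_combination -h1
  exact_mod_cast h2

theorem isHighestWeight_topVec (s : ℤ) : IsHighestWeight (gradElt n) (topVec hg s) := by
  have hn := hg.one_lt
  refine isHighestWeight_pairElt (by omega) (isGradingElement_rhoElt (by omega))
    (isHighestWeight_rhoElt (by omega) (topVec_ne_zero hg s) (lam := weightB n a₁ a₂ s)
      (single_inl_lie_topVec hg s) (coroot_inl_lie_topVec hg s))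
    (isHighestWeight_rhoElt (by omega) (topVec_ne_zero hg s) (lam := weightA n a₁ a₂ s)
      (single_inr_lie_topVec hg s) (coroot_inr_lie_topVec hg s))

theorem vermaGen_weightB_ne_zero (s : ℤ) : vermaGen (weightB n a₁ a₂ s) ≠ 0 :=
  have h0 : (toResFst (topVec hg s) : ResFst (sl (Fin n) ℂ) (sl (Fin 2) ℂ) (NRes n a₁ a₂)) ≠ 0 :=
    topVec_ne_zero hg s
  vermaGen_ne_zero h0 (single_inl_lie_topVec hg s) (coroot_inl_lie_topVec hg s)

theorem vermaGen_weightA_ne_zero (s : ℤ) : vermaGen (weightA n a₁ a₂ s) ≠ 0 :=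
  have h0 : (toResSnd (topVec hg s) : ResSnd (sl (Fin n) ℂ) (sl (Fin 2) ℂ) (NRes n a₁ a₂)) ≠ 0 :=
    topVec_ne_zero hg s
  vermaGen_ne_zero h0 (single_inr_lie_topVec hg s) (coroot_inr_lie_topVec hg s)

theorem gradElt_lie_topVec (s : ℤ) :
    ⁅gradElt n, topVec hg s⁆ = topEig n a₁ a₂ • topVec hg s := by
  rw [topVec, gradElt_lie_monoN hg.one_lt, deg_topTuple, sub_zero]

/-! ### The simple constituents of `N` -/

/-- The submodule of `N` generated by a highest weight vector. -/
def constituent (s : ℤ) : LieSubmodule ℂ (sl (Fin n) ℂ × sl (Fin 2) ℂ) (NRes n a₁ a₂) :=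
  LieSubmodule.lieSpan ℂ _ {topVec hg s}

theorem topVec_mem (s : ℤ) : topVec hg s ∈ constituent hg s := LieSubmodule.subset_lieSpan rfl

/-- Apart from the multiples of `topVec hg s`, the constituent lives in positive degrees, so no other
highest weight vector occurs in its elements. -/
theorem coeff_eq_zero_of_mem_constituent {s t : ℤ} (hst : t ≠ s) {f : NRes n a₁ a₂}
    (hf : f ∈ constituent hg s) : coeff (topTuple n a₁ a₂ t) (inclN f) = 0 := by
  have h1 := (isHighestWeight_topVec hg s).lieSpan_le (isGradingElement_gradElt hg.one_lt)
    (gradElt_lie_topVec hg s) hf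
  obtain ⟨x, hx, y, hy, rfl⟩ := Submodule.mem_sup.1 h1
  obtain ⟨c, rfl⟩ := Submodule.mem_span_singleton.1 hx
  rw [map_add, map_add, coeff_eq_zero_of_mem_tail hg.one_lt hy (deg_topTuple t), map_smul,
    map_smul, coeff_topVec, if_neg hst.symm, smul_zero, add_zero]

theorem eq_of_topVec_mem {s t : ℤ} (h : topVec hg t ∈ constituent hg s) : t = s := by
  by_contra hst
  have := coeff_eq_zero_of_mem_constituent hg hst h
  rw [coeff_topVec, if_pos rfl] at this
  exact one_ne_zero this

theorem mem_span_topVec_of_isSingular {f : NRes n a₁ a₂} (hf : IsSingular (gradElt n) f) :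
    f ∈ Submodule.span ℂ (Set.range (topVec hg)) := by
  have h1 : (inclN f : Mono (Fin n ⊕ Fin n)) ∈
      Submodule.span ℂ (mono '' Set.range (topTuple n a₁ a₂)) := by
    have h2 : (inclN f : (Fin n ⊕ Fin n → ℂ) →₀ ℂ) ∈
        Finsupp.supported ℂ ℂ (Set.range (topTuple n a₁ a₂)) := by
      refine (Finsupp.mem_supported ℂ _).2 fun b hb => ?_
      have hb0 : coeff b (inclN f) ≠ 0 := Finsupp.mem_support_iff.1 hb
      have hbA := mem_admSet_of_coeff_ne_zero f hb0
      obtain ⟨s, rfl⟩ := exists_eq_topTuple hg.one_lt hbA (by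
        by_contra hd
        exact hb0 (coeff_eq_zero_of_isSingular hg.one_lt hg.left hg.right hg.diff hf hbA hd))
      exact ⟨s, rfl⟩
    exact (Finsupp.supported_eq_span_single ℂ (Set.range (topTuple n a₁ a₂))).le h2
  have h3 : mono '' Set.range (topTuple n a₁ a₂) = inclN '' Set.range (topVec hg) := by
    rw [← Set.range_comp, ← Set.range_comp]; rfl
  rw [h3, ← Submodule.map_span] at h1
  obtain ⟨g, hg', hgf⟩ := h1
  rwa [← inclN_injective hgf]

/-- Every nonzero submodule of `N` contains one of the highest weight vectors, as these have
distinct weights for `sl_2`. -/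
theorem exists_topVec_mem
    {P : LieSubmodule ℂ (sl (Fin n) ℂ × sl (Fin 2) ℂ) (NRes n a₁ a₂)} (hP : P ≠ ⊥) :
    ∃ s, topVec hg s ∈ P := by
  obtain ⟨f, hfP, hf0, hf⟩ := exists_singular (iSup_layer_NRes hg.one_lt) P hP
  have hspan := mem_span_topVec_of_isSingular hg hf
  let T := LieModule.toEnd ℂ (sl (Fin n) ℂ × sl (Fin 2) ℂ) (NRes n a₁ a₂) (0, coroot 0)
  have hT : ∀ s, T (topVec hg s) = weightA n a₁ a₂ s 0 • topVec hg s :=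
    fun s => coroot_inr_lie_topVec hg s 0
  have hw : ∀ {s t : ℤ}, s ≠ t → weightA n a₁ a₂ s 0 ≠ weightA n a₁ a₂ t 0 := by
    intro s t hst h
    exact hst (weightA_injective (funext fun i => by rwa [show i = 0 from Fin.ext (by omega)]))
  have hex : ∃ s, coeff (topTuple n a₁ a₂ s) (inclN f) ≠ 0 := by
    by_contra! hall
    refine hf0 (inclN_injective ?_)
    rw [map_zero]
    refine Finsupp.ext fun b => ?_
    change coeff b (inclN f) = 0
    by_contra hb
    obtain ⟨s, rfl⟩ := exists_eq_topTuple hg.one_lt (mem_admSet_of_coeff_ne_zero f hb) (by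
      by_contra hd
      exact hb (coeff_eq_zero_of_isSingular hg.one_lt hg.left hg.right hg.diff hf
        (mem_admSet_of_coeff_ne_zero f hb) hd))
    exact hb (hall s)
  obtain ⟨s, hs⟩ := hex
  refine ⟨s, ?_⟩
  have hy : f - coeff (topTuple n a₁ a₂ s) (inclN f) • topVec hg s ∈
      ⨆ (ν : ℂ) (_ : ν ≠ weightA n a₁ a₂ s 0), T.eigenspace ν := by
    refine Submodule.span_induction (p := fun f _ =>
      f - coeff (topTuple n a₁ a₂ s) (inclN f) • topVec hg s ∈
      ⨆ (ν : ℂ) (_ : ν ≠ weightA n a₁ a₂ s 0), T.eigenspace ν) ?_ ?_ ?_ ?_ hspan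
    · rintro _ ⟨t, rfl⟩
      rw [coeff_topVec]
      split_ifs with h
      · rw [h, one_smul, sub_self]; exact Submodule.zero_mem _
      · rw [zero_smul, sub_zero]
        exact Submodule.mem_iSup_of_mem _ (Submodule.mem_iSup_of_mem (hw h)
          (Module.End.mem_eigenspace_iff.2 (hT t)))
    · simp
    · intro f g _ _ hf hg
      have := Submodule.add_mem _ hf hg
      rwa [sub_add_sub_comm, ← add_smul, ← map_add, ← map_add] at this
    · intro c f _ hf
      have := Submodule.smul_mem _ c hf
      rwa [smul_sub, smul_smul, ← smul_eq_mul c, ← map_smul, ← map_smul] at this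
  have h1 := mem_of_add_mem_eigenspaces T P.toSubmodule (fun x hx => P.lie_mem hx)
    (weightA n a₁ a₂ s 0)
    (x := coeff (topTuple n a₁ a₂ s) (inclN f) • topVec hg s) (by rw [map_smul, hT, smul_comm])
    hy (by rw [add_sub_cancel]; exact hfP)
  exact (Submodule.smul_mem_iff _ hs).1 h1

/-- A nonzero submodule of a constituent contains a highest weight vector of `N`, which must be the
generator. -/
theorem isIrreducible_constituent (s : ℤ) :
    LieModule.IsIrreducible ℂ (sl (Fin n) ℂ × sl (Fin 2) ℂ) (constituent hg s) := by
  have : Nontrivial (constituent hg s) :=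
    ⟨⟨⟨_, topVec_mem hg s⟩, 0, fun h => topVec_ne_zero hg s (congrArg Subtype.val h)⟩⟩
  refine LieModule.IsIrreducible.mk fun P hP => ?_
  obtain ⟨f, hf, hf0⟩ := exists_mem_ne_zero hP
  have hP' : P.map (constituent hg s).incl ≠ ⊥ := by
    intro h
    have h1 : (f : NRes n a₁ a₂) ∈ P.map (constituent hg s).incl := LieSubmodule.mem_map_of_mem hf
    rw [h, LieSubmodule.mem_bot] at h1
    exact hf0 (Subtype.ext h1)
  obtain ⟨t, ht⟩ := exists_topVec_mem hg hP'
  have hle : P.map (constituent hg s).incl ≤ constituent hg s := LieSubmodule.map_incl_le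
  obtain rfl := eq_of_topVec_mem hg (hle ht)
  have hge : constituent hg t ≤ P.map (constituent hg t).incl :=
    LieSubmodule.lieSpan_le.2 (by simpa using ht)
  rw [eq_top_iff]
  rintro g -
  obtain ⟨g', hg', h⟩ := (LieSubmodule.mem_map _).1 (hge g.2)
  rwa [← (Subtype.ext h : g' = g)]

theorem coeff_eq_zero_of_mem_iSup {s : ℤ} {f : NRes n a₁ a₂}
    (hf : f ∈ ⨆ (t : ℤ) (_ : t ≠ s), (constituent hg t).toSubmodule) :
    coeff (topTuple n a₁ a₂ s) (inclN f) = 0 := by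
  have h : (⨆ (t : ℤ) (_ : t ≠ s), (constituent hg t).toSubmodule) ≤
      LinearMap.ker (coeff (topTuple n a₁ a₂ s) ∘ₗ inclN) :=
    iSup₂_le fun t ht f hf => coeff_eq_zero_of_mem_constituent hg ht.symm hf
  exact h hf

/-- A nonzero intersection of a constituent with the sum of the others would contain a highest weight
vector. -/
theorem iSupIndep_constituent : iSupIndep fun s => (constituent hg s).toSubmodule := by
  intro s
  rw [disjoint_iff, Submodule.eq_bot_iff]
  intro f hf
  by_contra h0
  let P : LieSubmodule ℂ (sl (Fin n) ℂ × sl (Fin 2) ℂ) (NRes n a₁ a₂) :=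
    constituent hg s ⊓ ⨆ (t : ℤ) (_ : t ≠ s), constituent hg t
  have hPc : P.toSubmodule = (constituent hg s).toSubmodule ⊓
      ⨆ (t : ℤ) (_ : t ≠ s), (constituent hg t).toSubmodule := by
    simp only [P, LieSubmodule.inf_toSubmodule, LieSubmodule.iSup_toSubmodule]
  have hP : P ≠ ⊥ := by
    intro h
    have h1 : f ∈ P.toSubmodule := by rw [hPc]; exact hf
    rw [h] at h1
    exact h0 h1
  obtain ⟨t, ht⟩ := exists_topVec_mem hg hP
  have ht' : topVec hg t ∈ P.toSubmodule := ht
  rw [hPc] at ht'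
  obtain rfl := eq_of_topVec_mem hg ht'.1
  have := coeff_eq_zero_of_mem_iSup hg ht'.2
  rw [coeff_topVec, if_pos rfl] at this
  exact one_ne_zero this

/-- By induction on the degree, every `x(b)` lies in the sum of the constituents: modulo this sum the
images of the lowering operators vanish. -/
theorem iSup_constituent : ⨆ s, (constituent hg s).toSubmodule = ⊤ := by
  let S : LieSubmodule ℂ (sl (Fin n) ℂ × sl (Fin 2) ℂ) (NRes n a₁ a₂) := ⨆ s, constituent hg s
  have hS : S.toSubmodule = ⨆ s, (constituent hg s).toSubmodule := by
    simp only [S, LieSubmodule.iSup_toSubmodule]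
  let K := S.toSubmodule.map inclN
  have hK : ∀ f : NRes n a₁ a₂, K.mkQ (inclN f) = 0 ↔ f ∈ S := by
    intro f
    rw [Submodule.mkQ_apply, Submodule.Quotient.mk_eq_zero]
    refine ⟨?_, fun h => ⟨f, h, rfl⟩⟩
    rintro ⟨g, hg', h⟩
    rwa [← inclN_injective h]
  have key : ∀ (m : ℕ) (b) (hb : b ∈ admSet (expTuple n a₁ a₂)), deg a₁ a₂ b = m →
      monoN b hb ∈ S := by
    intro m
    induction m using Nat.strong_induction_on with
    | _ m ih =>
    intro b hb hd
    rcases Nat.eq_zero_or_pos m with rfl | hm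
    · obtain ⟨s, rfl⟩ := exists_eq_topTuple hg.one_lt hb (by simpa using hd)
      exact LieSubmodule.mem_iSup_of_mem s (topVec_mem hg s)
    · have hlow : ∀ (r : ℤ), 0 < r → ∀ (b) (hb : b ∈ admSet (expTuple n a₁ a₂)),
          deg a₁ a₂ b = m - r → monoN b hb ∈ S := by
        intro r hr b hb hd
        obtain ⟨k, hk⟩ := exists_nat_deg hb
        refine ih k ?_ b hb hk
        have : (k : ℤ) = m - r := by rw [hk] at hd; exact_mod_cast hd
        omega
      rw [← hK]
      refine apply_mono_eq_zero hg.one_lt hg.left hg.right hg.diff K.mkQ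
        (by rw [hd]; exact_mod_cast hm.ne') ?_ ?_ b hb rfl
      · intro i j hij b' hb' hd'
        have h1 := hlow ((j.val : ℤ) - i.val) (by have := Fin.lt_def.1 hij; omega) b' hb'
          (by rw [hd', hd]; push_cast; rfl)
        have h2 := (hK _).2 (S.lie_mem (x := (single j i hij.ne' (1 : ℂ), 0)) h1)
        rwa [inclN_lie, embPair_inl, val_single] at h2
      · intro b' hb' hd'
        have h1 := hlow ((n : ℤ) - 1) (by have := hg.one_lt; omega) b' hb'
          (by rw [hd', hd]; push_cast; rfl)
        have h2 := (hK _).2 (S.lie_mem (x := (0, single 1 0 one_ne_zero (1 : ℂ))) h1)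
        rwa [inclN_lie, embPair_inr, val_single] at h2
  rw [← hS, eq_top_iff]
  rintro f -
  induction f using NRes_induction with
  | zero => exact Submodule.zero_mem _
  | add f g hf hg => exact Submodule.add_mem _ hf hg
  | smul c f hf => exact Submodule.smul_mem _ c hf
  | mono b hb =>
    obtain ⟨m, hm⟩ := exists_nat_deg hb
    exact key m b hb hm

theorem nonempty_constituent_equiv (s : ℤ) :
    Nonempty (ExtTensor (SimpleHW (weightB n a₁ a₂ s)) (SimpleHW (weightA n a₁ a₂ s))
      ≃ₗ⁅ℂ, sl (Fin n) ℂ × sl (Fin 2) ℂ⁆ constituent hg s) := by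
  have hn := hg.one_lt
  have hv := isHighestWeight_hwVec (by omega) (vermaGen_weightB_ne_zero hg s)
  have hw := isHighestWeight_hwVec (by omega) (vermaGen_weightA_ne_zero hg s)
  have := isIrreducible_simpleHW (by omega) (vermaGen_weightB_ne_zero hg s)
  have := isIrreducible_simpleHW (by omega) (vermaGen_weightA_ne_zero hg s)
  have := isIrreducible_extTensor (isGradingElement_rhoElt (by omega))
    (isGradingElement_rhoElt (by omega)) hv hw
  have := isIrreducible_constituent hg s
  have hN := isHighestWeight_topVec hg s
  refine nonempty_equiv_of_isHighestWeight (isGradingElement_gradElt hn)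
    (isHighestWeight_extMk (by omega) (isGradingElement_rhoElt (by omega)) hv hw)
    (w := ⟨topVec hg s, topVec_mem hg s⟩) ⟨fun h => hN.ne_zero (congrArg Subtype.val h),
      fun r hr x hx => Subtype.ext (hN.isSingular r hr x hx), fun x hx => ?_⟩ fun x hx => ?_
  · obtain ⟨c, hc⟩ := hN.exists_smul x hx
    exact ⟨c, Subtype.ext hc⟩
  · obtain ⟨h1, h2⟩ := of_mem_gr_pairElt (by omega) (isGradingElement_rhoElt (by omega)) hx
    have h2' : x.2 ∈ gr (rhoElt 2) 0 := by
      rcases h2 with h2 | ⟨t, h3, h2⟩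
      · rw [h2]; exact Submodule.zero_mem _
      · have h4 : t = 0 := by
          rcases mul_eq_zero.1 h3 with h5 | h5
          · omega
          · exact h5
        rwa [← h4]
    obtain ⟨c, hc, hc'⟩ := exists_smul_of_coroot (by omega)
      (V := ResFst (sl (Fin n) ℂ) (sl (Fin 2) ℂ) (NRes n a₁ a₂)) (v := toResFst (topVec hg s))
      (coroot_inl_lie_topVec hg s) (coroot_lie_hwVec (weightB n a₁ a₂ s)) h1
    obtain ⟨d, hd, hd'⟩ := exists_smul_of_coroot (by omega)
      (V := ResSnd (sl (Fin n) ℂ) (sl (Fin 2) ℂ) (NRes n a₁ a₂)) (v := toResSnd (topVec hg s))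
      (coroot_inr_lie_topVec hg s) (coroot_lie_hwVec (weightA n a₁ a₂ s)) h2'
    refine ⟨c + d, ?_, Subtype.ext ?_⟩
    · rw [lie_extMk, hc', hd', map_smul, map_smul, LinearMap.smul_apply, add_smul]
    · change ⁅x, topVec hg s⁆ = (c + d) • topVec hg s
      have e1 : ⁅(x.1, (0 : sl (Fin 2) ℂ)), topVec hg s⁆ = c • topVec hg s := hc
      have e2 : ⁅((0 : sl (Fin n) ℂ), x.2), topVec hg s⁆ = d • topVec hg s := hd
      rw [lie_eq_add, e1, e2, add_smul]

omit hg in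
/-- An internal direct sum decomposition into submodules isomorphic to given modules gives an
isomorphism of Lie modules with the external direct sum. -/
theorem nonempty_directSum_equiv_of_isInternal {L M ι : Type} [LieRing L] [LieAlgebra ℂ L]
    [AddCommGroup M] [Module ℂ M] [LieRingModule L M] [LieModule ℂ L M] [DecidableEq ι]
    (C : ι → LieSubmodule ℂ L M) (hC : DirectSum.IsInternal fun s => (C s).toSubmodule)
    {A : ι → Type} [∀ s, AddCommGroup (A s)] [∀ s, Module ℂ (A s)] [∀ s, LieRingModule L (A s)]
    [∀ s, LieModule ℂ L (A s)] (e : ∀ s, A s ≃ₗ⁅ℂ, L⁆ C s) :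
    Nonempty (M ≃ₗ⁅ℂ, L⁆ ⨁ s, A s) := by
  let F : (⨁ s, A s) →ₗ[ℂ] M :=
    DirectSum.toModule ℂ ι M fun s => (C s).toSubmodule.subtype ∘ₗ (e s).toLinearEquiv.toLinearMap
  have hFof : ∀ s v, F (DirectSum.lof ℂ ι A s v) = (e s v : M) := by
    intro s v
    simp only [F, DirectSum.toModule_lof]
    rfl
  have hF : Function.Bijective F := by
    have h2 : Function.Bijective (DirectSum.coeLinearMap fun s => (C s).toSubmodule) := hC
    let G : (⨁ s, A s) ≃ₗ[ℂ] ⨁ s, (C s).toSubmodule :=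
      DFinsupp.mapRange.linearEquiv fun s => (e s).toLinearEquiv
    have hG : ∀ s v, G (DirectSum.lof ℂ ι A s v) =
        DirectSum.lof ℂ ι (fun s => (C s).toSubmodule) s (e s v) := fun s v =>
      DFinsupp.mapRange_single (hf := fun s => (e s).toLinearEquiv.map_zero)
    have h4 : F = DirectSum.coeLinearMap (fun s => (C s).toSubmodule) ∘ₗ G.toLinearMap := by
      refine DirectSum.linearMap_ext ℂ fun s => LinearMap.ext fun v => ?_
      change F (DirectSum.lof ℂ ι A s v) =
        DirectSum.coeLinearMap (fun s => (C s).toSubmodule) (G (DirectSum.lof ℂ ι A s v))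
      rw [hFof, hG, DirectSum.coeLinearMap_lof]
    rw [h4]
    exact h2.comp G.bijective
  have hlie : ∀ (x : L) m, F ⁅x, m⁆ = ⁅x, F m⁆ := by
    intro x m
    induction m using DirectSum.induction_on with
    | zero => rw [lie_zero, map_zero, lie_zero]
    | add f g hf hg => rw [lie_add, map_add, hf, hg, map_add, lie_add]
    | of s v =>
      have h1 : ⁅x, DirectSum.lof ℂ ι A s v⁆ = DirectSum.lof ℂ ι A s ⁅x, v⁆ :=
        (LieModuleHom.map_lie (DirectSum.lieModuleOf ℂ ι L A s) x v).symm
      change F ⁅x, DirectSum.lof ℂ ι A s v⁆ = ⁅x, F (DirectSum.lof ℂ ι A s v)⁆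
      rw [h1, hFof, hFof]
      exact congrArg Subtype.val (LieModuleHom.map_lie (e s).toLieModuleHom x v)
  exact ⟨({ LinearEquiv.ofBijective F hF with map_lie' := hlie _ _ } : _ ≃ₗ⁅ℂ, L⁆ M).symm⟩

theorem nonempty_directSum_equiv :
    Nonempty (NRes n a₁ a₂ ≃ₗ⁅ℂ, sl (Fin n) ℂ × sl (Fin 2) ℂ⁆
      ⨁ b : ℤ, ExtTensor (SimpleHW (weightB n a₁ a₂ b)) (SimpleHW (weightA n a₁ a₂ b))) :=
  nonempty_directSum_equiv_of_isInternal (constituent hg)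
    (DirectSum.isInternal_submodule_of_iSupIndep_of_iSup_eq_top (iSupIndep_constituent hg)
      (iSup_constituent hg)) fun s => (nonempty_constituent_equiv hg s).some

theorem multiplicityFree_NRes :
    MultiplicityFree (sl (Fin n) ℂ × sl (Fin 2) ℂ) (NRes n a₁ a₂) := by
  -- a simple submodule is generated by any of the highest weight vectors which it contains
  have hgen : ∀ P : LieSubmodule ℂ (sl (Fin n) ℂ × sl (Fin 2) ℂ) (NRes n a₁ a₂),
      LieModule.IsIrreducible ℂ (sl (Fin n) ℂ × sl (Fin 2) ℂ) P → ∃ s, P = constituent hg s := by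
    intro P hP
    have hP0 : P ≠ ⊥ := by
      rintro rfl
      exact bot_ne_top (α := LieSubmodule ℂ (sl (Fin n) ℂ × sl (Fin 2) ℂ)
        (⊥ : LieSubmodule ℂ (sl (Fin n) ℂ × sl (Fin 2) ℂ) (NRes n a₁ a₂)))
        (Subsingleton.elim _ _)
    obtain ⟨s, hs⟩ := exists_topVec_mem hg hP0
    have hle : constituent hg s ≤ P := LieSubmodule.lieSpan_le.2 (by simpa using hs)
    have htop : (constituent hg s).comap P.incl = ⊤ := eq_top_of_ne_zero _
      (f := ⟨topVec hg s, hs⟩) (topVec_mem hg s)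
      fun h => topVec_ne_zero hg s (congrArg Subtype.val h)
    exact ⟨s, le_antisymm (LieSubmodule.comap_incl_eq_top.1 htop) hle⟩
  rintro P Q hP hQ ⟨e⟩
  obtain ⟨s, rfl⟩ := hgen P hP
  obtain ⟨t, rfl⟩ := hgen Q hQ
  have hlie : ∀ x m, e ⁅x, m⁆ = ⁅x, e m⁆ := fun x m => LieModuleHom.map_lie e.toLieModuleHom x m
  -- the image of the highest weight vector is a multiple of the other one
  let v : constituent hg s := ⟨topVec hg s, topVec_mem hg s⟩
  let w : constituent hg t := ⟨topVec hg t, topVec_mem hg t⟩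
  have hw : IsHighestWeight (gradElt n) w :=
    let h := isHighestWeight_topVec hg t
    ⟨fun h0 => h.ne_zero (congrArg Subtype.val h0), fun r hr x hx =>
      Subtype.ext (h.isSingular r hr x hx), fun x hx =>
      let ⟨c, hc⟩ := h.exists_smul x hx
      ⟨c, Subtype.ext hc⟩⟩
  obtain ⟨c, hc⟩ := hw.singular_mem_span (isGradingElement_gradElt hg.one_lt) (f := e v)
    fun r hr x hx => by
      rw [← hlie, show ⁅x, v⁆ = 0 from
        Subtype.ext ((isHighestWeight_topVec hg s).isSingular r hr x hx)]
      exact e.toLinearEquiv.map_zero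
  have hne : e v ≠ 0 := fun h =>
    topVec_ne_zero hg s (congrArg Subtype.val (e.toLinearEquiv.map_eq_zero_iff.1 h))
  have hs : ∀ i, ⁅((0 : sl (Fin n) ℂ), coroot i), v⁆ = weightA n a₁ a₂ s i • v :=
    fun i => Subtype.ext (coroot_inr_lie_topVec hg s i)
  have ht : ∀ i, ⁅((0 : sl (Fin n) ℂ), coroot i), w⁆ = weightA n a₁ a₂ t i • w :=
    fun i => Subtype.ext (coroot_inr_lie_topVec hg t i)
  have hst : weightA n a₁ a₂ s = weightA n a₁ a₂ t := by
    funext i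
    have h1 : weightA n a₁ a₂ s i • e v = weightA n a₁ a₂ t i • e v := by
      rw [← show e (weightA n a₁ a₂ s i • v) = weightA n a₁ a₂ s i • e v from
        e.toLinearEquiv.map_smul _ _, ← hs, hlie, hc, lie_smul, ht, smul_comm]
    exact smul_left_injective ℂ hne h1
  rw [weightA_injective hst]

end TopVec

/-! ### The mutual commutants -/

section Commutants

open LieAlgebra.SpecialLinear (single val_single)

variable {n : ℕ}

theorem trace_fromBlocks (A B C D : Matrix (Fin n) (Fin n) ℂ) :
    Matrix.trace (Matrix.fromBlocks A B C D) = Matrix.trace A + Matrix.trace D := by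
  simp [Matrix.trace, Fintype.sum_sum_type]

theorem embB_injective (n : ℕ) : Function.Injective (embB n) := by
  intro A B h
  have h1 : Matrix.fromBlocks A.val 0 0 A.val = Matrix.fromBlocks B.val 0 0 B.val :=
    congrArg Subtype.val h
  exact Subtype.ext (Matrix.fromBlocks_inj.1 h1).1

theorem embA_injective (hn : 0 < n) : Function.Injective (embA n) := by
  intro M M' h
  have h1 : scalarBlocks n M.val = scalarBlocks n M'.val := congrArg Subtype.val h
  obtain ⟨h00, h01, h10, h11⟩ := Matrix.fromBlocks_inj.1 h1
  have key : ∀ c d : ℂ, c • (1 : Matrix (Fin n) (Fin n) ℂ) = d • 1 → c = d := by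
    intro c d hcd
    simpa using congrFun (congrFun hcd ⟨0, hn⟩) ⟨0, hn⟩
  apply Subtype.ext
  ext i j
  fin_cases i <;> fin_cases j
  exacts [key _ _ h00, key _ _ h01, key _ _ h10, key _ _ h11]

/-- The blocks of a matrix which commutes with `𝔟` commute with all `E_{ij}`, `i ≠ j`, so they are
scalar. A matrix which commutes with `E_{12}` and `E_{21}` in `𝔞` is of the form `diag(A, A)`. -/
theorem mutualCommutants_range (hn : 0 < n) :
    MutualCommutants (embB n).range (embA n).range := by
  constructor
  · intro x
    constructor
    · rintro ⟨M, rfl⟩ _ ⟨A, rfl⟩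
      rw [← lie_skew]
      exact neg_eq_zero.2 (emb_commute n A M)
    · intro h
      have hx := (Matrix.fromBlocks_toBlocks x.val).symm
      set A := x.val.toBlocks₁₁
      set B := x.val.toBlocks₁₂
      set C := x.val.toBlocks₂₁
      set D := x.val.toBlocks₂₂
      have hcomm : ∀ i j : Fin n, i ≠ j → Commute (Matrix.single i j (1 : ℂ)) A ∧
          Commute (Matrix.single i j (1 : ℂ)) B ∧ Commute (Matrix.single i j (1 : ℂ)) C ∧
          Commute (Matrix.single i j (1 : ℂ)) D := by
        intro i j hij
        have h1 : x.val * (embB n (single i j hij 1)).val -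
            (embB n (single i j hij 1)).val * x.val = 0 :=
          congrArg Subtype.val (h _ ⟨single i j hij 1, rfl⟩)
        have h2 : (embB n (single i j hij 1)).val =
            Matrix.fromBlocks (Matrix.single i j 1) 0 0 (Matrix.single i j 1) := rfl
        rw [hx, h2, sub_eq_zero, Matrix.fromBlocks_multiply, Matrix.fromBlocks_multiply,
          Matrix.fromBlocks_inj] at h1
        simp only [mul_zero, zero_mul, add_zero, zero_add] at h1
        exact ⟨h1.1.symm, h1.2.1.symm, h1.2.2.1.symm, h1.2.2.2.symm⟩
      obtain ⟨a, ha⟩ := Matrix.mem_range_scalar_of_commute_single fun i j hij => (hcomm i j hij).1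
      obtain ⟨b, hb⟩ := Matrix.mem_range_scalar_of_commute_single fun i j hij => (hcomm i j hij).2.1
      obtain ⟨c, hc⟩ :=
        Matrix.mem_range_scalar_of_commute_single fun i j hij => (hcomm i j hij).2.2.1
      obtain ⟨d, hd⟩ :=
        Matrix.mem_range_scalar_of_commute_single fun i j hij => (hcomm i j hij).2.2.2
      have htr : a + d = 0 := by
        have h1 : Matrix.trace x.val = 0 := x.2
        rw [hx, trace_fromBlocks, ← ha, ← hd, Matrix.scalar_apply, Matrix.scalar_apply,
          Matrix.trace_diagonal, Matrix.trace_diagonal, Finset.sum_const, Finset.sum_const,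
          ← smul_add, Finset.card_univ, Fintype.card_fin] at h1
        exact (smul_eq_zero.1 h1).resolve_left hn.ne'
      refine ⟨⟨!![a, b; c, d], ?_⟩, Subtype.ext ?_⟩
      · change Matrix.trace !![a, b; c, d] = 0
        simpa [Matrix.trace_fin_two] using htr
      · change scalarBlocks n !![a, b; c, d] = x.val
        rw [hx, ← ha, ← hb, ← hc, ← hd]
        simp [scalarBlocks, Matrix.smul_one_eq_diagonal]
  · intro x
    constructor
    · rintro ⟨A, rfl⟩ _ ⟨M, rfl⟩
      exact emb_commute n A M
    · intro h
      have hx := (Matrix.fromBlocks_toBlocks x.val).symm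
      set A := x.val.toBlocks₁₁
      set B := x.val.toBlocks₁₂
      set C := x.val.toBlocks₂₁
      set D := x.val.toBlocks₂₂
      have h1 : x.val * (embA n (single 0 1 zero_ne_one 1)).val =
          (embA n (single 0 1 zero_ne_one 1)).val * x.val :=
        sub_eq_zero.1 (congrArg Subtype.val (h _ ⟨single 0 1 zero_ne_one 1, rfl⟩))
      have h2 : x.val * (embA n (single 1 0 one_ne_zero 1)).val =
          (embA n (single 1 0 one_ne_zero 1)).val * x.val :=
        sub_eq_zero.1 (congrArg Subtype.val (h _ ⟨single 1 0 one_ne_zero 1, rfl⟩))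
      have e1 : (embA n (single 0 1 zero_ne_one 1)).val = Matrix.fromBlocks 0 1 0 0 := by
        change scalarBlocks n (Matrix.single 0 1 1) = _
        simp [scalarBlocks]
      have e2 : (embA n (single 1 0 one_ne_zero 1)).val = Matrix.fromBlocks 0 0 1 0 := by
        change scalarBlocks n (Matrix.single 1 0 1) = _
        simp [scalarBlocks]
      rw [hx, e1, Matrix.fromBlocks_multiply, Matrix.fromBlocks_multiply,
        Matrix.fromBlocks_inj] at h1
      rw [hx, e2, Matrix.fromBlocks_multiply, Matrix.fromBlocks_multiply,
        Matrix.fromBlocks_inj] at h2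
      simp only [mul_zero, zero_mul, add_zero, zero_add, mul_one, one_mul] at h1 h2
      have hC : C = 0 := h1.1.symm
      have hAD : A = D := h1.2.1
      have hB : B = 0 := h2.1
      have htr : Matrix.trace A = 0 := by
        have h1 : Matrix.trace x.val = 0 := x.2
        rw [hx, trace_fromBlocks, ← hAD] at h1
        exact add_self_eq_zero.1 h1
      refine ⟨⟨A, htr⟩, Subtype.ext ?_⟩
      change Matrix.fromBlocks A 0 0 A = x.val
      rw [hx, hB, hC, ← hAD]

end Commutants

end DualPairSL

end

theorem mainTheorem1 (n : ℕ) (hn : 1 < n) (a₁ a₂ : ℂ)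
    (h₁ : ∀ k : ℤ, a₁ ≠ k) (h₂ : ∀ k : ℤ, a₂ ≠ k) (h₁₂ : ∀ k : ℤ, a₁ - a₂ ≠ k) :
    -- the two embedded algebras `𝔟 ≅ sl_n` and `𝔞 ≅ sl_2` are the commutant of each other
    (Function.Injective (embB n) ∧ Function.Injective (embA n) ∧
      MutualCommutants (embB n).range (embA n).range) ∧
    -- the decomposition
    Nonempty (NRes n a₁ a₂ ≃ₗ⁅ℂ, sl (Fin n) ℂ ×
        sl (Fin 2) ℂ⁆
      ⨁ b : ℤ, ExtTensor (SimpleHW (weightB n a₁ a₂ b)) (SimpleHW (weightA n a₁ a₂ b))) ∧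
    -- the modules which occur are simple
    (∀ b : ℤ,
      LieModule.IsIrreducible ℂ (sl (Fin n) ℂ)
        (SimpleHW (weightB n a₁ a₂ b)) ∧
      LieModule.IsIrreducible ℂ (sl (Fin 2) ℂ)
        (SimpleHW (weightA n a₁ a₂ b)) ∧
      LieModule.IsIrreducible ℂ (sl (Fin n) ℂ ×
          sl (Fin 2) ℂ)
        (ExtTensor (SimpleHW (weightB n a₁ a₂ b)) (SimpleHW (weightA n a₁ a₂ b)))) ∧
    -- the restriction is multiplicity free
    MultiplicityFree (sl (Fin n) ℂ ×
      sl (Fin 2) ℂ) (NRes n a₁ a₂) ∧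
    -- the correspondence between the two families of simple modules is one-to-one
    (∀ b b' : ℤ,
      (Nonempty (SimpleHW (weightB n a₁ a₂ b) ≃ₗ⁅ℂ, sl (Fin n) ℂ⁆
        SimpleHW (weightB n a₁ a₂ b')) → b = b') ∧
      (Nonempty (SimpleHW (weightA n a₁ a₂ b) ≃ₗ⁅ℂ, sl (Fin 2) ℂ⁆
        SimpleHW (weightA n a₁ a₂ b')) → b = b')) := by
  have hg : Generic n a₁ a₂ := ⟨hn, h₁, h₂, h₁₂⟩
  have hn0 : 0 < n := by omega
  refine ⟨⟨embB_injective n, embA_injective hn0, mutualCommutants_range hn0⟩,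
    nonempty_directSum_equiv hg, fun b => ?_, multiplicityFree_NRes hg, fun b b' => ⟨?_, ?_⟩⟩
  · have iB := isIrreducible_simpleHW hn0 (vermaGen_weightB_ne_zero hg b)
    have iA := isIrreducible_simpleHW two_pos (vermaGen_weightA_ne_zero hg b)
    exact ⟨iB, iA, isIrreducible_extTensor (isGradingElement_rhoElt hn0)
      (isGradingElement_rhoElt two_pos)
      (isHighestWeight_hwVec hn0 (vermaGen_weightB_ne_zero hg b))
      (isHighestWeight_hwVec two_pos (vermaGen_weightA_ne_zero hg b))⟩
  · rintro ⟨e⟩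
    exact weightB_injective hg (weight_eq_of_equiv hn0 (vermaGen_weightB_ne_zero hg b)
      (vermaGen_weightB_ne_zero hg b') e)
  · rintro ⟨e⟩
    exact weightA_injective (weight_eq_of_equiv two_pos (vermaGen_weightA_ne_zero hg b)
      (vermaGen_weightA_ne_zero hg b') e)
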